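/- **Setting.** Let $0<r_{\min}<r_{\max}$, $\sigma>0$, $\alpha,a,b\in\mathbb R$, and $\Omega=(r_{\min},r_{\max})\times(0,2\pi)$ with points $(r,\psi)$. Write $\langle u,v\rangle=\frac1{2\pi(r_{\max}-r_{\min})}\int_\Omega u\,v^*\,dr\,d\psi$ and $\|u\|^2=\langle u,u\rangle$ for the scalar product and norm of $Y=L^2(\Omega)$ (complex valued). Put $$\tilde\Delta=\partial_r^2+\tfrac4{r^2}\partial_\psi^2,\quad f(r)=\alpha r-ar^3+\tfrac{\sigma^2}{2r},\quad g(r,\psi)=2r^2\big(b+\sqrt{a^2+b^2}\cos\psi\big),\quad h=\partial_rf+\partial_\psi g,$$ $$V=f\partial_r+g\partial_\psi,\qquad L=\tfrac{\sigma^2}2\tilde\Delta+V,\qquad L^*=\tfrac{\sigma^2}2\tilde\Delta-V-h,\qquad C_V=\sqrt{\sup_\Omega f^2+\sup_\Omega\tfrac{r^2}4g^2}.$$ Let $X$ be the space of all $u\in H^2(\Omega)$ with $u=0$ at $r=r_{\min}$ and at $r=r_{\max}$ and with $u|_{\psi=0}=u|_{\psi=2\pi}$, $\partial_\psi u|_{\psi=0}=\partial_\psi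 u|_{\psi=2\pi}$ (traces). Let $\bar u\in X$, $\bar\lambda\in\mathbb R$, $\eta_L\in(0,1)$, $\eta_S\in(0,\|\bar u\|^2)$, and put $A=L-\bar\lambda$, $A^*=L^*-\bar\lambda$, $$S(u,\lambda)=(Au-\lambda\bar u,\ \langle u,\bar u\rangle),\qquad S^*(v,\kappa)=(A^*v+\kappa\bar u,\ -\langle v,\bar u\rangle),$$ $$\mathfrak s_2=(1-\eta_L)\tfrac{\sigma^4}4,\qquad \mathfrak s_1=\tfrac{1-\eta_L}{\eta_L}C_V^2-\bar\lambda\sigma^2,\qquad \mathfrak s_0=\bar\lambda^2+\inf_\Omega(\bar\lambda h)-\tfrac1{\eta_S}\|A^*\bar u\|^2,\qquad \mathfrak s_\lambda=\|\bar u\|^2-\eta_S.$$ For $s\in[0,1]$ let $\mathfrak S^{(s)}$ be the operator in $Y\times\mathbb C$ with domain $Z^{(s)}\times\mathbb C$, $$Z^{(s)}=\Big\{u\in H^4(\Omega)\cap X:\ \big(sL+(1-s)\tfrac{2\mathfrak s_2}{\sigma^2}\tilde\Delta\big)u\in X\Big\},$$ $$\mathfrak S^{(s)}=s\,S^*S+(1-s)\,\mathfrak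 S^{(0)},\qquad \mathfrak S^{(0)}=\begin{pmatrix}\mathfrak s_2\tilde\Delta^2+\mathfrak s_1\tilde\Delta+\mathfrak s_0&0\\0&\mathfrak s_\lambda\end{pmatrix},$$ where $S^*S$ and $\mathfrak S^{(0)}$ are read as differential expressions on $H^4(\Omega)\times\mathbb C$. **Proposition.** For every $s\in[0,1]$ all eigenvalues of $\mathfrak S^{(s)}$ are real and of finite multiplicity, and, counted with multiplicity, they form an infinite sequence $\lambda_1^{(s)}\le\lambda_2^{(s)}\le\cdots$ that tends to $+\infty$. Each of them is nondecreasing in $s$: for all $0\le s'\le s\le1$ and all $n\ge1$, $$\lambda_n^{(s')}\le\lambda_n^{(s)}.$$ -/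

import Mathlib

open MeasureTheory Set Filter Topology
open scoped ContDiff

noncomputable section

namespace ShearKolmogorov

/-! ### Linear operators with a domain -/

section Operators

variable {E F G : Type*} [AddCommGroup E] [Module ℂ E] [AddCommGroup F] [Module ℂ F]
  [AddCommGroup G] [Module ℂ G]

/-- The vectors `x` of the domain of `T` with `T x ∈ V`. -/
def preimage (T : E →ₗ.[ℂ] F) (V : Submodule ℂ F) : Submodule ℂ E :=
  (V.comap T.toFun).map T.domain.subtype

theorem preimage_le (T : E →ₗ.[ℂ] F) (V : Submodule ℂ F) : preimage T V ≤ T.domain := by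
  rintro _ ⟨x, -, rfl⟩
  exact x.2

theorem mem_of_mem_preimage (T : E →ₗ.[ℂ] F) (V : Submodule ℂ F) (x : E)
    (hx : x ∈ preimage T V) : T ⟨x, preimage_le T V hx⟩ ∈ V := by
  obtain ⟨y, hy, rfl⟩ := hx
  exact hy

/-- The composition `x ↦ T (R x)` on its natural domain
`{x ∈ dom R | R x ∈ dom T}`. -/
def compose (T : F →ₗ.[ℂ] G) (R : E →ₗ.[ℂ] F) : E →ₗ.[ℂ] G where
  domain := preimage R T.domain
  toFun := T.toFun.comp
    ((R.toFun.comp (Submodule.inclusion (preimage_le R T.domain))).codRestrict T.domain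
      (fun x => mem_of_mem_preimage R T.domain x.1 x.2))

/-- A linear map, as an operator that is defined everywhere. -/
def everywhere (T : E →ₗ[ℂ] F) : E →ₗ.[ℂ] F := T.toPMap ⊤

/-- Multiplication by a scalar. -/
def scalar (E : Type*) [AddCommGroup E] [Module ℂ E] (c : ℂ) : E →ₗ.[ℂ] E :=
  everywhere (c • LinearMap.id)

/-- The operator `(u, l) ↦ (T u, 0)` on `dom T × ℂ`. -/
def onFirst (T : E →ₗ.[ℂ] E) : E × ℂ →ₗ.[ℂ] E × ℂ where
  domain := T.domain.comap (LinearMap.fst ℂ E ℂ)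
  toFun := (LinearMap.inl ℂ E ℂ).comp
    (T.toFun.comp
      (((LinearMap.fst ℂ E ℂ).comp (Submodule.subtype _)).codRestrict T.domain (fun x => x.2)))

/-- The value of `T` at `x`, meant for `x` in the domain of `T` (and `0` elsewhere). -/
def value (T : E →ₗ.[ℂ] F) (x : E) : F :=
  open Classical in if hx : x ∈ T.domain then T ⟨x, hx⟩ else 0

/-- The eigenspace `{x ∈ dom T | T x = z x}`. -/
def eigenspace (T : E →ₗ.[ℂ] E) (z : ℂ) : Submodule ℂ E :=
  (LinearMap.ker (T.toFun - z • T.domain.subtype)).map T.domain.subtype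

/-- `l 0 ≤ l 1 ≤ l 2 ≤ …` are the eigenvalues of `T`, counted with multiplicity, and they
accumulate only at `+∞`: every complex number `z` occurs in the sequence exactly as often as the
(finite) dimension of its eigenspace says. In particular all eigenvalues of `T` are real. There is
at most one such sequence. -/
structure IsOrderedEigenvalues (T : E →ₗ.[ℂ] E) (l : ℕ → ℝ) : Prop where
  monotone : Monotone l
  tendsto : Tendsto l atTop atTop
  finite_multiplicity : ∀ z : ℂ, Module.Finite ℂ (eigenspace T z)
  multiplicity : ∀ z : ℂ, {n : ℕ | (l n : ℂ) = z}.encard = (Module.finrank ℂ (eigenspace T z) : ℕ∞)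

end Operators

/-! ### The domain, the coefficients and the space `L²` -/

/-- The parameters of the system: the two radii of the annulus, the linear rate `α`, the damping
`a`, the shear `b` and the noise strength `σ`. -/
structure Params where
  rmin : ℝ
  rmax : ℝ
  α : ℝ
  a : ℝ
  b : ℝ
  σ : ℝ

variable (p : Params)

/-- The rectangle `Ω = (rmin, rmax) × (0, 2π)`, with points `(r, ψ)`. -/
def Ω : Set (ℝ × ℝ) := Ioo p.rmin p.rmax ×ˢ Ioo 0 (2 * Real.pi)

/-- `f(r) = α r - a r³ + σ² / (2 r)`. -/
def f (x : ℝ × ℝ) : ℝ := p.α * x.1 - p.a * x.1 ^ 3 + p.σ ^ 2 / (2 * x.1)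

/-- `g(r, ψ) = 2 r² (b + √(a² + b²) cos ψ)`. -/
def g (x : ℝ × ℝ) : ℝ :=
  2 * x.1 ^ 2 * (p.b + Real.sqrt (p.a ^ 2 + p.b ^ 2) * Real.cos x.2)

/-- `h = ∂f/∂r + ∂g/∂ψ`. -/
def h (x : ℝ × ℝ) : ℝ :=
  p.α - 3 * p.a * x.1 ^ 2 - p.σ ^ 2 / (2 * x.1 ^ 2)
    - 2 * x.1 ^ 2 * Real.sqrt (p.a ^ 2 + p.b ^ 2) * Real.sin x.2

/-- `Y = L²(Ω)`, complex valued. -/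
abbrev Y : Type := Lp ℂ 2 (volume.restrict (Ω p))

/-- The functional `u ↦ ⟨u, w⟩ = (2π(rmax - rmin))⁻¹ ∫_Ω u w*`; the inner product of Mathlib is
conjugate linear in its first argument. -/
def pair (w : Y p) : Y p →ₗ[ℂ] ℂ :=
  (((2 * Real.pi * (p.rmax - p.rmin))⁻¹ : ℝ) : ℂ) • (innerSL ℂ w).toLinearMap

/-- The square `⟨u, u⟩` of the `L²` norm that belongs to `pair`. -/
def normSq (u : Y p) : ℝ := (pair p u u).re

/-! ### Weak derivatives, Sobolev spaces, boundary conditions -/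

/-- `∂φ/∂r`. -/
def dr (φ : ℝ × ℝ → ℝ) : ℝ × ℝ → ℝ := fun x => fderiv ℝ φ x (1, 0)

/-- `∂φ/∂ψ`. -/
def dpsi (φ : ℝ × ℝ → ℝ) : ℝ × ℝ → ℝ := fun x => fderiv ℝ φ x (0, 1)

/-- `∂_r^i ∂_ψ^j φ`. -/
def pd (i j : ℕ) (φ : ℝ × ℝ → ℝ) : ℝ × ℝ → ℝ := dr^[i] (dpsi^[j] φ)

theorem contDiff_pd (i j : ℕ) (φ : ℝ × ℝ → ℝ) (hφ : ContDiff ℝ ∞ φ) : ContDiff ℝ ∞ (pd i j φ) := by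
  have key : ∀ (v : ℝ × ℝ) (χ : ℝ × ℝ → ℝ), ContDiff ℝ ∞ χ →
      ContDiff ℝ ∞ (fun x => fderiv ℝ χ x v) := fun v χ hχ =>
    (hχ.fderiv_right (m := ∞) (by simp)).clm_apply contDiff_const
  have h2 : ContDiff ℝ ∞ (dpsi^[j] φ) := by
    induction j with
    | zero => exact hφ
    | succ j ih => rw [Function.iterate_succ_apply']; exact key _ _ ih
  unfold pd
  induction i with
  | zero => exact h2
  | succ i ih => rw [Function.iterate_succ_apply']; exact key _ _ ih

theorem integrable_pd_smul (i j : ℕ) (φ : ℝ × ℝ → ℝ) (hφ : ContDiff ℝ ∞ φ) (u : Y p) :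
    Integrable (fun x => pd i j φ x • u x) (volume.restrict (Ω p)) := by
  have hc : Continuous (pd i j φ) := (contDiff_pd i j φ hφ).continuous
  have hK : IsCompact (Icc p.rmin p.rmax ×ˢ Icc 0 (2 * Real.pi)) :=
    isCompact_Icc.prod isCompact_Icc
  have hsub : Ω p ⊆ Icc p.rmin p.rmax ×ˢ Icc 0 (2 * Real.pi) :=
    prod_mono Ioo_subset_Icc_self Ioo_subset_Icc_self
  have hfin : volume (Ω p) < ⊤ := (measure_mono hsub).trans_lt hK.measure_lt_top
  have : IsFiniteMeasure (volume.restrict (Ω p)) := ⟨by simpa using hfin⟩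
  obtain ⟨C, hC⟩ := hK.exists_bound_of_continuousOn hc.continuousOn
  have hu : Integrable (u : ℝ × ℝ → ℂ) (volume.restrict (Ω p)) :=
    (Lp.memLp u).integrable (by norm_num)
  refine hu.bdd_smul C hc.aestronglyMeasurable ?_
  refine (ae_restrict_iff' (measurableSet_Ioo.prod measurableSet_Ioo)).2 ?_
  exact Eventually.of_forall fun x hx => hC x (hsub hx)

/-- The pairs `(u, v)` in `L²(Ω)` that satisfy the integration by parts formula
`∫_Ω (∂_r^i ∂_ψ^j φ) u = (-1)^(i+j) ∫_Ω φ v` for all smooth `φ : ℝ² → ℝ` in the class `T`. -/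
def partsGraph (T : Set (ℝ × ℝ → ℝ)) (i j : ℕ) : Submodule ℂ (Y p × Y p) where
  carrier := {w | ∀ φ ∈ T, ContDiff ℝ ∞ φ →
    ∫ x in Ω p, pd i j φ x • w.1 x = (-1) ^ (i + j) * ∫ x in Ω p, φ x • w.2 x}
  zero_mem' := by
    intro φ _ _
    have h0 := Lp.coeFn_zero ℂ 2 (volume.restrict (Ω p))
    have e1 : ∫ x in Ω p, pd i j φ x • (0 : Y p) x = 0 :=
      integral_eq_zero_of_ae (h0.mono fun x hx => by beta_reduce; rw [hx]; simp)
    have e2 : ∫ x in Ω p, φ x • (0 : Y p) x = 0 :=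
      integral_eq_zero_of_ae (h0.mono fun x hx => by beta_reduce; rw [hx]; simp)
    simp only [Prod.fst_zero, Prod.snd_zero, e1, e2, mul_zero]
  add_mem' := by
    intro w z hw hz φ hT hφ
    have add (k l : ℕ) (u v : Y p) : ∫ x in Ω p, pd k l φ x • (u + v) x =
        (∫ x in Ω p, pd k l φ x • u x) + ∫ x in Ω p, pd k l φ x • v x := by
      rw [← integral_add (integrable_pd_smul p k l φ hφ u) (integrable_pd_smul p k l φ hφ v)]
      refine integral_congr_ae ((Lp.coeFn_add u v).mono fun x hx => ?_)
      beta_reduce; rw [hx, Pi.add_apply, smul_add]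
    have a0 := add 0 0 w.2 z.2
    have h1 := hw φ hT hφ
    have h2 := hz φ hT hφ
    simp only [pd, Function.iterate_zero, id_eq] at a0
    simp only [Prod.fst_add, Prod.snd_add]
    rw [add, a0, h1, h2, mul_add]
  smul_mem' := by
    intro c w hw φ hT hφ
    have sm (χ : ℝ × ℝ → ℝ) (u : Y p) : ∫ x in Ω p, χ x • (c • u) x =
        c * ∫ x in Ω p, χ x • u x := by
      rw [← integral_const_mul]
      refine integral_congr_ae ((Lp.coeFn_smul c u).mono fun x hx => ?_)
      simp [hx, mul_left_comm]
    simp only [Prod.smul_fst, Prod.smul_snd, sm]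
    rw [hw φ hT hφ]
    ring

/-- Test functions with compact support in `Ω`. -/
def interiorTests : Set (ℝ × ℝ → ℝ) := {φ | HasCompactSupport φ ∧ tsupport φ ⊆ Ω p}

/-- A weak derivative is unique, so that its graph defines an operator. -/
theorem partsGraph_unique (i j : ℕ) (w : Y p × Y p) (hw : w ∈ partsGraph p (interiorTests p) i j)
    (h0 : w.1 = 0) : w.2 = 0 := by
  have hopen : IsOpen (Ω p) := isOpen_Ioo.prod isOpen_Ioo
  have hfin : volume (Ω p) < ⊤ :=
    (measure_mono (Set.prod_mono Ioo_subset_Icc_self Ioo_subset_Icc_self)).trans_lt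
      ((isCompact_Icc (a := p.rmin) (b := p.rmax)).prod
        (isCompact_Icc (a := 0) (b := 2 * Real.pi))).measure_lt_top
  have : IsFiniteMeasure (volume.restrict (Ω p)) := ⟨by simpa using hfin⟩
  have hu : Integrable (w.2 : ℝ × ℝ → ℂ) (volume.restrict (Ω p)) :=
    (Lp.memLp w.2).integrable (by norm_num)
  have key := hopen.ae_eq_zero_of_integral_contDiff_smul_eq_zero (μ := volume) (f := w.2)
    (IntegrableOn.locallyIntegrableOn hu) (by
      intro φ h1 h2 h3
      have := hw φ ⟨h2, h3⟩ h1
      rw [h0] at this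
      have e1 : ∫ x in Ω p, pd i j φ x • (0 : Y p) x = 0 :=
        integral_eq_zero_of_ae ((Lp.coeFn_zero ℂ 2 (volume.restrict (Ω p))).mono fun x hx => by
          beta_reduce; rw [hx]; simp)
      rw [e1] at this
      have h4 : ∫ x in Ω p, φ x • w.2 x = 0 := by
        rcases neg_one_pow_eq_or ℂ (i + j) with h | h <;> simpa [h] using this.symm
      rw [← h4]
      symm
      apply setIntegral_eq_integral_of_forall_compl_eq_zero
      intro x hx
      have : φ x = 0 := by
        by_contra hne; exact hx (h3 (subset_tsupport _ hne))
      simp [this])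
  rw [Lp.eq_zero_iff_ae_eq_zero]
  exact (ae_restrict_iff' hopen.measurableSet).2 key

/-- The weak derivative `∂_r^i ∂_ψ^j` in `L²(Ω)`, with domain all `u ∈ L²(Ω)` that have such a
derivative in `L²(Ω)`. -/
def weakDeriv (i j : ℕ) : Y p →ₗ.[ℂ] Y p := (partsGraph p (interiorTests p) i j).toLinearPMap

/-- The Sobolev space `H^k(Ω)`. -/
def H (k : ℕ) : Submodule ℂ (Y p) := ⨅ (i : ℕ) (j : ℕ) (_ : i + j ≤ k), (weakDeriv p i j).domain

/-- Functions that vanish at `r = rmin` and at `r = rmax` in the sense of traces: integration by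
parts in `r` against an arbitrary smooth function on the plane leaves no boundary term. -/
def zeroTrace : Submodule ℂ (Y p) := (partsGraph p Set.univ 1 0).map (LinearMap.fst ℂ _ _)

/-- Functions whose traces at `ψ = 0` and at `ψ = 2π` agree: integration by parts in `ψ` against
an arbitrary smooth function that is `2π`-periodic in `ψ` leaves no boundary term. -/
def periodicTrace : Submodule ℂ (Y p) :=
  (partsGraph p {φ | ∀ r ψ : ℝ, φ (r, ψ + 2 * Real.pi) = φ (r, ψ)} 0 1).map (LinearMap.fst ℂ _ _)

/-- The space `X` of all `u ∈ H²(Ω)` that vanish at `r = rmin` and `r = rmax` and for which `u`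
and `∂u/∂ψ` are periodic: they take the same values at `ψ = 0` and at `ψ = 2π`. -/
def X : Submodule ℂ (Y p) :=
  H p 2 ⊓ zeroTrace p ⊓ periodicTrace p ⊓ preimage (weakDeriv p 0 1) (periodicTrace p)

/-! ### The differential operators -/

/-- Multiplication by the function `c`, on its natural domain in `L²(Ω)`. -/
def mult (c : ℝ × ℝ → ℝ) : Y p →ₗ.[ℂ] Y p where
  domain :=
    { carrier := {u | MemLp (fun x => c x • u x) 2 (volume.restrict (Ω p))}
      zero_mem' := by
        refine (memLp_congr_ae ?_).2 (MemLp.zero' (ε := ℂ))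
        exact (Lp.coeFn_zero ℂ 2 (volume.restrict (Ω p))).mono fun x hx => by beta_reduce; rw [hx]; simp
      add_mem' := by
        intro u v hu hv
        refine (memLp_congr_ae ?_).2 (MemLp.add hu hv)
        exact (Lp.coeFn_add u v).mono fun x hx => by beta_reduce; rw [hx]; exact smul_add _ _ _
      smul_mem' := by
        intro z u hu
        refine (memLp_congr_ae ?_).2 (MemLp.const_smul hu z)
        exact (Lp.coeFn_smul z u).mono fun x hx => by simp [hx, mul_left_comm] }
  toFun :=
    { toFun := fun u => MemLp.toLp (fun x => c x • u.1 x) u.2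
      map_add' := by
        intro u v
        rw [← MemLp.toLp_add]
        refine MemLp.toLp_congr _ _ ?_
        exact (Lp.coeFn_add u.1 v.1).mono fun x hx =>
          (congrArg (c x • ·) hx).trans (smul_add _ _ _)
      map_smul' := by
        intro z u
        rw [RingHom.id_apply, ← MemLp.toLp_const_smul]
        refine MemLp.toLp_congr _ _ ?_
        exact (Lp.coeFn_smul z u.1).mono fun x hx => by simp [hx, mul_left_comm] }

/-- `Δ̃ = ∂²/∂r² + (4/r²) ∂²/∂ψ²`. -/
def lap : Y p →ₗ.[ℂ] Y p :=
  weakDeriv p 2 0 + compose (mult p fun x => 4 / x.1 ^ 2) (weakDeriv p 0 2)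

/-- `V = f ∂/∂r + g ∂/∂ψ`. -/
def V : Y p →ₗ.[ℂ] Y p :=
  compose (mult p (f p)) (weakDeriv p 1 0) + compose (mult p (g p)) (weakDeriv p 0 1)

/-- The backward Kolmogorov operator `L = (σ²/2) Δ̃ + V`. -/
def L : Y p →ₗ.[ℂ] Y p := ((p.σ ^ 2 / 2 : ℝ) : ℂ) • lap p + V p

/-- The forward Kolmogorov operator `L* = (σ²/2) Δ̃ - V - h`, the formal adjoint of `L`. -/
def Lstar : Y p →ₗ.[ℂ] Y p := ((p.σ ^ 2 / 2 : ℝ) : ℂ) • lap p - V p - mult p (h p)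

variable (ubar : Y p) (lbar : ℝ)

/-- `A = L - lbar`. -/
def A : Y p →ₗ.[ℂ] Y p := L p - scalar (Y p) lbar

/-- `A* = L* - lbar`, the formal adjoint of `A` (`lbar` is real). -/
def Astar : Y p →ₗ.[ℂ] Y p := Lstar p - scalar (Y p) lbar

/-- The derivative `S(u, l) = (A u - l ubar, ⟨u, ubar⟩)`. -/
def S : Y p × ℂ →ₗ.[ℂ] Y p × ℂ :=
  onFirst (A p lbar) +
    everywhere ((-(LinearMap.snd ℂ (Y p) ℂ).smulRight ubar).prod
      ((pair p ubar).comp (LinearMap.fst ℂ (Y p) ℂ)))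

/-- The formal adjoint `S*(v, k) = (A* v + k ubar, -⟨v, ubar⟩)`. -/
def Sstar : Y p × ℂ →ₗ.[ℂ] Y p × ℂ :=
  onFirst (Astar p lbar) +
    everywhere (((LinearMap.snd ℂ (Y p) ℂ).smulRight ubar).prod
      (-(pair p ubar).comp (LinearMap.fst ℂ (Y p) ℂ)))

/-! ### The base operator and the homotopy -/

/-- The constant `C_V = √(‖f²‖_∞ + ‖r² g² / 4‖_∞)`. -/
def CV : ℝ := Real.sqrt ((⨆ x : Ω p, f p x ^ 2) + ⨆ x : Ω p, x.1.1 ^ 2 / 4 * g p x ^ 2)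

/-- `s₂ = (1 - ηL) σ⁴ / 4`. -/
def s2 (etaL : ℝ) : ℝ := (1 - etaL) * (p.σ ^ 4 / 4)

/-- `s₁ = ((1 - ηL) / ηL) C_V² - lbar σ²`. -/
def s1 (etaL : ℝ) : ℝ := (1 - etaL) / etaL * CV p ^ 2 - lbar * p.σ ^ 2

/-- `s₀ = lbar² + inf_Ω (lbar h) - ‖A* ubar‖² / ηS`. The infimum is `lbar * inf_Ω h` if `lbar ≥ 0`
and `lbar * sup_Ω h` if `lbar ≤ 0`. -/
def s0 (etaS : ℝ) : ℝ :=
  lbar ^ 2 + (⨅ x : Ω p, lbar * h p x) - 1 / etaS * normSq p (value (Astar p lbar) ubar)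

/-- `s_λ = ‖ubar‖² - ηS`. -/
def sl (etaS : ℝ) : ℝ := normSq p ubar - etaS

/-- The base operator `diag(s₂ Δ̃² + s₁ Δ̃ + s₀, s_λ)`. -/
def base (etaL etaS : ℝ) : Y p × ℂ →ₗ.[ℂ] Y p × ℂ :=
  onFirst ((s2 p etaL : ℂ) • compose (lap p) (lap p) + (s1 p lbar etaL : ℂ) • lap p
      + scalar (Y p) (s0 p ubar lbar etaS)) +
    everywhere ((LinearMap.inr ℂ (Y p) ℂ).comp
      ((sl p ubar etaS : ℂ) • LinearMap.snd ℂ (Y p) ℂ))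

/-- `Z^(s)`: the functions `u ∈ H⁴(Ω) ∩ X` with `(s L + (1 - s) (2 s₂ / σ²) Δ̃) u ∈ X`. -/
def Z (etaL s : ℝ) : Submodule ℂ (Y p) :=
  H p 4 ⊓ X p ⊓
    preimage ((s : ℂ) • L p + (((1 - s) * (2 * s2 p etaL / p.σ ^ 2) : ℝ) : ℂ) • lap p) (X p)

/-- The operator `s S*S + (1 - s) base` with domain `Z^(s) × ℂ`. -/
def family (etaL etaS s : ℝ) : Y p × ℂ →ₗ.[ℂ] Y p × ℂ :=
  ((s : ℂ) • compose (Sstar p ubar lbar) (S p ubar lbar)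
      + ((1 - s : ℝ) : ℂ) • base p ubar lbar etaL etaS).domRestrict
    ((Z p etaL s).comap (LinearMap.fst ℂ (Y p) ℂ))

end ShearKolmogorov

end

/-! The eigenvalue problems are rewritten as problems for bounded forms on the fixed Hilbert space Y
× ℂ, where monotonicity in s is visible.

The operator r²Δ̃ with the boundary conditions of X separates in log r and ψ. Its eigenfunctions are
√r sin(ν log(r/rmin)) e^{ikψ}, with eigenvalues -(ν² + 1/4 + 4k²), and divided by r they are an
orthonormal basis of L² (`basis`). Hence the solution operator `green`, which sends φ to the u ∈ X
with Δ̃u = φ/r, and its derivatives up to order two are explicit bounded operators. `green` is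
compact and its range is exactly X (`green_mem_X`, `exists_eq_green`), so u ∈ X is parametrized by φ
∈ L².

For u = green φ, the eigenvalue equation is equivalent to its weak form s ⟨S·, S·⟩ + (1 - s)(base
form) = z ⟨·, ·⟩, tested on all of X × ℂ (`mem_eigenspace_family_iff`,
`mem_eigenspace_family_iff_form`). The operator domains depend on s, but the form domain does not:
the second boundary condition in Z^(s) is a natural one. It says that the flux G = s(σ²/2)(Au - λū)
+ (1 - s)s₂Δ̃u lies in X. The weak equation makes G a very weak L² solution of a second order
Dirichlet problem, so G ∈ X by duality (`exists_eq_green_of_weak`), and elliptic regularity gives u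
∈ H⁴ (`green_mem_H_four`).

The constants s₂, s₁, s₀, s_λ are such that the base form is at most ‖S(u, λ)‖²
(`base_le_residual`); this follows from two weighted Young inequalities, the bound of Vu by the
Dirichlet form, and 2 Re⟨u, Vu⟩ = -⟨u, hu⟩. The form is affine in s, so it is nondecreasing in s.
After adding m‖u‖², with m independent of s, it is coercive with some operator M. With Φ = (green,
id), the operators T = Φ M⁻¹ Φ* are compact, symmetric, positive and nonincreasing in s, and (z +
m)T x = x characterizes the eigenvectors (`exists_solution_operators`). Comparing the numbers of
eigenvalues of T above each level (`finrank_eigenspan_le`) orders the eigenvalues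
(`exists_isOrderedEigenvalues`). -/

noncomputable section

namespace ShearKolmogorov

/-! ### Compact symmetric operators: comparison of eigenvalue counts -/

section Spectral

variable {E : Type*} [NormedAddCommGroup E] [InnerProductSpace ℂ E]

/-- Eigenspaces of a symmetric operator are mutually orthogonal, so neither the norm nor the
quadratic form has cross terms. -/
theorem exists_eigenvector_decomposition {T : E →ₗ[ℂ] E} (hT : T.IsSymmetric) {ι : Type*}
    (m : ι → ℂ) (hm : Function.Injective m) {x : E}
    (hx : x ∈ ⨆ i, Module.End.eigenspace T (m i)) :
    ∃ (s : Finset ι) (y : ι → E), (∀ i, y i ∈ Module.End.eigenspace T (m i)) ∧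
      ‖x‖ ^ 2 = ∑ i ∈ s, ‖y i‖ ^ 2 ∧
      (inner ℂ (T x) x).re = ∑ i ∈ s, (m i).re * ‖y i‖ ^ 2 := by
  obtain ⟨f, hf, rfl⟩ := (Submodule.mem_iSup_iff_exists_finsupp _ _).1 hx
  have hO := hT.orthogonalFamily_eigenspaces.comp hm
  have e1 : f.sum (fun _ z => z) = ∑ i ∈ f.support, f i := rfl
  refine ⟨f.support, f, hf, ?_, ?_⟩
  · exact hO.norm_sum (fun i => ⟨f i, hf i⟩) f.support
  · have hTf : ∀ i, T (f i) = m i • f i := fun i => Module.End.mem_eigenspace_iff.1 (hf i)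
    have h1 := hO.inner_sum (fun i => m i • ⟨f i, hf i⟩) (fun i => ⟨f i, hf i⟩) f.support
    have h2 : T (f.sum fun _ z => z) = ∑ i ∈ f.support, m i • f i := by
      rw [e1, map_sum]; exact Finset.sum_congr rfl fun i _ => hTf i
    have h3 : inner ℂ (T (f.sum fun _ z => z)) (f.sum fun _ z => z) =
        ∑ i ∈ f.support, inner ℂ (m i • f i) (f i) := by
      rw [h2, e1]; exact h1
    rw [h3, Complex.re_sum]
    refine Finset.sum_congr rfl fun i _ => ?_
    rw [inner_smul_left, inner_self_eq_norm_sq_to_K]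
    simp only [Complex.coe_algebraMap, ← Complex.ofReal_pow, Complex.re_mul_ofReal,
      Complex.conj_re]

/-- The span of the eigenvectors of `T` with eigenvalue `1 / l`, `0 < l ≤ c`. -/
def eigenspan (T : E →ₗ[ℂ] E) (c : ℝ) : Submodule ℂ E :=
  ⨆ i : Ioc (0 : ℝ) c, Module.End.eigenspace T (((i : ℝ)⁻¹ : ℝ) : ℂ)

theorem eigenspace_le_eigenspan (T : E →ₗ[ℂ] E) {l c : ℝ} (h0 : 0 < l) (hc : l ≤ c) :
    Module.End.eigenspace T ((l⁻¹ : ℝ) : ℂ) ≤ eigenspan T c :=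
  le_iSup (fun i : Ioc (0 : ℝ) c => Module.End.eigenspace T (((i : ℝ)⁻¹ : ℝ) : ℂ)) ⟨l, h0, hc⟩

theorem eigenspan_mono (T : E →ₗ[ℂ] E) : Monotone (eigenspan T) := fun _ _ h =>
  iSup_le fun i => eigenspace_le_eigenspan T i.2.1 (i.2.2.trans h)

theorem eigenspan_eq_bot (T : E →ₗ[ℂ] E) {c : ℝ} (hc : c ≤ 0) : eigenspan T c = ⊥ :=
  iSup_eq_bot.2 fun i => absurd (i.2.1.trans_le i.2.2) (not_lt.2 hc)

theorem ofReal_inv_injective (c : ℝ) :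
    Function.Injective fun i : Ioc (0 : ℝ) c => (((i : ℝ)⁻¹ : ℝ) : ℂ) := fun _ _ h =>
  Subtype.ext (inv_injective (Complex.ofReal_injective h))

theorem norm_sq_le_of_mem_eigenspan {T : E →ₗ[ℂ] E} (hT : T.IsSymmetric) {c : ℝ} {x : E}
    (hx : x ∈ eigenspan T c) : ‖x‖ ^ 2 ≤ c * (inner ℂ (T x) x).re := by
  obtain ⟨s, y, -, h1, h2⟩ := exists_eigenvector_decomposition hT _ (ofReal_inv_injective c) hx
  rw [h1, h2, Finset.mul_sum]
  refine Finset.sum_le_sum fun i _ => ?_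
  have hi := i.2
  rw [Complex.ofReal_re, ← mul_assoc, ← div_eq_mul_inv]
  exact le_mul_of_one_le_left (sq_nonneg _) ((one_le_div hi.1).2 hi.2)

variable [CompleteSpace E]

/-- The form bound makes T bounded below on the span, hence on its closure. A compact operator that
is bounded below is a closed embedding, so the closed unit ball of that closure is compact. -/
theorem finiteDimensional_eigenspan {T : E →L[ℂ] E} (hc : IsCompactOperator T)
    (hT : (T : E →ₗ[ℂ] E).IsSymmetric) (c : ℝ) :
    FiniteDimensional ℂ (eigenspan (T : E →ₗ[ℂ] E) c) := by
  rcases le_or_gt c 0 with h0 | h0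
  · rw [eigenspan_eq_bot _ h0]; infer_instance
  have key : ∀ x ∈ eigenspan (T : E →ₗ[ℂ] E) c, ‖x‖ ≤ c * ‖T x‖ := by
    intro x hx
    have h1 := norm_sq_le_of_mem_eigenspan hT hx
    have h2 : (inner ℂ (T x) x).re ≤ ‖T x‖ * ‖x‖ :=
      (Complex.re_le_norm _).trans (norm_inner_le_norm _ _)
    rcases (norm_nonneg x).eq_or_lt with h | h
    · rw [← h]; positivity
    · have : ‖x‖ * ‖x‖ ≤ (c * ‖T x‖) * ‖x‖ := by
        calc ‖x‖ * ‖x‖ = ‖x‖ ^ 2 := by ring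
          _ ≤ c * (inner ℂ (T x) x).re := h1
          _ ≤ c * (‖T x‖ * ‖x‖) := by gcongr
          _ = _ := by ring
      exact le_of_mul_le_mul_right this h
  set C := (eigenspan (T : E →ₗ[ℂ] E) c).topologicalClosure with hC
  have key2 : ∀ x ∈ C, ‖x‖ ≤ c * ‖T x‖ := by
    intro x hx
    have hcl : IsClosed {x : E | ‖x‖ ≤ c * ‖T x‖} :=
      isClosed_le continuous_norm (continuous_const.mul (continuous_norm.comp T.continuous))
    exact closure_minimal (fun x hx => key x hx) hcl hx
  have : CompleteSpace C := (Submodule.isClosed_topologicalClosure _).completeSpace_coe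
  set R : C →L[ℂ] E := T.comp C.subtypeL with hR
  have hanti : AntilipschitzWith (Real.toNNReal c) R := by
    refine R.antilipschitz_of_bound fun x => ?_
    rw [Real.coe_toNNReal _ h0.le]
    exact key2 x x.2
  have hemb : IsClosedEmbedding R := hanti.isClosedEmbedding R.uniformContinuous
  have hRc : IsCompactOperator R := hc.comp_clm C.subtypeL
  have hfin : FiniteDimensional ℂ C := by
    obtain ⟨K, hK, hKs⟩ := hRc.image_closedBall_subset_compact 1 (f := (R : C →ₗ[ℂ] E))
    have hcomp := hemb.isCompact_preimage hK
    refine FiniteDimensional.of_isCompact_closedBall ℂ (r := 1) one_pos (c := (0 : C)) ?_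
    exact hcomp.of_isClosed_subset Metric.isClosed_closedBall
      fun x hx => hKs (mem_image_of_mem _ hx)
  exact Submodule.finiteDimensional_of_le (Submodule.le_topologicalClosure _)

/-- The complement of the span is invariant under T and contains no eigenvector with eigenvalue at
least 1/c. The spectral theorem there gives the inequality with ≤. The strict form is what makes the
dimension count in `finrank_eigenspan_le` work. -/
theorem mul_inner_lt_of_mem_orthogonal {T : E →L[ℂ] E} (hc : IsCompactOperator T)
    (hT : (T : E →ₗ[ℂ] E).IsSymmetric) {c : ℝ} (h0 : 0 < c) {x : E}
    (hx : x ∈ (eigenspan (T : E →ₗ[ℂ] E) c)ᗮ) (hx0 : x ≠ 0) :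
    c * (inner ℂ (T x) x).re < ‖x‖ ^ 2 := by
  set U := (eigenspan (T : E →ₗ[ℂ] E) c)ᗮ with hU
  have hinv : ∀ v ∈ U, (T : E →ₗ[ℂ] E) v ∈ U := by
    intro v hv
    rw [hU, eigenspan, ← Submodule.iInf_orthogonal] at hv ⊢
    exact (T : E →ₗ[ℂ] E).iInf_invariant
      (fun i => hT.invariant_orthogonalComplement_eigenspace _) v hv
  have hUc : IsClosed (U : Set E) := Submodule.isClosed_orthogonal _
  have : CompleteSpace U := hUc.completeSpace_coe
  let S : U →L[ℂ] U := T.restrict hinv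
  have hSc : IsCompactOperator S := hc.restrict' hinv
  have hSs : (S : U →ₗ[ℂ] U).IsSymmetric := hT.restrict_invariant hinv
  have hbot := ContinuousLinearMap.orthogonalComplement_iSup_eigenspaces_eq_bot hSc hSs
  have hdense : ((⨆ μ, Module.End.eigenspace (S : U →ₗ[ℂ] U) μ).topologicalClosure) = ⊤ :=
    (Submodule.topologicalClosure_eq_top_iff).2 hbot
  -- The inequality is closed in y, so it suffices to prove it on the dense span of the eigenvectors
  -- of the restriction.
  have hle : ∀ y : U, c * (inner ℂ (S y) y).re ≤ ‖y‖ ^ 2 := by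
    intro y
    have hcl : IsClosed {y : U | c * (inner ℂ (S y) y).re ≤ ‖y‖ ^ 2} := by
      refine isClosed_le ?_ ?_
      · exact continuous_const.mul (Complex.continuous_re.comp (S.continuous.inner continuous_id))
      · fun_prop
    have hy : y ∈ (⨆ μ, Module.End.eigenspace (S : U →ₗ[ℂ] U) μ).topologicalClosure := by
      rw [hdense]; trivial
    refine closure_minimal (fun z hz => ?_) hcl hy
    obtain ⟨s, w, hw, h1, h2⟩ :=
      exists_eigenvector_decomposition hSs (fun μ : ℂ => μ) Function.injective_id hz
    have h2' : (inner ℂ (S z) z).re = ∑ i ∈ s, (i : ℂ).re * ‖w i‖ ^ 2 := h2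
    change c * (inner ℂ (S z) z).re ≤ ‖z‖ ^ 2
    rw [h1, h2', Finset.mul_sum]
    refine Finset.sum_le_sum fun μ _ => ?_
    rcases eq_or_ne (w μ) 0 with h | h
    · simp [h]
    have hev : Module.End.HasEigenvalue (S : U →ₗ[ℂ] U) μ :=
      Module.End.hasEigenvalue_of_hasEigenvector ⟨hw μ, h⟩
    have hreal := Complex.conj_eq_iff_re.1 (hSs.conj_eigenvalue_eq_self hev)
    rw [← mul_assoc]
    refine mul_le_of_le_one_left (sq_nonneg _) ?_
    by_contra hlt
    push Not at hlt
    have hpos : 0 < μ.re := by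
      by_contra hn
      push Not at hn
      nlinarith
    -- An eigenvalue μ with cμ > 1 would have its eigenvector both in the span and orthogonal to it.
    have hmem : (w μ : E) ∈ eigenspan (T : E →ₗ[ℂ] E) c := by
      refine eigenspace_le_eigenspan _ (inv_pos.2 hpos) (l := μ.re⁻¹) ?_ ?_
      · rw [inv_le_comm₀ hpos h0, inv_le_iff_one_le_mul₀ h0]; linarith
      · rw [inv_inv, hreal, Module.End.mem_eigenspace_iff]
        have := Module.End.mem_eigenspace_iff.1 (hw μ)
        exact congrArg Subtype.val this
    have : (w μ : E) = 0 :=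
      (Submodule.mem_bot ℂ).1 (Submodule.inf_orthogonal_eq_bot (eigenspan (T : E →ₗ[ℂ] E) c) ▸
        ⟨hmem, (w μ).2⟩)
    exact h (Subtype.ext this)
  have hleE : ∀ y ∈ U, c * (inner ℂ (T y) y).re ≤ ‖y‖ ^ 2 := fun y hy => hle ⟨y, hy⟩
  refine lt_of_le_of_ne (hleE x hx) fun heq => hx0 ?_
  -- equality makes `x` an eigenvector with eigenvalue `1 / c`
  set D : E → E := fun y => y - (c : ℂ) • T y with hD
  set d := D x with hd
  have hdU : d ∈ U := U.sub_mem hx (U.smul_mem _ (hinv x hx))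
  have q (y : E) : (inner ℂ (D y) y).re = ‖y‖ ^ 2 - c * (inner ℂ (T y) y).re := by
    simp only [hD, inner_sub_left, inner_smul_left, Complex.conj_ofReal, Complex.sub_re,
      Complex.re_ofReal_mul]
    congr 1
    rw [inner_self_eq_norm_sq_to_K]; norm_cast
  have hd0 : ‖d‖ ^ 2 = 0 := by
    -- This is the nonnegative form of D at x - t d. Its constant term vanishes because x is an
    -- equality case, and its linear term is -2t‖d‖² because D is symmetric.
    have hexp : ∀ t : ℝ, 0 ≤ -2 * t * ‖d‖ ^ 2 + t ^ 2 * (inner ℂ (D d) d).re := by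
      intro t
      have hmem : x - (t : ℂ) • d ∈ U := U.sub_mem hx (U.smul_mem _ hdU)
      have h1 := hleE _ hmem
      have h2 : 0 ≤ (inner ℂ (D (x - (t : ℂ) • d)) (x - (t : ℂ) • d)).re := by
        rw [q]; linarith
      have hDl : D (x - (t : ℂ) • d) = d - (t : ℂ) • D d := by
        simp only [hD, hd, map_sub, map_smul, smul_sub]
        simp only [smul_comm (c : ℂ) (t : ℂ)]
        abel
      have hsymm : inner ℂ (D d) x = inner ℂ d d := by
        have h3 : inner ℂ (T d) x = inner ℂ d (T x) := hT d x
        have h4 : inner ℂ d (x - (c : ℂ) • T x) = inner ℂ d d := rfl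
        rw [← h4]
        simp only [hD, inner_sub_left, inner_sub_right, inner_smul_left, inner_smul_right,
          Complex.conj_ofReal, h3]
      have h0x : (inner ℂ d x).re = 0 := by rw [hd, q]; linarith
      have hself : (inner ℂ d d).re = ‖d‖ ^ 2 := by
        rw [inner_self_eq_norm_sq_to_K]; norm_cast
      rw [hDl] at h2
      simp only [inner_sub_left, inner_sub_right, inner_smul_left, inner_smul_right,
        Complex.conj_ofReal, hsymm, Complex.sub_re, Complex.re_ofReal_mul, h0x, hself] at h2
      nlinarith
    by_contra hne
    have hpos : 0 < ‖d‖ ^ 2 := lt_of_le_of_ne (sq_nonneg _) (Ne.symm hne)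
    set B := |(inner ℂ (D d) d).re| + 1 with hB
    have hBpos : 0 < B := by positivity
    -- For this t the quadratic term is at most half of the linear one, which forces d = 0. The
    -- summand 1 in B only makes B positive.
    have h1 := hexp (‖d‖ ^ 2 / B)
    have h2 : (inner ℂ (D d) d).re ≤ B := (le_abs_self _).trans (by linarith)
    have h3 : (‖d‖ ^ 2 / B) ^ 2 * (inner ℂ (D d) d).re ≤ (‖d‖ ^ 2 / B) ^ 2 * B := by gcongr
    have h4 : (‖d‖ ^ 2 / B) ^ 2 * B = (‖d‖ ^ 2 / B) * ‖d‖ ^ 2 := by field_simp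
    have h5 : 0 < (‖d‖ ^ 2 / B) * ‖d‖ ^ 2 := by positivity
    nlinarith
  have hd1 : d = 0 := by simpa using hd0
  have hxW : x ∈ eigenspan (T : E →ₗ[ℂ] E) c := by
    refine eigenspace_le_eigenspan _ h0 le_rfl (Module.End.mem_eigenspace_iff.2 ?_)
    have h1 : x = (c : ℂ) • T x := sub_eq_zero.1 hd1
    have hcne : (c : ℂ) ≠ 0 := by exact_mod_cast h0.ne'
    rw [ContinuousLinearMap.coe_coe, Complex.ofReal_inv, eq_inv_smul_iff₀ hcne, ← h1]
  exact (Submodule.mem_bot ℂ).1 (Submodule.inf_orthogonal_eq_bot (eigenspan (T : E →ₗ[ℂ] E) c) ▸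
    ⟨hxW, hx⟩)

/-- A lower bound for the quadratic form lowers the number of small eigenvalues. -/
theorem finrank_eigenspan_le {T R : E →L[ℂ] E} (hTc : IsCompactOperator T)
    (hT : (T : E →ₗ[ℂ] E).IsSymmetric) (hRc : IsCompactOperator R)
    (hR : (R : E →ₗ[ℂ] E).IsSymmetric)
    (hle : ∀ x, (inner ℂ (R x) x).re ≤ (inner ℂ (T x) x).re) (c : ℝ) :
    Module.finrank ℂ (eigenspan (R : E →ₗ[ℂ] E) c) ≤
      Module.finrank ℂ (eigenspan (T : E →ₗ[ℂ] E) c) := by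
  rcases le_or_gt c 0 with h0 | h0
  · rw [eigenspan_eq_bot _ h0, eigenspan_eq_bot _ h0]
  have := finiteDimensional_eigenspan hTc hT c
  have := finiteDimensional_eigenspan hRc hR c
  set P := eigenspan (R : E →ₗ[ℂ] E) c
  set Q := eigenspan (T : E →ₗ[ℂ] E) c
  -- A nonzero vector of P orthogonal to Q would satisfy ‖x‖² ≤ c(Rx, x) ≤ c(Tx, x) < ‖x‖². So P
  -- embeds in Q by projection.
  have : Function.Injective ((Q.orthogonalProjectionOnto : E →ₗ[ℂ] Q) ∘ₗ P.subtype) := by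
    rw [← LinearMap.ker_eq_bot, LinearMap.ker_eq_bot']
    intro x hx
    by_contra hne
    have hxo : (x : E) ∈ Qᗮ := by
      rw [← Submodule.orthogonalProjectionOnto_eq_zero_iff]; exact hx
    have h1 := mul_inner_lt_of_mem_orthogonal hTc hT h0 hxo (by simpa using hne)
    have h2 := norm_sq_le_of_mem_eigenspan hR x.2
    have h3 : c * (inner ℂ (R x) (x : E)).re ≤ c * (inner ℂ (T x) (x : E)).re :=
      mul_le_mul_of_nonneg_left (hle x) h0.le
    exact absurd (h2.trans h3) (not_le.2 h1)
  exact LinearMap.finrank_le_finrank_of_injective this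

end Spectral

/-! ### From a counting function to a sequence -/

section Counting

/-- The increasing enumeration of the jumps of an integer valued distribution function. -/
theorem exists_enumeration (N d : ℝ → ℕ) (hmono : Monotone N)
    (hright : ∀ c, ∃ ε > 0, N (c + ε) = N c)
    (hleft : ∀ c, ∃ ε > 0, ∀ δ > 0, δ ≤ ε → N (c - δ) + d c = N c)
    (hunb : ∀ n, ∃ c, n < N c) (hzero : ∃ c, N c = 0) :
    ∃ l : ℕ → ℝ, (∀ n c, l n ≤ c ↔ n < N c) ∧ ∀ c, {n | l n = c}.encard = d c := by
  obtain ⟨c₀, hc₀⟩ := hzero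
  have hbdd : ∀ n, BddBelow {c | n < N c} := fun n => ⟨c₀, fun c hc => by
    by_contra hlt
    have := hmono (not_le.1 hlt).le
    have h2 : n < N c := hc
    omega⟩
  -- The n-th value is the place where N first exceeds n. Being constant just to the right of c, N
  -- already exceeds n at the infimum itself.
  have hl : ∀ n c, sInf {c | n < N c} ≤ c ↔ n < N c := by
    intro n c
    refine ⟨fun h => ?_, fun h => csInf_le (hbdd n) h⟩
    obtain ⟨ε, hε, he⟩ := hright c
    obtain ⟨c', hc', hlt⟩ := exists_lt_of_csInf_lt (hunb n) (h.trans_lt (lt_add_of_pos_right c hε))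
    exact he ▸ lt_of_lt_of_le hc' (hmono hlt.le)
  refine ⟨fun n => sInf {c | n < N c}, hl, fun c => ?_⟩
  obtain ⟨ε, hε, he⟩ := hleft c
  have h1 := he ε hε le_rfl
  have : {n | sInf {c | n < N c} = c} = (Finset.Ico (N (c - ε)) (N c) : Set ℕ) := by
    ext n
    simp only [mem_ofPred_eq, Finset.coe_Ico, mem_Ico]
    constructor
    · intro h
      refine ⟨?_, (hl n c).1 h.le⟩
      by_contra hlt
      have := (hl n (c - ε)).2 (not_le.1 hlt)
      linarith
    · rintro ⟨h2, h3⟩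
      refine le_antisymm ((hl n c).2 h3) (le_of_not_gt fun hlt => ?_)
      set δ := min ε (c - sInf {c | n < N c}) with hδ
      have hδ0 : 0 < δ := lt_min hε (by linarith)
      have h4 := he δ hδ0 (min_le_left _ _)
      have h5 : n < N (c - δ) := (hl n (c - δ)).1 (by
        have := min_le_right ε (c - sInf {c | n < N c}); linarith)
      omega
  rw [this, Set.encard_coe_eq_coe_finsetCard, Nat.card_Ico]
  congr 1
  omega

end Counting

/-! ### Eigenvalue sequences of positive compact operators, and transfer to unbounded ones -/

section Enumeration

variable {E : Type*} [NormedAddCommGroup E] [InnerProductSpace ℂ E] [CompleteSpace E]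

/-- All these eigenspaces lie in one finite dimensional invariant subspace, and eigenspaces for
distinct eigenvalues are independent. -/
theorem finite_eigenvalues {T : E →L[ℂ] E} (hc : IsCompactOperator T)
    (hT : (T : E →ₗ[ℂ] E).IsSymmetric) (c : ℝ) :
    {l : ℝ | 0 < l ∧ l ≤ c ∧ Module.End.eigenspace (T : E →ₗ[ℂ] E) ((l⁻¹ : ℝ) : ℂ) ≠ ⊥}.Finite := by
  set W := eigenspan (T : E →ₗ[ℂ] E) c with hW
  have hfin : FiniteDimensional ℂ W := finiteDimensional_eigenspan hc hT c
  have hinv : ∀ v ∈ W, (T : E →ₗ[ℂ] E) v ∈ W := by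
    intro v hv
    have : W ≤ W.comap (T : E →ₗ[ℂ] E) := iSup_le fun i x hx => by
      rw [Submodule.mem_comap, Module.End.mem_eigenspace_iff.1 hx]
      exact W.smul_mem _ (eigenspace_le_eigenspan _ i.2.1 i.2.2 hx)
    exact this hv
  have h1 : {μ | Module.End.eigenspace ((T : E →ₗ[ℂ] E).restrict hinv) μ ≠ ⊥}.Finite :=
    WellFoundedGT.finite_ne_bot_of_iSupIndep (Module.End.eigenspaces_iSupIndep _)
  refine (h1.preimage (f := fun l : ℝ => ((l⁻¹ : ℝ) : ℂ)) ?_).subset ?_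
  · intro x _ y _ h
    exact inv_injective (Complex.ofReal_injective h)
  · rintro l ⟨h2, h3, h4⟩
    obtain ⟨v, hv, hv0⟩ := (Submodule.ne_bot_iff _).1 h4
    refine (Submodule.ne_bot_iff _).2 ⟨⟨v, eigenspace_le_eigenspan _ h2 h3 hv⟩, ?_, ?_⟩
    · rw [Module.End.mem_eigenspace_iff]
      exact Subtype.ext (Module.End.mem_eigenspace_iff.1 hv)
    · exact fun h => hv0 (congrArg Subtype.val h)

theorem exists_eigenvalue_gap {T : E →L[ℂ] E} (hc : IsCompactOperator T)
    (hT : (T : E →ₗ[ℂ] E).IsSymmetric) (c : ℝ) :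
    ∃ ε > 0, ∀ l : ℝ, 0 < l → |l - c| ≤ ε → l ≠ c →
      Module.End.eigenspace (T : E →ₗ[ℂ] E) ((l⁻¹ : ℝ) : ℂ) = ⊥ := by
  have hF := (finite_eigenvalues hc hT (c + 1)).subset (sdiff_subset (t := {c}))
  have hnhds := hF.isClosed.isOpen_compl.mem_nhds (x := c) (by simp)
  obtain ⟨ε, hε, hball⟩ := Metric.nhds_basis_closedBall.mem_iff.1 hnhds
  refine ⟨min ε 1, lt_min hε one_pos, fun l hl hlc hne => ?_⟩
  by_contra hbot
  have h1 : l ∈ Metric.closedBall c ε := by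
    rw [Metric.mem_closedBall, Real.dist_eq]; exact hlc.trans (min_le_left _ _)
  have h2 := (abs_le.1 (hlc.trans (min_le_right _ _))).2
  exact hball h1 ⟨⟨hl, by linarith, hbot⟩, hne⟩

/-- If the dimensions were bounded, the span of maximal dimension would contain every eigenspace,
since positivity makes every eigenvalue of the form 1/l with l > 0. By the spectral theorem that
finite dimensional span would be the whole space. -/
theorem exists_lt_finrank_eigenspan {T : E →L[ℂ] E} (hc : IsCompactOperator T)
    (hT : (T : E →ₗ[ℂ] E).IsSymmetric) (hpos : ∀ x, x ≠ 0 → 0 < (inner ℂ (T x) x).re)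
    (hinf : ¬ FiniteDimensional ℂ E) (n : ℕ) :
    ∃ c, n < Module.finrank ℂ (eigenspan (T : E →ₗ[ℂ] E) c) := by
  by_contra! hle
  have hfin := finiteDimensional_eigenspan hc hT
  set N : ℝ → ℕ := fun c => Module.finrank ℂ (eigenspan (T : E →ₗ[ℂ] E) c)
  have hb : BddAbove (range N) := ⟨n, by rintro _ ⟨c, rfl⟩; exact hle c⟩
  obtain ⟨c₀, h₀⟩ := Nat.sSup_mem (range_nonempty N) hb
  have hmax : ∀ c, N c ≤ N c₀ := fun c => h₀ ▸ le_csSup hb (mem_range_self c)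
  have hall : ∀ c, eigenspan (T : E →ₗ[ℂ] E) c ≤ eigenspan (T : E →ₗ[ℂ] E) c₀ := by
    intro c
    rcases le_total c c₀ with h | h
    · exact eigenspan_mono _ h
    · exact (Submodule.eq_of_le_of_finrank_le (eigenspan_mono _ h) (hmax c)).ge
  have hsup : (⨆ μ, Module.End.eigenspace (T : E →ₗ[ℂ] E) μ) ≤ eigenspan (T : E →ₗ[ℂ] E) c₀ := by
    refine iSup_le fun μ x hx => ?_
    rcases eq_or_ne x 0 with h | h
    · rw [h]; exact Submodule.zero_mem _
    have hreal := Complex.conj_eq_iff_re.1 (hT.conj_eigenvalue_eq_self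
      (Module.End.hasEigenvalue_of_hasEigenvector ⟨hx, h⟩))
    have h1 : T x = μ • x := Module.End.mem_eigenspace_iff.1 hx
    have h2 := hpos x h
    rw [h1, ← hreal, inner_smul_left, Complex.conj_ofReal, Complex.re_ofReal_mul,
      inner_self_eq_norm_sq_to_K] at h2
    have h3 : 0 < μ.re := by
      have h4 : (((‖x‖ : ℝ) : ℂ) ^ 2).re = ‖x‖ ^ 2 := by norm_cast
      have : 0 < μ.re * ‖x‖ ^ 2 := h4 ▸ h2
      exact pos_of_mul_pos_left this (sq_nonneg _)
    refine hall μ.re⁻¹ (eigenspace_le_eigenspan _ (inv_pos.2 h3) le_rfl ?_)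
    rwa [inv_inv, hreal]
  have hbot := ContinuousLinearMap.orthogonalComplement_iSup_eigenspaces_eq_bot hc hT
  have hbot2 : (eigenspan (T : E →ₗ[ℂ] E) c₀)ᗮ = ⊥ :=
    le_bot_iff.1 (hbot ▸ Submodule.orthogonal_le hsup)
  have htop := (Submodule.orthogonal_eq_bot_iff).1 hbot2
  have h5 := hfin c₀
  rw [htop] at h5
  exact hinf (Module.finite_def.2 (Module.Finite.iff_fg.1 h5))

/-- The dimension of `eigenspan T c` is a step function of c. It is right continuous because the
reciprocal eigenvalues are isolated, and its jump at c is the multiplicity of the eigenvalue 1/c. -/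
theorem exists_eigenvalue_enumeration {T : E →L[ℂ] E} (hc : IsCompactOperator T)
    (hT : (T : E →ₗ[ℂ] E).IsSymmetric) (hpos : ∀ x, x ≠ 0 → 0 < (inner ℂ (T x) x).re)
    (hinf : ¬ FiniteDimensional ℂ E) :
    ∃ l : ℕ → ℝ, (∀ n c, l n ≤ c ↔ n < Module.finrank ℂ (eigenspan (T : E →ₗ[ℂ] E) c)) ∧
      (∀ c ≤ 0, {n | l n = c} = ∅) ∧
      ∀ c > 0, {n | l n = c}.encard =
        (Module.finrank ℂ (Module.End.eigenspace (T : E →ₗ[ℂ] E) ((c⁻¹ : ℝ) : ℂ)) : ℕ∞) := by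
  have hfin := finiteDimensional_eigenspan hc hT
  set N : ℝ → ℕ := fun c => Module.finrank ℂ (eigenspan (T : E →ₗ[ℂ] E) c) with hN
  set d : ℝ → ℕ := fun c => if c ≤ 0 then 0 else
    Module.finrank ℂ (Module.End.eigenspace (T : E →ₗ[ℂ] E) ((c⁻¹ : ℝ) : ℂ)) with hd
  suffices hgaps : (∀ c, ∃ ε > 0, N (c + ε) = N c) ∧
      ∀ c, ∃ ε > 0, ∀ δ > 0, δ ≤ ε → N (c - δ) + d c = N c by
    obtain ⟨l, h1, h2⟩ := exists_enumeration N d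
      (fun a b h => Submodule.finrank_mono (eigenspan_mono _ h)) hgaps.1 hgaps.2
      (exists_lt_finrank_eigenspan hc hT hpos hinf) ⟨0, by simp [N, eigenspan_eq_bot]⟩
    refine ⟨l, h1, fun c hc0 => ?_, fun c hc0 => ?_⟩
    · rw [← Set.encard_eq_zero, h2, hd]; simp [hc0]
    · rw [h2, hd]; simp [not_le.2 hc0]
  constructor
  · intro c
    obtain ⟨ε, hε, hgap⟩ := exists_eigenvalue_gap hc hT c
    refine ⟨ε, hε, ?_⟩
    have : eigenspan (T : E →ₗ[ℂ] E) (c + ε) = eigenspan (T : E →ₗ[ℂ] E) c := by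
      refine le_antisymm (iSup_le fun i => ?_) (eigenspan_mono _ (by linarith))
      rcases le_or_gt (i : ℝ) c with h | h
      · exact eigenspace_le_eigenspan _ i.2.1 h
      · rw [hgap i i.2.1 (by rw [abs_of_pos (by linarith)]; linarith [i.2.2]) h.ne']
        exact bot_le
    simp only [hN]
    rw [this]
  · intro c
    rcases le_or_gt c 0 with h0 | h0
    · refine ⟨1, one_pos, fun δ hδ _ => ?_⟩
      simp only [hN, hd]
      rw [eigenspan_eq_bot _ h0, eigenspan_eq_bot _ (by linarith : c - δ ≤ 0), if_pos h0, add_zero]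
    obtain ⟨ε, hε, hgap⟩ := exists_eigenvalue_gap hc hT c
    refine ⟨ε, hε, fun δ hδ hδε => ?_⟩
    simp only [hN, hd]
    rw [if_neg (not_le.2 h0)]
    -- By the gap, the only new eigenspace on passing from c - δ to c is the one at c itself;
    -- independence of eigenspaces makes the sum direct.
    have hsup : eigenspan (T : E →ₗ[ℂ] E) c = eigenspan (T : E →ₗ[ℂ] E) (c - δ) ⊔
        Module.End.eigenspace (T : E →ₗ[ℂ] E) ((c⁻¹ : ℝ) : ℂ) := by
      refine le_antisymm (iSup_le fun i => ?_)
        (sup_le (eigenspan_mono _ (by linarith)) (eigenspace_le_eigenspan _ h0 le_rfl))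
      rcases le_or_gt (i : ℝ) (c - δ) with h | h
      · exact (eigenspace_le_eigenspan _ i.2.1 h).trans le_sup_left
      rcases eq_or_ne (i : ℝ) c with h' | h'
      · rw [h']; exact le_sup_right
      · rw [hgap i i.2.1 (by rw [abs_sub_comm, abs_of_nonneg] <;> linarith [i.2.2]) h']
        exact bot_le
    have hdisj : eigenspan (T : E →ₗ[ℂ] E) (c - δ) ⊓
        Module.End.eigenspace (T : E →ₗ[ℂ] E) ((c⁻¹ : ℝ) : ℂ) = ⊥ := by
      have h1 := Module.End.eigenspaces_iSupIndep (T : E →ₗ[ℂ] E) ((c⁻¹ : ℝ) : ℂ)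
      rw [inf_comm, ← disjoint_iff]
      refine h1.mono_right (iSup_le fun i => ?_)
      refine le_iSup₂_of_le (((i : ℝ)⁻¹ : ℝ) : ℂ) ?_ le_rfl
      intro h
      have := inv_injective (Complex.ofReal_injective h)
      linarith [i.2.2]
    have hfc := hfin (c - δ)
    have hfE : FiniteDimensional ℂ (Module.End.eigenspace (T : E →ₗ[ℂ] E) ((c⁻¹ : ℝ) : ℂ)) :=
      have := hfin c
      Submodule.finiteDimensional_of_le (eigenspace_le_eigenspan _ h0 le_rfl)
    have := Submodule.finrank_sup_add_finrank_inf_eq (eigenspan (T : E →ₗ[ℂ] E) (c - δ))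
      (Module.End.eigenspace (T : E →ₗ[ℂ] E) ((c⁻¹ : ℝ) : ℂ))
    rw [hdisj, finrank_bot, add_zero, ← hsup] at this
    exact this.symm

/-- If `(z + m) T (J x) = J x` characterizes the eigenvectors of `R` for a compact positive `T`,
then the eigenvalues of `R` form a sequence, which depends monotonically on `T`. -/
theorem exists_isOrderedEigenvalues {F I : Type*} [AddCommGroup F] [Module ℂ F]
    (hinf : ¬ FiniteDimensional ℂ E) (J : F ≃ₗ[ℂ] E) (m : ℝ)
    (R : I → F →ₗ.[ℂ] F) (T : I → E →L[ℂ] E) (hc : ∀ i, IsCompactOperator (T i))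
    (hT : ∀ i, (T i : E →ₗ[ℂ] E).IsSymmetric)
    (hpos : ∀ i x, x ≠ 0 → 0 < (inner ℂ (T i x) x).re)
    (hJ : ∀ i z x, x ∈ eigenspace (R i) z ↔ (z + m) • T i (J x) = J x) :
    ∃ eig : I → ℕ → ℝ, (∀ i, IsOrderedEigenvalues (R i) (eig i)) ∧
      ∀ i j, (∀ x, (inner ℂ (T j x) x).re ≤ (inner ℂ (T i x) x).re) →
        ∀ n, eig i n ≤ eig j n := by
  choose l hl1 hl2 hl3 using fun i => exists_eigenvalue_enumeration (hc i) (hT i) (hpos i) hinf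
  -- The eigenvalue 1/c of T corresponds to the eigenvalue c - m of R.
  have heig : ∀ i (c : ℝ), 0 < c → eigenspace (R i) ((c - m : ℝ) : ℂ) =
      (Module.End.eigenspace (T i : E →ₗ[ℂ] E) ((c⁻¹ : ℝ) : ℂ)).comap (J : F →ₗ[ℂ] E) := by
    intro i c hc0
    have hcne : (c : ℂ) ≠ 0 := by exact_mod_cast hc0.ne'
    ext x
    rw [hJ, Submodule.mem_comap, Module.End.mem_eigenspace_iff]
    simp only [Complex.ofReal_sub, sub_add_cancel, Complex.ofReal_inv, LinearEquiv.coe_coe,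
      ContinuousLinearMap.coe_coe]
    rw [eq_inv_smul_iff₀ hcne]
  -- Any eigenvector of R gives T the eigenvalue 1/(z + m), which is real and positive. This is why
  -- no other complex z can occur.
  have hbot : ∀ i z, (∀ c : ℝ, 0 < c → ((c - m : ℝ) : ℂ) ≠ z) → eigenspace (R i) z = ⊥ := by
    intro i z hz
    refine (Submodule.eq_bot_iff _).2 fun x hx => ?_
    by_contra hne
    have hJx : J x ≠ 0 := fun h => hne (by simpa using h)
    have h1 := (hJ i z x).1 hx
    have hz0 : z + m ≠ 0 := fun h => hJx (by rw [← h1, h, zero_smul])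
    have h2 : T i (J x) = (z + m)⁻¹ • J x := by rw [eq_inv_smul_iff₀ hz0, h1]
    have hev : Module.End.HasEigenvalue (T i : E →ₗ[ℂ] E) (z + m)⁻¹ :=
      Module.End.hasEigenvalue_of_hasEigenvector ⟨Module.End.mem_eigenspace_iff.2 h2, hJx⟩
    have hreal := Complex.conj_eq_iff_re.1 ((hT i).conj_eigenvalue_eq_self hev)
    have h3 := hpos i _ hJx
    rw [h2, ← hreal, inner_smul_left, Complex.conj_ofReal, Complex.re_ofReal_mul,
      inner_self_eq_norm_sq_to_K] at h3
    have h4 : ((((‖J x‖ : ℝ) : ℂ)) ^ 2).re = ‖J x‖ ^ 2 := by norm_cast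
    have h5 : 0 < ((z + m)⁻¹).re * ‖J x‖ ^ 2 := h4 ▸ h3
    have h6 := pos_of_mul_pos_left h5 (sq_nonneg _)
    refine hz (((z + m)⁻¹).re)⁻¹ (inv_pos.2 h6) ?_
    rw [Complex.ofReal_sub, Complex.ofReal_inv, hreal, inv_inv, add_sub_cancel_right]
  refine ⟨fun i n => l i n - m, fun i => ?_, fun i j hij n => ?_⟩
  · have hequiv : ∀ c : ℝ, 0 < c → Nonempty (eigenspace (R i) ((c - m : ℝ) : ℂ) ≃ₗ[ℂ]
        Module.End.eigenspace (T i : E →ₗ[ℂ] E) ((c⁻¹ : ℝ) : ℂ)) := fun c hc0 => by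
      rw [heig i c hc0]
      exact ⟨J.ofSubmodule' _⟩
    refine ⟨fun a b hab => ?_, ?_, fun z => ?_, fun z => ?_⟩
    · have : l i a ≤ l i b := (hl1 i a _).2 (hab.trans_lt ((hl1 i b _).1 le_rfl))
      exact sub_le_sub_right this m
    · refine tendsto_atTop.2 fun B => ?_
      filter_upwards [eventually_ge_atTop
        (Module.finrank ℂ (eigenspan (T i : E →ₗ[ℂ] E) (B + m)))] with n hn
      by_contra hlt
      have := (hl1 i n (B + m)).1 (by linarith)
      omega
    · by_cases hz : ∃ c : ℝ, 0 < c ∧ ((c - m : ℝ) : ℂ) = z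
      · obtain ⟨c, hc0, rfl⟩ := hz
        obtain ⟨e⟩ := hequiv c hc0
        have hfc := finiteDimensional_eigenspan (hc i) (hT i) c
        have : FiniteDimensional ℂ
            (Module.End.eigenspace (T i : E →ₗ[ℂ] E) ((c⁻¹ : ℝ) : ℂ)) :=
          Submodule.finiteDimensional_of_le (eigenspace_le_eigenspan _ hc0 le_rfl)
        exact Module.Finite.equiv e.symm
      · push Not at hz
        rw [hbot i z hz]
        infer_instance
    · by_cases hz : ∃ c : ℝ, 0 < c ∧ ((c - m : ℝ) : ℂ) = z
      · obtain ⟨c, hc0, rfl⟩ := hz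
        obtain ⟨e⟩ := hequiv c hc0
        rw [e.finrank_eq, ← hl3 i c hc0]
        congr 1
        ext n
        simp only [mem_ofPred_eq, Complex.ofReal_inj, sub_left_inj]
      · push Not at hz
        rw [hbot i z hz, finrank_bot, Nat.cast_zero, Set.encard_eq_zero]
        refine Set.eq_empty_of_forall_notMem fun n hn => ?_
        have hn' : ((l i n - m : ℝ) : ℂ) = z := hn
        rcases le_or_gt (l i n) 0 with h | h
        · exact (hl2 i _ h).le (show n ∈ {k | l i k = l i n} from rfl)
        · exact hz _ h hn'
  -- The larger operator has at least as many reciprocal eigenvalues below each level, so its n-th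
  -- one comes no later.
  · refine sub_le_sub_right ((hl1 i n _).2 (((hl1 j n _).1 le_rfl).trans_le ?_)) m
    exact finrank_eigenspan_le (hc i) (hT i) (hc j) (hT j) hij _

end Enumeration

/-- The standing assumptions on the parameters. -/
class Params.Admissible (p : Params) : Prop where
  rmin_pos : 0 < p.rmin
  rmin_lt : p.rmin < p.rmax
  σ_pos : 0 < p.σ

/-! ### Continuous functions in L² and multiplication operators -/

section Functions

variable (p : Params)

theorem isOpen_Ω : IsOpen (Ω p) := isOpen_Ioo.prod isOpen_Ioo

theorem measurableSet_Ω : MeasurableSet (Ω p) := (isOpen_Ω p).measurableSet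

/-- The closed rectangle. -/
def box : Set (ℝ × ℝ) := Icc p.rmin p.rmax ×ˢ Icc 0 (2 * Real.pi)

theorem isCompact_box : IsCompact (box p) := isCompact_Icc.prod isCompact_Icc

theorem Ω_subset_box : Ω p ⊆ box p := prod_mono Ioo_subset_Icc_self Ioo_subset_Icc_self

instance instIsFiniteMeasureΩ : IsFiniteMeasure (volume.restrict (Ω p)) :=
  ⟨by simpa using (measure_mono (Ω_subset_box p)).trans_lt (isCompact_box p).measure_lt_top⟩

theorem ae_mem_Ω : ∀ᵐ x ∂volume.restrict (Ω p), x ∈ Ω p := ae_restrict_mem (measurableSet_Ω p)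

theorem exists_bound {G : Type*} [NormedAddCommGroup G] {F : ℝ × ℝ → G} (hF : Continuous F) :
    ∃ C, 0 ≤ C ∧ ∀ x ∈ box p, ‖F x‖ ≤ C := by
  obtain ⟨C, hC⟩ := (isCompact_box p).exists_bound_of_continuousOn hF.continuousOn
  exact ⟨max C 0, le_max_right _ _, fun x hx => (hC x hx).trans (le_max_left _ _)⟩

theorem memLp_of_continuous {F : ℝ × ℝ → ℂ} (hF : Continuous F) :
    MemLp F 2 (volume.restrict (Ω p)) := by
  obtain ⟨C, -, hC⟩ := exists_bound p hF
  exact MemLp.of_bound hF.aestronglyMeasurable C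
    ((ae_mem_Ω p).mono fun x hx => hC x (Ω_subset_box p hx))

theorem integrable_of_continuous {F : ℝ × ℝ → ℂ} (hF : Continuous F) :
    Integrable F (volume.restrict (Ω p)) :=
  (memLp_of_continuous p hF).integrable (by norm_num)

/-- A continuous function, as an element of `L²(Ω)`. -/
def toY (F : ℝ × ℝ → ℂ) : Y p :=
  open Classical in if hF : Continuous F then (memLp_of_continuous p hF).toLp F else 0

variable {p}

theorem coeFn_toY {F : ℝ × ℝ → ℂ} (hF : Continuous F) :
    toY p F =ᵐ[volume.restrict (Ω p)] F := by
  rw [toY, dif_pos hF]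
  exact MemLp.coeFn_toLp _

theorem Y_ext {u v : Y p} (h : ∀ᵐ x ∂volume.restrict (Ω p), x ∈ Ω p → u x = v x) : u = v :=
  Lp.ext (by filter_upwards [h, ae_mem_Ω p] with x h1 h2 using h1 h2)

theorem toY_congr {F G : ℝ × ℝ → ℂ} (hF : Continuous F) (hG : Continuous G)
    (h : ∀ x ∈ Ω p, F x = G x) : toY p F = toY p G :=
  Y_ext (by
    filter_upwards [coeFn_toY hF, coeFn_toY hG] with x h1 h2 hx
    rw [h1, h2, h x hx])

theorem toY_add {F G : ℝ × ℝ → ℂ} (hF : Continuous F) (hG : Continuous G) :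
    toY p (fun x => F x + G x) = toY p F + toY p G :=
  Y_ext (by
    filter_upwards [coeFn_toY hF, coeFn_toY hG, coeFn_toY (hF.add hG),
      Lp.coeFn_add (toY p F) (toY p G)] with x h1 h2 h3 h4 _
    rw [h4, Pi.add_apply, h1, h2]; exact h3)

theorem toY_smul {F : ℝ × ℝ → ℂ} (hF : Continuous F) (z : ℂ) :
    toY p (fun x => z * F x) = z • toY p F :=
  Y_ext (by
    filter_upwards [coeFn_toY hF, coeFn_toY (continuous_const.mul hF : Continuous fun x => z * F x),
      Lp.coeFn_smul z (toY p F)] with x h1 h3 h4 _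
    rw [h4, Pi.smul_apply, h1]; exact h3)

theorem inner_eq_integral (u v : Y p) :
    inner ℂ u v = ∫ x in Ω p, v x * (starRingEnd ℂ) (u x) := by
  rw [L2.inner_def]; rfl

theorem inner_toY {F : ℝ × ℝ → ℂ} (hF : Continuous F) (u : Y p) :
    inner ℂ (toY p F) u = ∫ x in Ω p, (starRingEnd ℂ) (F x) * u x := by
  rw [inner_eq_integral]
  refine integral_congr_ae ((coeFn_toY hF).mono fun x hx => ?_)
  simp only [hx, mul_comm]

theorem integral_smul_eq_inner {φ : ℝ × ℝ → ℝ} (hφ : Continuous φ) (u : Y p) :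
    ∫ x in Ω p, φ x • u x = inner ℂ (toY p fun x => (φ x : ℂ)) u := by
  rw [inner_toY (F := fun x => (φ x : ℂ)) (Complex.continuous_ofReal.comp hφ)]
  simp

theorem mem_mult_domain {c : ℝ × ℝ → ℝ} {C : ℝ} (hm : Measurable c)
    (hC : ∀ x ∈ Ω p, ‖c x‖ ≤ C) (u : Y p) : u ∈ (mult p c).domain :=
  (Lp.memLp u).of_le_mul (c := C)
    (hm.aestronglyMeasurable.smul (Lp.aestronglyMeasurable u))
    ((ae_mem_Ω p).mono fun x hx => by
      rw [norm_smul]; exact mul_le_mul_of_nonneg_right (hC x hx) (norm_nonneg _))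

theorem coeFn_mult {c : ℝ × ℝ → ℝ} (u : (mult p c).domain) :
    mult p c u =ᵐ[volume.restrict (Ω p)] fun x => c x • u.1 x :=
  MemLp.coeFn_toLp u.2

theorem mem_mult_domain_of_continuous {c : ℝ × ℝ → ℝ} (hc : Continuous c) (u : Y p) :
    u ∈ (mult p c).domain := by
  obtain ⟨C, -, hC⟩ := exists_bound p hc
  exact mem_mult_domain hc.measurable (fun x hx => hC x (Ω_subset_box p hx)) u

theorem norm_mult_le {c : ℝ × ℝ → ℝ} {C : ℝ} (hC : ∀ x ∈ Ω p, ‖c x‖ ≤ C)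
    (u : (mult p c).domain) : ‖mult p c u‖ ≤ C * ‖(u : Y p)‖ := by
  refine Lp.norm_le_mul_norm_of_ae_le_mul ?_
  filter_upwards [coeFn_mult u, ae_mem_Ω p] with x h1 h2
  rw [h1, norm_smul]
  exact mul_le_mul_of_nonneg_right (hC x h2) (norm_nonneg _)

variable (p) in
/-- Multiplication by a continuous function, as a bounded operator. -/
def mulL (c : ℝ × ℝ → ℝ) : Y p →L[ℂ] Y p :=
  open Classical in if hc : Continuous c then
    LinearMap.mkContinuousOfExistsBound
      ((mult p c).toFun.comp
        (LinearMap.id.codRestrict (mult p c).domain (mem_mult_domain_of_continuous hc)))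
      (by
        obtain ⟨C, -, hC⟩ := exists_bound p hc
        exact ⟨C, fun u => norm_mult_le (fun x hx => hC x (Ω_subset_box p hx))
          ⟨u, mem_mult_domain_of_continuous hc u⟩⟩)
  else 0

theorem mulL_eq_mult {c : ℝ × ℝ → ℝ} (hc : Continuous c) (u : Y p) :
    mulL p c u = mult p c ⟨u, mem_mult_domain_of_continuous hc u⟩ := by
  rw [mulL, dif_pos hc]; rfl

theorem coeFn_mulL {c : ℝ × ℝ → ℝ} (hc : Continuous c) (u : Y p) :
    mulL p c u =ᵐ[volume.restrict (Ω p)] fun x => c x * u x := by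
  rw [mulL_eq_mult hc]
  exact coeFn_mult _

theorem norm_mulL_le {c : ℝ × ℝ → ℝ} (hc : Continuous c) {C : ℝ} (hC : ∀ x ∈ Ω p, ‖c x‖ ≤ C)
    (u : Y p) : ‖mulL p c u‖ ≤ C * ‖u‖ := by
  rw [mulL_eq_mult hc]
  exact norm_mult_le hC _

theorem mulL_mulL {c d e : ℝ × ℝ → ℝ} (hc : Continuous c) (hd : Continuous d) (he : Continuous e)
    (h : ∀ x ∈ Ω p, c x * d x = e x) (u : Y p) : mulL p c (mulL p d u) = mulL p e u :=
  Y_ext (by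
    filter_upwards [coeFn_mulL hc (mulL p d u), coeFn_mulL hd u, coeFn_mulL he u] with x h1 h2 h3 hx
    rw [h1, h2, h3, ← h x hx]; push_cast; ring)

theorem mulL_add {c d e : ℝ × ℝ → ℝ} (hc : Continuous c) (hd : Continuous d) (he : Continuous e)
    (h : ∀ x ∈ Ω p, c x + d x = e x) (u : Y p) : mulL p c u + mulL p d u = mulL p e u :=
  Y_ext (by
    filter_upwards [Lp.coeFn_add (mulL p c u) (mulL p d u), coeFn_mulL hc u, coeFn_mulL hd u,
      coeFn_mulL he u] with x h0 h1 h2 h3 hx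
    rw [h0, Pi.add_apply, h1, h2, h3, ← h x hx]; push_cast; ring)

theorem mulL_one {c : ℝ × ℝ → ℝ} (hc : Continuous c) (h : ∀ x ∈ Ω p, c x = 1) (u : Y p) :
    mulL p c u = u :=
  Y_ext (by
    filter_upwards [coeFn_mulL hc u] with x h1 hx
    rw [h1, h x hx]; simp)

theorem mulL_const {a : ℝ} (u : Y p) : mulL p (fun _ => a) u = (a : ℂ) • u :=
  Y_ext (by
    filter_upwards [coeFn_mulL continuous_const u, Lp.coeFn_smul (a : ℂ) u] with x h1 h2 _
    rw [h1, h2]; simp)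

theorem mulL_toY {c : ℝ × ℝ → ℝ} (hc : Continuous c) {F G : ℝ × ℝ → ℂ} (hF : Continuous F)
    (hG : Continuous G) (h : ∀ x ∈ Ω p, c x * F x = G x) : mulL p c (toY p F) = toY p G :=
  Y_ext (by
    filter_upwards [coeFn_mulL hc (toY p F), coeFn_toY hF, coeFn_toY hG] with x h1 h2 h3 hx
    rw [h1, h2, h3, h x hx])

theorem inner_mulL (c : ℝ × ℝ → ℝ) (u v : Y p) :
    inner ℂ (mulL p c u) v = inner ℂ u (mulL p c v) := by
  by_cases hc : Continuous c
  · rw [inner_eq_integral, inner_eq_integral]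
    refine integral_congr_ae ?_
    filter_upwards [coeFn_mulL hc u, coeFn_mulL hc v] with x h1 h2
    rw [h1, h2, map_mul, Complex.conj_ofReal]; ring
  · simp [mulL, dif_neg hc]

end Functions

/-! ### Calculus of the integration by parts relation -/

section WeakDerivatives

variable {p : Params}

theorem mem_partsGraph_iff {T : Set (ℝ × ℝ → ℝ)} {i j : ℕ} {u v : Y p} :
    (u, v) ∈ partsGraph p T i j ↔ ∀ φ ∈ T, ContDiff ℝ ∞ φ →
      inner ℂ (toY p fun x => (pd i j φ x : ℂ)) u =
        (-1) ^ (i + j) * inner ℂ (toY p fun x => (φ x : ℂ)) v := by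
  refine forall_congr' fun φ => forall_congr' fun _ => forall_congr' fun hφ => ?_
  rw [integral_smul_eq_inner (contDiff_pd i j φ hφ).continuous,
    integral_smul_eq_inner hφ.continuous]

/-- Each test function imposes one continuous linear condition. Closedness lets derivative formulas
that are checked on basis vectors pass to all of L². -/
theorem isClosed_partsGraph (T : Set (ℝ × ℝ → ℝ)) (i j : ℕ) :
    IsClosed (partsGraph p T i j : Set (Y p × Y p)) := by
  have : (partsGraph p T i j : Set (Y p × Y p)) = ⋂ (φ : ℝ × ℝ → ℝ) (_ : φ ∈ T)
      (_ : ContDiff ℝ ∞ φ), {w | inner ℂ (toY p fun x => (pd i j φ x : ℂ)) w.1 =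
        (-1) ^ (i + j) * inner ℂ (toY p fun x => (φ x : ℂ)) w.2} := by
    ext w
    simp only [mem_iInter]
    exact mem_partsGraph_iff
  rw [this]
  refine isClosed_iInter fun φ => isClosed_iInter fun _ => isClosed_iInter fun _ => ?_
  refine isClosed_eq ?_ ?_
  · exact continuous_const.inner continuous_fst
  · exact continuous_const.mul (continuous_const.inner continuous_snd)

theorem partsGraph_anti {T T' : Set (ℝ × ℝ → ℝ)} (h : T ⊆ T') (i j : ℕ) :
    partsGraph p T' i j ≤ partsGraph p T i j := fun _ hw φ hφ => hw φ (h hφ)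

/-- A family of test functions that is stable under differentiation. -/
structure StableTests (T : Set (ℝ × ℝ → ℝ)) : Prop where
  dr_mem : ∀ φ ∈ T, ContDiff ℝ ∞ φ → dr φ ∈ T
  dpsi_mem : ∀ φ ∈ T, ContDiff ℝ ∞ φ → dpsi φ ∈ T

theorem pd_succ_left (i j : ℕ) (φ : ℝ × ℝ → ℝ) : pd (i + 1) j φ = dr (pd i j φ) :=
  Function.iterate_succ_apply' _ _ _

theorem pd_zero_succ (j : ℕ) (φ : ℝ × ℝ → ℝ) : pd 0 (j + 1) φ = dpsi (pd 0 j φ) :=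
  Function.iterate_succ_apply' _ _ _

theorem contDiff_dr {φ : ℝ × ℝ → ℝ} (hφ : ContDiff ℝ ∞ φ) : ContDiff ℝ ∞ (dr φ) :=
  contDiff_pd 1 0 φ hφ

theorem contDiff_dpsi {φ : ℝ × ℝ → ℝ} (hφ : ContDiff ℝ ∞ φ) : ContDiff ℝ ∞ (dpsi φ) :=
  contDiff_pd 0 1 φ hφ

theorem StableTests.pd_mem {T : Set (ℝ × ℝ → ℝ)} (hT : StableTests T) (i j : ℕ) {φ : ℝ × ℝ → ℝ}
    (hφT : φ ∈ T) (hφ : ContDiff ℝ ∞ φ) : pd i j φ ∈ T := by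
  induction i with
  | zero =>
    induction j with
    | zero => exact hφT
    | succ j ih => rw [pd_zero_succ]; exact hT.dpsi_mem _ ih (contDiff_pd 0 j φ hφ)
  | succ i ih => rw [pd_succ_left]; exact hT.dr_mem _ ih (contDiff_pd i j φ hφ)

theorem dr_dpsi_comm {φ : ℝ × ℝ → ℝ} (hφ : ContDiff ℝ ∞ φ) : dr (dpsi φ) = dpsi (dr φ) := by
  have hd : Differentiable ℝ (fderiv ℝ φ) :=
    (hφ.fderiv_right (m := 1) (by norm_cast)).differentiable one_ne_zero
  ext x
  have hs : IsSymmSndFDerivAt ℝ φ x := hφ.contDiffAt.isSymmSndFDerivAt (by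
    simp only [minSmoothness_of_isRCLikeNormedField]; exact WithTop.coe_le_coe.2 (le_top : (2 : ℕ∞) ≤ ⊤))
  have e (v w : ℝ × ℝ) : fderiv ℝ (fun y => fderiv ℝ φ y v) x w = fderiv ℝ (fderiv ℝ φ) x w v := by
    have h1 : HasFDerivAt (fun y => fderiv ℝ φ y v)
        ((ContinuousLinearMap.apply ℝ ℝ v).comp (fderiv ℝ (fderiv ℝ φ) x)) x :=
      (ContinuousLinearMap.apply ℝ ℝ v).hasFDerivAt.comp x (hd x).hasFDerivAt
    rw [h1.fderiv]; rfl
  change fderiv ℝ (fun y => fderiv ℝ φ y (0, 1)) x (1, 0) =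
    fderiv ℝ (fun y => fderiv ℝ φ y (1, 0)) x (0, 1)
  rw [e, e]
  exact hs _ _

theorem pd_dpsi_comm (i j : ℕ) {φ : ℝ × ℝ → ℝ} (hφ : ContDiff ℝ ∞ φ) :
    pd i j (dpsi φ) = dpsi (pd i j φ) := by
  induction i with
  | zero => exact (Function.iterate_succ_apply _ _ _).symm.trans (Function.iterate_succ_apply' _ _ _)
  | succ i ih => rw [pd_succ_left, ih, pd_succ_left, dr_dpsi_comm (contDiff_pd i j φ hφ)]

theorem pd_pd (i j k l : ℕ) {φ : ℝ × ℝ → ℝ} (hφ : ContDiff ℝ ∞ φ) :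
    pd k l (pd i j φ) = pd (i + k) (j + l) φ := by
  induction k with
  | zero =>
    induction l with
    | zero => rfl
    | succ l ih =>
      rw [pd_zero_succ, ih, ← add_assoc, add_zero, ← pd_dpsi_comm _ _ hφ]
      simp only [pd]
      rw [Function.iterate_succ_apply]
  | succ k ih => rw [pd_succ_left, ih, ← add_assoc, pd_succ_left]

theorem partsGraph_comp {T : Set (ℝ × ℝ → ℝ)} (hT : StableTests T) {i j k l : ℕ} {u v w : Y p}
    (h1 : (u, v) ∈ partsGraph p T k l) (h2 : (v, w) ∈ partsGraph p T i j) :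
    (u, w) ∈ partsGraph p T (i + k) (j + l) := by
  rw [mem_partsGraph_iff] at *
  intro φ hφT hφ
  have e1 := h1 _ (hT.pd_mem i j hφT hφ) (contDiff_pd i j φ hφ)
  rw [pd_pd _ _ _ _ hφ, h2 φ hφT hφ, ← mul_assoc, ← pow_add] at e1
  rw [e1]
  congr 2
  ring

/-- Testing the formula for u against a derivative of φ, again an admissible test function, yields
the formula for v up to a sign that squares to 1. -/
theorem partsGraph_of_comp {T : Set (ℝ × ℝ → ℝ)} (hT : StableTests T) {i j k l : ℕ} {u v w : Y p}
    (h1 : (u, v) ∈ partsGraph p T k l) (h2 : (u, w) ∈ partsGraph p T (i + k) (j + l)) :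
    (v, w) ∈ partsGraph p T i j := by
  rw [mem_partsGraph_iff] at *
  intro φ hφT hφ
  have e1 := h1 _ (hT.pd_mem i j hφT hφ) (contDiff_pd i j φ hφ)
  rw [pd_pd _ _ _ _ hφ, h2 φ hφT hφ] at e1
  have h3 : ((-1 : ℂ) ^ (k + l)) * (-1) ^ (k + l) = 1 := by rw [← mul_pow]; simp
  have h4 : ((-1 : ℂ) ^ (i + k + (j + l))) = (-1) ^ (k + l) * (-1) ^ (i + j) := by
    rw [← pow_add]; congr 1; ring
  calc inner ℂ (toY p fun x => (pd i j φ x : ℂ)) v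
      = (-1 : ℂ) ^ (k + l) * ((-1) ^ (k + l) * inner ℂ (toY p fun x => (pd i j φ x : ℂ)) v) := by
        rw [← mul_assoc, h3, one_mul]
    _ = _ := by rw [← e1, h4, mul_assoc, ← mul_assoc, h3, one_mul]

theorem stableTests_interior : StableTests (interiorTests p) := by
  have key : ∀ v, ∀ φ ∈ interiorTests p, (fun x => fderiv ℝ φ x v) ∈ interiorTests p :=
    fun v φ hφ => ⟨hφ.1.fderiv_apply ℝ v, (tsupport_fderiv_apply_subset ℝ v).trans hφ.2⟩
  exact ⟨fun φ hφ _ => key _ φ hφ, fun φ hφ _ => key _ φ hφ⟩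

/-- Test functions with period `2π` in `ψ`. -/
def periodicTests : Set (ℝ × ℝ → ℝ) := {φ | ∀ r ψ : ℝ, φ (r, ψ + 2 * Real.pi) = φ (r, ψ)}

theorem stableTests_periodic : StableTests periodicTests := by
  have key : ∀ v, ∀ φ ∈ periodicTests, (fun x => fderiv ℝ φ x v) ∈ periodicTests := by
    intro v φ hφ r ψ
    have : (fun x : ℝ × ℝ => φ (x + (0, 2 * Real.pi))) = φ := by
      ext ⟨a, b⟩
      simpa using hφ a b
    have h1 := fderiv_comp_add_right (𝕜 := ℝ) (f := φ) (x := (r, ψ)) (0, 2 * Real.pi)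
    rw [this] at h1
    change fderiv ℝ φ (r, ψ + 2 * Real.pi) v = fderiv ℝ φ (r, ψ) v
    rw [h1]; simp
  exact ⟨fun φ hφ _ => key _ φ hφ, fun φ hφ _ => key _ φ hφ⟩

theorem fderiv_mul_apply' {φ c : ℝ × ℝ → ℝ} (hφ : ContDiff ℝ ∞ φ) (hc : ContDiff ℝ ∞ c)
    (v x : ℝ × ℝ) : fderiv ℝ (fun y => φ y * c y) x v =
      fderiv ℝ φ x v * c x + φ x * fderiv ℝ c x v := by
  rw [fderiv_fun_mul (hφ.differentiable (by simp) x) (hc.differentiable (by simp) x)]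
  simp; ring

theorem continuous_ofReal_comp {φ : ℝ × ℝ → ℝ} (hφ : Continuous φ) :
    Continuous fun x => (φ x : ℂ) := Complex.continuous_ofReal.comp hφ

/-- The coefficient is moved onto the test function, so the product rule needs only that the class
of tests is stable under multiplication by c. -/
theorem partsGraph_leibniz {T : Set (ℝ × ℝ → ℝ)} {c : ℝ × ℝ → ℝ} (hc : ContDiff ℝ ∞ c)
    (hcT : ∀ φ ∈ T, (fun x => φ x * c x) ∈ T) {u v : Y p} :
    ((u, v) ∈ partsGraph p T 1 0 →
      (mulL p c u, mulL p c v + mulL p (dr c) u) ∈ partsGraph p T 1 0) ∧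
    ((u, v) ∈ partsGraph p T 0 1 →
      (mulL p c u, mulL p c v + mulL p (dpsi c) u) ∈ partsGraph p T 0 1) := by
  have key : ∀ (e : ℝ × ℝ) (φ : ℝ × ℝ → ℝ), ContDiff ℝ ∞ φ →
      inner ℂ (toY p fun x => (fderiv ℝ (fun y => φ y * c y) x e : ℂ)) u =
        (-1) * inner ℂ (toY p fun x => ((φ x * c x : ℝ) : ℂ)) v →
      inner ℂ (toY p fun x => (fderiv ℝ φ x e : ℂ)) (mulL p c u) =
        (-1) * inner ℂ (toY p fun x => (φ x : ℂ))
          (mulL p c v + mulL p (fun x => fderiv ℝ c x e) u) := by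
    intro e φ hφ h
    have c1 : Continuous fun x => fderiv ℝ φ x e :=
      (hφ.continuous_fderiv (by simp)).clm_apply continuous_const
    have c2 : Continuous fun x => fderiv ℝ c x e :=
      (hc.continuous_fderiv (by simp)).clm_apply continuous_const
    have c3 : Continuous fun x => fderiv ℝ (fun y => φ y * c y) x e :=
      ((hφ.mul hc).continuous_fderiv (by simp)).clm_apply continuous_const
    have e1 : mulL p c (toY p fun x => (fderiv ℝ φ x e : ℂ)) +
        mulL p (fun x => fderiv ℝ c x e) (toY p fun x => (φ x : ℂ)) =
        toY p fun x => (fderiv ℝ (fun y => φ y * c y) x e : ℂ) := by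
      rw [mulL_toY hc.continuous (continuous_ofReal_comp c1)
        (continuous_ofReal_comp (c1.mul hc.continuous)) (by intros; simp only [Pi.mul_apply]; push_cast; ring),
        mulL_toY c2 (continuous_ofReal_comp hφ.continuous)
        (continuous_ofReal_comp (hφ.continuous.mul c2)) (by intros; simp only [Pi.mul_apply]; push_cast; ring),
        ← toY_add (continuous_ofReal_comp (c1.mul hc.continuous))
          (continuous_ofReal_comp (hφ.continuous.mul c2))]
      congr 1; ext x
      simp only [Pi.mul_apply]; rw [fderiv_mul_apply' hφ hc]; push_cast; ring
    have e2 : mulL p c (toY p fun x => (φ x : ℂ)) = toY p fun x => ((φ x * c x : ℝ) : ℂ) :=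
      mulL_toY hc.continuous (continuous_ofReal_comp hφ.continuous)
        (continuous_ofReal_comp (hφ.continuous.mul hc.continuous)) (by intros; push_cast; ring)
    rw [← e1, ← e2, inner_add_left, inner_mulL, inner_mulL, inner_mulL] at h
    rw [inner_add_right, mul_add, ← h]
    ring
  constructor
  · intro h
    rw [mem_partsGraph_iff] at *
    intro φ hφT hφ
    have h1 := h _ (hcT φ hφT) (hφ.mul hc)
    rw [show (-1 : ℂ) ^ (1 + 0) = -1 by norm_num] at h1 ⊢
    exact key (1, 0) φ hφ h1
  · intro h
    rw [mem_partsGraph_iff] at *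
    intro φ hφT hφ
    have h1 := h _ (hcT φ hφT) (hφ.mul hc)
    rw [show (-1 : ℂ) ^ (0 + 1) = -1 by norm_num] at h1 ⊢
    exact key (0, 1) φ hφ h1

theorem mul_mem_interior {c : ℝ × ℝ → ℝ} {φ : ℝ × ℝ → ℝ} (hφ : φ ∈ interiorTests p) :
    (fun x => φ x * c x) ∈ interiorTests p :=
  ⟨hφ.1.mul_right, (tsupport_mul_subset_left).trans hφ.2⟩

theorem mul_mem_periodic {c : ℝ × ℝ → ℝ} (hc : c ∈ periodicTests) {φ : ℝ × ℝ → ℝ}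
    (hφ : φ ∈ periodicTests) : (fun x => φ x * c x) ∈ periodicTests := fun r ψ => by
  simp only [hφ r ψ, hc r ψ]

end WeakDerivatives

/-! ### Integration by parts for smooth functions on the rectangle -/

section Classical

variable {p : Params}

theorem two_pi_pos' : (0 : ℝ) < 2 * Real.pi := by positivity

theorem integral_Ioo_deriv_eq {a b : ℝ} (hab : a ≤ b) {F F' : ℝ → ℂ}
    (hF : ∀ t, HasDerivAt F (F' t) t) (hF' : Continuous F') :
    ∫ t in Ioo a b, F' t = F b - F a := by
  rw [← integral_Ioc_eq_integral_Ioo, ← intervalIntegral.integral_of_le hab]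
  exact intervalIntegral.integral_eq_sub_of_hasDerivAt (fun t _ => hF t)
    (hF'.intervalIntegrable _ _)

theorem restrict_Ω_eq : (volume : Measure (ℝ × ℝ)).restrict (Ω p) =
    ((volume : Measure ℝ).restrict (Ioo p.rmin p.rmax)).prod
      ((volume : Measure ℝ).restrict (Ioo 0 (2 * Real.pi))) := by
  rw [Measure.prod_restrict, ← Measure.volume_eq_prod]; rfl

theorem hasDerivAt_slice_left {G : Type*} [NormedAddCommGroup G] [NormedSpace ℝ G]
    {F : ℝ × ℝ → G} (hF : Differentiable ℝ F) (r ψ : ℝ) :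
    HasDerivAt (fun t => F (t, ψ)) (fderiv ℝ F (r, ψ) (1, 0)) r :=
  (hF (r, ψ)).hasFDerivAt.comp_hasDerivAt (f := fun t => (t, ψ)) r
    ((hasDerivAt_id r).prodMk (hasDerivAt_const r ψ))

theorem hasDerivAt_slice_right {G : Type*} [NormedAddCommGroup G] [NormedSpace ℝ G]
    {F : ℝ × ℝ → G} (hF : Differentiable ℝ F) (r ψ : ℝ) :
    HasDerivAt (fun t => F (r, t)) (fderiv ℝ F (r, ψ) (0, 1)) ψ :=
  (hF (r, ψ)).hasFDerivAt.comp_hasDerivAt (f := fun t => (r, t)) ψ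
    ((hasDerivAt_const ψ r).prodMk (hasDerivAt_id ψ))

theorem integral_fderiv_left [hp : p.Admissible] {Ψ : ℝ × ℝ → ℂ} (hΨ : ContDiff ℝ 1 Ψ)
    (h0 : ∀ ψ, Ψ (p.rmin, ψ) = Ψ (p.rmax, ψ)) :
    ∫ x in Ω p, fderiv ℝ Ψ x (1, 0) = 0 := by
  have hc : Continuous fun x => fderiv ℝ Ψ x (1, 0) :=
    (hΨ.continuous_fderiv one_ne_zero).clm_apply continuous_const
  have hi := integrable_of_continuous p hc
  rw [restrict_Ω_eq] at hi ⊢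
  rw [integral_prod_symm _ hi]
  refine integral_eq_zero_of_ae (Eventually.of_forall fun ψ => ?_)
  have := integral_Ioo_deriv_eq hp.rmin_lt.le (F := fun t => Ψ (t, ψ))
    (hasDerivAt_slice_left (hΨ.differentiable one_ne_zero) · ψ) (hc.comp (by fun_prop))
  simpa [h0] using this

theorem integral_fderiv_right {Ψ : ℝ × ℝ → ℂ} (hΨ : ContDiff ℝ 1 Ψ)
    (h0 : ∀ r, Ψ (r, 0) = Ψ (r, 2 * Real.pi)) :
    ∫ x in Ω p, fderiv ℝ Ψ x (0, 1) = 0 := by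
  have hc : Continuous fun x => fderiv ℝ Ψ x (0, 1) :=
    (hΨ.continuous_fderiv one_ne_zero).clm_apply continuous_const
  have hi := integrable_of_continuous p hc
  rw [restrict_Ω_eq] at hi ⊢
  rw [integral_prod _ hi]
  refine integral_eq_zero_of_ae (Eventually.of_forall fun r => ?_)
  have := integral_Ioo_deriv_eq two_pi_pos'.le (F := fun t => Ψ (r, t))
    (hasDerivAt_slice_right (hΨ.differentiable one_ne_zero) r) (hc.comp (by fun_prop))
  simpa [h0] using this

theorem inner_toY_fderiv {e : ℝ × ℝ} {φ : ℝ × ℝ → ℝ} {F : ℝ × ℝ → ℂ} (hφ : ContDiff ℝ ∞ φ)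
    (hF : ContDiff ℝ ∞ F) (h : ∫ x in Ω p, fderiv ℝ (fun y => (φ y : ℂ) * F y) x e = 0) :
    inner ℂ (toY p fun x => (fderiv ℝ φ x e : ℂ)) (toY p F) =
      (-1) * inner ℂ (toY p fun x => (φ x : ℂ)) (toY p fun x => fderiv ℝ F x e) := by
  have c1 : Continuous fun x => ((fderiv ℝ φ x e : ℝ) : ℂ) :=
    continuous_ofReal_comp ((hφ.continuous_fderiv (by simp)).clm_apply continuous_const)
  have c2 : Continuous fun x => fderiv ℝ F x e :=
    (hF.continuous_fderiv (by simp)).clm_apply continuous_const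
  have c3 := continuous_ofReal_comp hφ.continuous
  rw [inner_toY c1, inner_toY c3]
  have e1 : ∫ x in Ω p, (starRingEnd ℂ) (fderiv ℝ φ x e : ℂ) * toY p F x =
      ∫ x in Ω p, (fderiv ℝ φ x e : ℂ) * F x :=
    integral_congr_ae ((coeFn_toY hF.continuous).mono fun x hx => by
      simp only [hx, Complex.conj_ofReal])
  have e2 : ∫ x in Ω p, (starRingEnd ℂ) (φ x : ℂ) * toY p (fun x => fderiv ℝ F x e) x =
      ∫ x in Ω p, (φ x : ℂ) * fderiv ℝ F x e :=
    integral_congr_ae ((coeFn_toY c2).mono fun x hx => by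
      simp only [hx, Complex.conj_ofReal])
  rw [e1, e2]
  have e3 : ∀ x, fderiv ℝ (fun y => (φ y : ℂ) * F y) x e =
      (fderiv ℝ φ x e : ℂ) * F x + (φ x : ℂ) * fderiv ℝ F x e := by
    intro x
    have h1 : HasFDerivAt (fun y => (φ y : ℂ)) (Complex.ofRealCLM.comp (fderiv ℝ φ x)) x :=
      Complex.ofRealCLM.hasFDerivAt.comp x (hφ.differentiable (by simp) x).hasFDerivAt
    have h2 := (hF.differentiable (by simp) x).hasFDerivAt
    have h3 : HasFDerivAt (fun y => (φ y : ℂ) * F y) _ x := h1.mul h2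
    rw [h3.fderiv]
    simp; ring
  simp only [e3] at h
  have i1 : Integrable (fun x => (fderiv ℝ φ x e : ℂ) * F x) (volume.restrict (Ω p)) :=
    integrable_of_continuous p (c1.mul hF.continuous)
  have i2 : Integrable (fun x => (φ x : ℂ) * fderiv ℝ F x e) (volume.restrict (Ω p)) :=
    integrable_of_continuous p (c3.mul c2)
  rw [integral_add i1 i2] at h
  linear_combination h

theorem contDiff_ofReal_mul {φ : ℝ × ℝ → ℝ} {F : ℝ × ℝ → ℂ} (hφ : ContDiff ℝ ∞ φ)
    (hF : ContDiff ℝ ∞ F) : ContDiff ℝ 1 fun y => (φ y : ℂ) * F y :=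
  ((Complex.ofRealCLM.contDiff.comp hφ).mul hF).of_le (by simp)

theorem toY_mem_partsGraph_left [p.Admissible] {F : ℝ × ℝ → ℂ} (hF : ContDiff ℝ ∞ F) {T : Set (ℝ × ℝ → ℝ)}
    (h : ∀ φ ∈ T, ∀ ψ, φ (p.rmin, ψ) * F (p.rmin, ψ) = φ (p.rmax, ψ) * F (p.rmax, ψ)) :
    (toY p F, toY p fun x => fderiv ℝ F x (1, 0)) ∈ partsGraph p T 1 0 := by
  rw [mem_partsGraph_iff]
  intro φ hφT hφ
  rw [show (-1 : ℂ) ^ (1 + 0) = -1 by norm_num]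
  exact inner_toY_fderiv hφ hF (integral_fderiv_left (contDiff_ofReal_mul hφ hF) (h φ hφT))

theorem toY_mem_partsGraph_right {F : ℝ × ℝ → ℂ} (hF : ContDiff ℝ ∞ F) {T : Set (ℝ × ℝ → ℝ)}
    (h : ∀ φ ∈ T, ∀ r, φ (r, 0) * F (r, 0) = φ (r, 2 * Real.pi) * F (r, 2 * Real.pi)) :
    (toY p F, toY p fun x => fderiv ℝ F x (0, 1)) ∈ partsGraph p T 0 1 := by
  rw [mem_partsGraph_iff]
  intro φ hφT hφ
  rw [show (-1 : ℂ) ^ (0 + 1) = -1 by norm_num]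
  exact inner_toY_fderiv hφ hF (integral_fderiv_right (contDiff_ofReal_mul hφ hF) (h φ hφT))

end Classical

/-! ### Removing the compact support of test functions -/

section Cutoff

open Real (smoothTransition)

/-- The weight is t + 1 because the cutoffs evaluate the transition at n(t - a) - 1: the weight then
becomes n times the distance to the endpoint. -/
theorem exists_smoothTransition_deriv_bound :
    ∃ C, 0 ≤ C ∧ ∀ t : ℝ, |t + 1| * |deriv smoothTransition t| ≤ C := by
  have hcont : Continuous (deriv smoothTransition) :=
    (Real.smoothTransition.contDiff (n := 1)).continuous_deriv le_rfl
  obtain ⟨C, hC⟩ := (isCompact_Icc (a := (0 : ℝ)) (b := 1)).exists_bound_of_continuousOn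
    hcont.continuousOn
  have hC0 : 0 ≤ C := (norm_nonneg _).trans (hC 0 (by simp))
  refine ⟨2 * C, by positivity, fun t => ?_⟩
  rcases lt_or_ge t 0 with h | h
  · have : smoothTransition =ᶠ[𝓝 t] fun _ => 0 :=
      (eventually_lt_nhds h).mono fun x hx => Real.smoothTransition.zero_of_nonpos hx.le
    rw [this.deriv_eq]; simp [hC0]
  rcases lt_or_ge 1 t with h' | h'
  · have : smoothTransition =ᶠ[𝓝 t] fun _ => 1 :=
      (eventually_gt_nhds h').mono fun x hx => Real.smoothTransition.one_of_one_le hx.le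
    rw [this.deriv_eq]; simp [hC0]
  · have h1 : |t + 1| ≤ 2 := by rw [abs_of_nonneg] <;> linarith
    exact mul_le_mul h1 (hC t ⟨h, h'⟩) (abs_nonneg _) (by norm_num)

/-- Smooth cutoff functions that exhaust the interval `(a, b)`. -/
def cut (a b : ℝ) (n : ℕ) (t : ℝ) : ℝ :=
  smoothTransition (n * (t - a) - 1) * smoothTransition (n * (b - t) - 1)

variable {a b : ℝ} {n : ℕ} {t : ℝ}

theorem contDiff_cut : ContDiff ℝ ∞ (cut a b n) := by
  unfold cut
  exact (Real.smoothTransition.contDiff.comp (by fun_prop)).mul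
    (Real.smoothTransition.contDiff.comp (by fun_prop))

theorem cut_nonneg : 0 ≤ cut a b n t :=
  mul_nonneg (Real.smoothTransition.nonneg _) (Real.smoothTransition.nonneg _)

theorem cut_le_one : cut a b n t ≤ 1 :=
  mul_le_one₀ (Real.smoothTransition.le_one _) (Real.smoothTransition.nonneg _)
    (Real.smoothTransition.le_one _)

theorem support_cut_subset (hn : 0 < n) :
    Function.support (cut a b n) ⊆ Icc (a + (n : ℝ)⁻¹) (b - (n : ℝ)⁻¹) := by
  have hn' : (0 : ℝ) < n := by exact_mod_cast hn
  intro t ht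
  have h1 : 0 < n * (t - a) - 1 := by
    by_contra h
    exact ht (by rw [cut, Real.smoothTransition.zero_of_nonpos (not_lt.1 h), zero_mul])
  have h2 : 0 < n * (b - t) - 1 := by
    by_contra h
    exact ht (by rw [cut, Real.smoothTransition.zero_of_nonpos (not_lt.1 h), mul_zero])
  have e : (n : ℝ) * (n : ℝ)⁻¹ = 1 := mul_inv_cancel₀ hn'.ne'
  constructor <;> nlinarith

theorem cut_eventually_eq_one (ht : t ∈ Ioo a b) : ∀ᶠ n : ℕ in atTop, cut a b n =ᶠ[𝓝 t] 1 := by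
  set d := min (t - a) (b - t) / 2 with hd
  have hd0 : 0 < d := half_pos (lt_min (sub_pos.2 ht.1) (sub_pos.2 ht.2))
  obtain ⟨N, hN⟩ := exists_nat_gt (2 / d)
  filter_upwards [eventually_ge_atTop N] with n hn
  have hn' : 2 < n * d := by
    rw [div_lt_iff₀ hd0] at hN
    exact hN.trans_le (by gcongr)
  filter_upwards [Metric.ball_mem_nhds t hd0] with s hs
  rw [Real.ball_eq_Ioo] at hs
  have h1 := min_le_left (t - a) (b - t)
  have h2 := min_le_right (t - a) (b - t)
  have hn0 : (0 : ℝ) ≤ n := n.cast_nonneg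
  have h3 : d ≤ s - a := by have := hs.1; linarith
  have h4 : d ≤ b - s := by have := hs.2; linarith
  rw [cut, Real.smoothTransition.one_of_one_le, Real.smoothTransition.one_of_one_le]
  · simp
  · nlinarith [mul_le_mul_of_nonneg_left h4 hn0]
  · nlinarith [mul_le_mul_of_nonneg_left h3 hn0]

/-- The derivative of the cutoff is of size n, but it lives at distance between 1/n and 2/n from an
endpoint. A quantity that vanishes linearly at both endpoints compensates this, uniformly in n. -/
theorem exists_deriv_cut_bound : ∃ C, 0 ≤ C ∧ ∀ (a b : ℝ) (n : ℕ) (t M y : ℝ), 0 ≤ M →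
    |y| ≤ M * |t - a| → |y| ≤ M * |b - t| → |y * deriv (cut a b n) t| ≤ C * M := by
  obtain ⟨C, hC0, hC⟩ := exists_smoothTransition_deriv_bound
  refine ⟨2 * C, by positivity, fun a b n t M y hM h1 h2 => ?_⟩
  have hst : Differentiable ℝ smoothTransition :=
    (Real.smoothTransition.contDiff (n := 1)).differentiable one_ne_zero
  have d1 : HasDerivAt (fun t => smoothTransition (n * (t - a) - 1))
      (deriv smoothTransition (n * (t - a) - 1) * n) t := by
    refine (hst _).hasDerivAt.comp t ?_
    simpa using (((hasDerivAt_id t).sub_const a).const_mul (n : ℝ)).sub_const 1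
  have d2 : HasDerivAt (fun t => smoothTransition (n * (b - t) - 1))
      (deriv smoothTransition (n * (b - t) - 1) * (-n)) t := by
    refine (hst _).hasDerivAt.comp t ?_
    simpa using (((hasDerivAt_id t).const_sub b).const_mul (n : ℝ)).sub_const 1
  have hd : deriv (cut a b n) t = _ := (d1.mul d2).deriv
  rw [hd]
  have b1 := hC (n * (t - a) - 1)
  have b2 := hC (n * (b - t) - 1)
  rw [sub_add_cancel, abs_mul, Nat.abs_cast] at b1 b2
  set x1 := smoothTransition (n * (t - a) - 1)
  set x2 := smoothTransition (n * (b - t) - 1)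
  have hx1 : |x1| ≤ 1 := by
    rw [abs_of_nonneg (Real.smoothTransition.nonneg _)]; exact Real.smoothTransition.le_one _
  have hx2 : |x2| ≤ 1 := by
    rw [abs_of_nonneg (Real.smoothTransition.nonneg _)]; exact Real.smoothTransition.le_one _
  set y1 := deriv smoothTransition (n * (t - a) - 1)
  set y2 := deriv smoothTransition (n * (b - t) - 1)
  have k1 : |y * (y1 * n * x2)| ≤ C * M := by
    rw [abs_mul, abs_mul, abs_mul, Nat.abs_cast]
    calc |y| * (|y1| * n * |x2|) ≤ (M * |t - a|) * (|y1| * n * 1) := by gcongr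
      _ = M * (n * |t - a| * |y1|) := by ring
      _ ≤ M * C := by gcongr
      _ = C * M := mul_comm _ _
  have k2 : |y * (x1 * (y2 * -n))| ≤ C * M := by
    rw [abs_mul, abs_mul, abs_mul, abs_neg, Nat.abs_cast]
    calc |y| * (|x1| * (|y2| * n)) ≤ (M * |b - t|) * (1 * (|y2| * n)) := by gcongr
      _ = M * (n * |b - t| * |y2|) := by ring
      _ ≤ M * C := by gcongr
      _ = C * M := mul_comm _ _
  calc _ = |y * (y1 * n * x2) + y * (x1 * (y2 * -n))| := by rw [mul_add]
    _ ≤ _ := (abs_add_le _ _).trans (by linarith)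

variable {p : Params}

theorem cut_mem_interior {φ : ℝ × ℝ → ℝ} (hn : 0 < n) :
    (fun x : ℝ × ℝ => φ x * (cut p.rmin p.rmax n x.1 * cut 0 (2 * Real.pi) n x.2)) ∈
      interiorTests p := by
  have hn' : (0 : ℝ) < (n : ℝ)⁻¹ := inv_pos.2 (by exact_mod_cast hn)
  set K : Set (ℝ × ℝ) := Icc (p.rmin + (n : ℝ)⁻¹) (p.rmax - (n : ℝ)⁻¹) ×ˢ
    Icc (0 + (n : ℝ)⁻¹) (2 * Real.pi - (n : ℝ)⁻¹) with hK
  have hKc : IsCompact K := isCompact_Icc.prod isCompact_Icc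
  have hs : Function.support (fun x : ℝ × ℝ => φ x * (cut p.rmin p.rmax n x.1 *
      cut 0 (2 * Real.pi) n x.2)) ⊆ K := by
    intro x hx
    have h1 : cut p.rmin p.rmax n x.1 ≠ 0 := fun h => hx (by simp [h])
    have h2 : cut 0 (2 * Real.pi) n x.2 ≠ 0 := fun h => hx (by simp [h])
    exact ⟨support_cut_subset hn h1, support_cut_subset hn h2⟩
  have ht := closure_minimal hs hKc.isClosed
  refine ⟨hKc.of_isClosed_subset (isClosed_tsupport _) ht, ht.trans ?_⟩
  refine prod_mono (fun x hx => ⟨by linarith [hx.1], by linarith [hx.2]⟩)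
    (fun x hx => ⟨by linarith [hx.1], by linarith [hx.2]⟩)

theorem abs_le_of_vanishing {φ : ℝ × ℝ → ℝ} (hφ : ContDiff ℝ ∞ φ) {M : ℝ}
    (hM : ∀ x ∈ box p, ‖fderiv ℝ φ x (1, 0)‖ ≤ M) {x : ℝ × ℝ} (hx : x ∈ box p) {c : ℝ}
    (hc : c ∈ Icc p.rmin p.rmax) (h0 : φ (c, x.2) = 0) : |φ x| ≤ M * |x.1 - c| := by
  have := (convex_Icc p.rmin p.rmax).norm_image_sub_le_of_norm_hasDerivWithin_le
    (f := fun t => φ (t, x.2)) (f' := fun t => fderiv ℝ φ (t, x.2) (1, 0)) (C := M)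
    (fun t _ => (hasDerivAt_slice_left (hφ.differentiable (by simp)) t x.2).hasDerivWithinAt)
    (fun t ht => hM _ ⟨ht, hx.2⟩) hc hx.1
  simpa [h0] using this

variable [hp : p.Admissible]

/-- A test function that vanishes at both radii need not have compact support. -/
theorem inner_dr_of_vanishing {u v : Y p} (h : (u, v) ∈ partsGraph p (interiorTests p) 1 0)
    {φ : ℝ × ℝ → ℝ} (hφ : ContDiff ℝ ∞ φ) (h1 : ∀ ψ, φ (p.rmin, ψ) = 0)
    (h2 : ∀ ψ, φ (p.rmax, ψ) = 0) :
    inner ℂ (toY p fun x => (dr φ x : ℂ)) u = (-1) * inner ℂ (toY p fun x => (φ x : ℂ)) v := by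
  set χ : ℕ → ℝ × ℝ → ℝ := fun n x => cut p.rmin p.rmax n x.1 * cut 0 (2 * Real.pi) n x.2 with hχ
  have hχs : ∀ n, ContDiff ℝ ∞ (χ n) := fun n =>
    (contDiff_cut.comp contDiff_fst).mul (contDiff_cut.comp contDiff_snd)
  have hχ1 : ∀ n x, ‖χ n x‖ ≤ 1 := fun n x => by
    rw [Real.norm_eq_abs, abs_of_nonneg (mul_nonneg cut_nonneg cut_nonneg)]
    exact mul_le_one₀ cut_le_one cut_nonneg cut_le_one
  have hcdr := (contDiff_dr hφ).continuous
  obtain ⟨M, hM0, hM⟩ := exists_bound p hcdr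
  obtain ⟨B, hB0, hB⟩ := exists_bound p hφ.continuous
  obtain ⟨C, hC0, hC⟩ := exists_deriv_cut_bound
  have hu : Integrable (u : ℝ × ℝ → ℂ) (volume.restrict (Ω p)) :=
    (Lp.memLp u).integrable (by norm_num)
  have hv : Integrable (v : ℝ × ℝ → ℂ) (volume.restrict (Ω p)) :=
    (Lp.memLp v).integrable (by norm_num)
  have hlim_χ : ∀ x ∈ Ω p, ∀ᶠ n in atTop, χ n x = 1 := by
    intro x hx
    filter_upwards [cut_eventually_eq_one hx.1, cut_eventually_eq_one hx.2] with n e1 e2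
    simp only [hχ, e1.eq_of_nhds, e2.eq_of_nhds, Pi.one_apply, mul_one]
  have hdr : ∀ n x, dr (fun y => φ y * χ n y) x =
      dr φ x * χ n x + φ x * (deriv (cut p.rmin p.rmax n) x.1 * cut 0 (2 * Real.pi) n x.2) := by
    intro n x
    have e1 := fderiv_mul_apply' hφ (hχs n) (1, 0) x
    have e2 := hasDerivAt_slice_left ((hχs n).differentiable (by simp)) x.1 x.2
    have e3 : HasDerivAt (fun t => χ n (t, x.2))
        (deriv (cut p.rmin p.rmax n) x.1 * cut 0 (2 * Real.pi) n x.2) x.1 :=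
      (((contDiff_cut (a := p.rmin) (b := p.rmax) (n := n)).differentiable
        (by simp)) x.1).hasDerivAt.mul_const (cut 0 (2 * Real.pi) n x.2)
    rw [← e2.unique e3]
    exact e1
  have hlim_d : ∀ x ∈ Ω p, ∀ᶠ n in atTop, dr (fun y => φ y * χ n y) x = dr φ x := by
    intro x hx
    filter_upwards [cut_eventually_eq_one hx.1, hlim_χ x hx] with n e1 e2
    have e3 : deriv (cut p.rmin p.rmax n) x.1 = 0 := by
      rw [e1.deriv_eq]; exact deriv_const _ _
    rw [hdr, e2, e3]; ring
  have key : ∀ n : ℕ, 0 < n → ∫ x in Ω p, dr (fun y => φ y * χ n y) x • u x =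
      (-1) * ∫ x in Ω p, (φ x * χ n x) • v x := by
    intro n hn
    have := h (fun x => φ x * χ n x) (cut_mem_interior hn) (hφ.mul (hχs n))
    rw [show (-1 : ℂ) ^ (1 + 0) = -1 by norm_num] at this
    exact this
  have l1 : Tendsto (fun n : ℕ => ∫ x in Ω p, dr (fun y => φ y * χ n y) x • u x) atTop
      (𝓝 (∫ x in Ω p, dr φ x • u x)) := by
    -- In the majorant, M bounds the term where φ is differentiated and C * M the term where the
    -- cutoff is; the latter uses that φ vanishes at both radii.
    refine tendsto_integral_of_dominated_convergence (fun x => (M + C * M) * ‖u x‖) ?_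
      (hu.norm.const_mul _) ?_ ?_
    · exact fun n => ((contDiff_dr (hφ.mul (hχs n))).continuous.aestronglyMeasurable).smul
        hu.aestronglyMeasurable
    · intro n
      filter_upwards [ae_mem_Ω p] with x hx
      have hxb := Ω_subset_box p hx
      rw [norm_smul]
      refine mul_le_mul_of_nonneg_right ?_ (norm_nonneg _)
      rw [hdr]
      refine (norm_add_le _ _).trans (add_le_add ?_ ?_)
      · rw [norm_mul]
        exact (mul_le_mul (hM x hxb) (hχ1 n x) (norm_nonneg _) hM0).trans (mul_one M).le
      · rw [← mul_assoc, norm_mul, Real.norm_eq_abs, Real.norm_eq_abs,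
          abs_of_nonneg (cut_nonneg (t := x.2))]
        have e1 := abs_le_of_vanishing hφ hM hxb (left_mem_Icc.2 hp.rmin_lt.le) (h1 x.2)
        have e2 := abs_le_of_vanishing hφ hM hxb (right_mem_Icc.2 hp.rmin_lt.le) (h2 x.2)
        rw [abs_sub_comm] at e2
        have e3 := hC p.rmin p.rmax n x.1 M (φ x) hM0 e1 e2
        exact (mul_le_mul e3 cut_le_one cut_nonneg (by positivity)).trans (mul_one _).le
    · filter_upwards [ae_mem_Ω p] with x hx
      refine tendsto_const_nhds.congr' ?_
      filter_upwards [hlim_d x hx] with n hn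
      rw [hn]
  have l2 : Tendsto (fun n : ℕ => ∫ x in Ω p, (φ x * χ n x) • v x) atTop
      (𝓝 (∫ x in Ω p, φ x • v x)) := by
    refine tendsto_integral_of_dominated_convergence (fun x => B * ‖v x‖) ?_
      (hv.norm.const_mul _) ?_ ?_
    · exact fun n => ((hφ.mul (hχs n)).continuous.aestronglyMeasurable).smul
        hv.aestronglyMeasurable
    · intro n
      filter_upwards [ae_mem_Ω p] with x hx
      rw [norm_smul, norm_mul]
      refine mul_le_mul_of_nonneg_right ?_ (norm_nonneg _)
      exact (mul_le_mul (hB x (Ω_subset_box p hx)) (hχ1 n x) (norm_nonneg _) hB0).trans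
        (mul_one B).le
    · filter_upwards [ae_mem_Ω p] with x hx
      refine tendsto_const_nhds.congr' ?_
      filter_upwards [hlim_χ x hx] with n hn
      rw [hn, mul_one]
  have l3 := (l2.const_mul (-1 : ℂ)).congr' (f₂ := fun n : ℕ =>
      ∫ x in Ω p, dr (fun y => φ y * χ n y) x • u x) (by
    filter_upwards [eventually_gt_atTop 0] with n hn
    rw [key n hn])
  have := tendsto_nhds_unique l1 l3
  rwa [integral_smul_eq_inner hcdr, integral_smul_eq_inner hφ.continuous] at this

end Cutoff

/-! ### A smooth positive extension of the radius -/

section Rho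

variable (p : Params)

/-- A smooth positive function on the line that is the identity beyond `rmin`. -/
def rho (r : ℝ) : ℝ := p.rmin + Real.smoothTransition (2 / p.rmin * r - 1) * (r - p.rmin)

theorem contDiff_rho : ContDiff ℝ ∞ (rho p) := by
  unfold rho
  exact contDiff_const.add ((Real.smoothTransition.contDiff.comp (by fun_prop)).mul (by fun_prop))

variable {p} [hp : p.Admissible]

theorem rho_eq {r : ℝ} (hr : p.rmin ≤ r) : rho p r = r := by
  have h0 := hp.rmin_pos
  rw [rho, Real.smoothTransition.one_of_one_le]
  · ring
  · have : 2 / p.rmin * p.rmin = 2 := by field_simp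
    have h2 : 2 / p.rmin * p.rmin ≤ 2 / p.rmin * r := by gcongr
    linarith

theorem rho_pos (r : ℝ) : 0 < rho p r := by
  have h0 := hp.rmin_pos
  rcases le_or_gt p.rmin r with h | h
  · rw [rho_eq h]; linarith
  set c := Real.smoothTransition (2 / p.rmin * r - 1) with hc
  have hc0 : 0 ≤ c := Real.smoothTransition.nonneg _
  have hc1 : c ≤ 1 := Real.smoothTransition.le_one _
  rcases le_or_gt r 0 with hr | hr
  · have : c = 0 := Real.smoothTransition.zero_of_nonpos (by
      have : 2 / p.rmin * r ≤ 0 := mul_nonpos_of_nonneg_of_nonpos (by positivity) hr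
      linarith)
    rw [rho, ← hc, this]; linarith
  · rw [rho, ← hc]; nlinarith

theorem rho_ne_zero (r : ℝ) : rho p r ≠ 0 := (rho_pos r).ne'

theorem rho_eventuallyEq {r : ℝ} (hr : p.rmin < r) : rho p =ᶠ[𝓝 r] fun t => t :=
  (eventually_gt_nhds hr).mono fun _ ht => rho_eq (le_of_lt ht)

end Rho

/-! ### Products R(r) e^{ikψ} -/

section Separated

variable {p : Params}

/-- The product `R(r) e^{ikψ}`. -/
def sep (R : ℝ → ℝ) (k : ℤ) (x : ℝ × ℝ) : ℂ := (R x.1 : ℂ) * Complex.exp (Complex.I * k * x.2)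

theorem contDiff_sep {R : ℝ → ℝ} (hR : ContDiff ℝ ∞ R) (k : ℤ) : ContDiff ℝ ∞ (sep R k) := by
  unfold sep
  refine (Complex.ofRealCLM.contDiff.comp (hR.comp contDiff_fst)).mul ?_
  exact (contDiff_const.mul (Complex.ofRealCLM.contDiff.comp contDiff_snd)).cexp

theorem continuous_sep {R : ℝ → ℝ} (hR : Continuous R) (k : ℤ) : Continuous (sep R k) := by
  unfold sep
  fun_prop

theorem fderiv_sep_left {R : ℝ → ℝ} (hR : ContDiff ℝ ∞ R) (k : ℤ) (x : ℝ × ℝ) :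
    fderiv ℝ (sep R k) x (1, 0) = sep (deriv R) k x := by
  refine (hasDerivAt_slice_left ((contDiff_sep hR k).differentiable (by simp)) x.1 x.2).unique ?_
  exact ((hR.differentiable (by simp) x.1).hasDerivAt.ofReal_comp).mul_const
    (Complex.exp (Complex.I * k * x.2))

theorem fderiv_sep_right {R : ℝ → ℝ} (hR : ContDiff ℝ ∞ R) (k : ℤ) (x : ℝ × ℝ) :
    fderiv ℝ (sep R k) x (0, 1) = Complex.I * k * sep R k x := by
  refine (hasDerivAt_slice_right ((contDiff_sep hR k).differentiable (by simp)) x.1 x.2).unique ?_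
  have h1 : HasDerivAt (fun t : ℝ => Complex.I * k * (t : ℂ)) (Complex.I * k) x.2 := by
    simpa using (Complex.ofRealCLM.hasDerivAt (x := x.2)).const_mul (Complex.I * k)
  have h2 := h1.cexp.const_mul (R x.1 : ℂ)
  refine h2.congr_deriv ?_
  rw [sep]; ring

theorem sep_periodic (R : ℝ → ℝ) (k : ℤ) (r ψ : ℝ) :
    sep R k (r, ψ + 2 * Real.pi) = sep R k (r, ψ) := by
  have : Complex.I * k * ((ψ + 2 * Real.pi : ℝ) : ℂ) =
      Complex.I * k * ψ + k * (2 * Real.pi * Complex.I) := by push_cast; ring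
  simp only [sep]
  rw [this, Complex.exp_add, Complex.exp_int_mul_two_pi_mul_I, mul_one]

theorem integral_cexp_int (j : ℤ) :
    ∫ ψ in Ioo 0 (2 * Real.pi), Complex.exp (Complex.I * j * (ψ : ℝ)) =
      if j = 0 then 2 * (Real.pi : ℂ) else 0 := by
  split_ifs with h
  · subst h
    simp [Real.pi_pos.le]
  · have hj : Complex.I * (j : ℂ) ≠ 0 :=
      mul_ne_zero Complex.I_ne_zero (by exact_mod_cast h)
    have hd : ∀ t : ℝ, HasDerivAt (fun t : ℝ => (Complex.I * j)⁻¹ *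
        Complex.exp (Complex.I * j * t)) (Complex.exp (Complex.I * j * t)) t := by
      intro t
      have h1 : HasDerivAt (fun t : ℝ => Complex.I * j * (t : ℂ)) (Complex.I * j) t := by
        simpa using (Complex.ofRealCLM.hasDerivAt (x := t)).const_mul (Complex.I * j)
      refine (h1.cexp.const_mul (Complex.I * j)⁻¹).congr_deriv ?_
      field_simp
    rw [integral_Ioo_deriv_eq two_pi_pos'.le hd (by fun_prop)]
    have : Complex.I * j * ((2 * Real.pi : ℝ) : ℂ) = j * (2 * Real.pi * Complex.I) := by
      push_cast; ring
    rw [this, Complex.exp_int_mul_two_pi_mul_I]; simp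

theorem inner_sep {R Q : ℝ → ℝ} (hR : Continuous R) (hQ : Continuous Q) (k l : ℤ) :
    inner ℂ (toY p (sep R k)) (toY p (sep Q l)) =
      ((∫ r in Ioo p.rmin p.rmax, R r * Q r : ℝ) : ℂ) *
        if k = l then 2 * (Real.pi : ℂ) else 0 := by
  rw [inner_toY (continuous_sep hR k)]
  have e1 : ∫ x in Ω p, (starRingEnd ℂ) (sep R k x) * toY p (sep Q l) x =
      ∫ x in Ω p, ((R x.1 * Q x.1 : ℝ) : ℂ) * Complex.exp (Complex.I * (l - k : ℤ) * x.2) := by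
    refine integral_congr_ae ((coeFn_toY (continuous_sep hQ l)).mono fun x hx => ?_)
    simp only [hx, sep, map_mul, Complex.conj_ofReal, ← Complex.exp_conj, Complex.conj_I]
    have : (starRingEnd ℂ) (k : ℂ) = k := by
      rw [show (k : ℂ) = ((k : ℝ) : ℂ) by push_cast; rfl, Complex.conj_ofReal]
    rw [this]
    rw [show (R x.1 : ℂ) * Complex.exp (-Complex.I * k * x.2) * (Q x.1 *
      Complex.exp (Complex.I * l * x.2)) = (R x.1 * Q x.1) * (Complex.exp (-Complex.I * k * x.2) *
      Complex.exp (Complex.I * l * x.2)) by ring, ← Complex.exp_add]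
    push_cast
    congr 2; ring
  rw [e1, restrict_Ω_eq, integral_prod_mul (f := fun r : ℝ => ((R r * Q r : ℝ) : ℂ))
    (g := fun ψ : ℝ => Complex.exp (Complex.I * (l - k : ℤ) * ψ)), integral_cexp_int]
  congr 1
  · exact integral_ofReal
  · simp only [sub_eq_zero, eq_comm (a := l)]

end Separated

/-! ### The separated orthonormal system -/

section Basis

variable (p : Params)

/-- The logarithmic width of the annulus. -/
def ell : ℝ := Real.log (p.rmax / p.rmin)

/-- The logarithmic radius. -/
def lrad (r : ℝ) : ℝ := Real.log (rho p r / p.rmin)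

/-- The radial frequencies. -/
def nu (n : ℕ) : ℝ := (n + 1) * Real.pi / ell p

/-- The normalizing constant of the basis. -/
def cN : ℝ := (Real.sqrt (Real.pi * ell p))⁻¹

/-- `√r` times a sine of the logarithmic radius. -/
def sinR (n : ℕ) (r : ℝ) : ℝ := cN p * Real.sqrt (rho p r) * Real.sin (nu p n * lrad p r)

/-- `√r` times a cosine of the logarithmic radius. -/
def cosR (n : ℕ) (r : ℝ) : ℝ := cN p * Real.sqrt (rho p r) * Real.cos (nu p n * lrad p r)

/-- The elements of the orthonormal basis. -/
def basisFun (i : ℕ × ℤ) : Y p := toY p (sep (fun r => sinR p i.1 r / rho p r) i.2)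

/-- The companions of the basis with cosines in place of sines. -/
def cobasisFun (i : ℕ × ℤ) : Y p := toY p (sep (fun r => cosR p i.1 r / rho p r) i.2)

variable {p} [hp : p.Admissible]

theorem ell_pos : 0 < ell p :=
  Real.log_pos ((one_lt_div hp.rmin_pos).2 hp.rmin_lt)

theorem nu_pos (n : ℕ) : 0 < nu p n := by
  have := ell_pos (p := p)
  unfold nu; positivity

theorem contDiff_sqrt_rho : ContDiff ℝ ∞ fun r => Real.sqrt (rho p r) :=
  (contDiff_rho p).sqrt rho_ne_zero

theorem contDiff_lrad : ContDiff ℝ ∞ (lrad p) :=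
  ((contDiff_rho p).div_const _).log fun r => div_ne_zero (rho_ne_zero r) hp.rmin_pos.ne'

theorem contDiff_sinR (n : ℕ) : ContDiff ℝ ∞ (sinR p n) :=
  (contDiff_const.mul contDiff_sqrt_rho).mul (contDiff_const.mul contDiff_lrad).sin

theorem contDiff_cosR (n : ℕ) : ContDiff ℝ ∞ (cosR p n) :=
  (contDiff_const.mul contDiff_sqrt_rho).mul (contDiff_const.mul contDiff_lrad).cos

theorem contDiff_div_rho {R : ℝ → ℝ} (hR : ContDiff ℝ ∞ R) :
    ContDiff ℝ ∞ fun r => R r / rho p r := hR.div (contDiff_rho p) rho_ne_zero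

theorem hasDerivAt_sqrt_rho {r : ℝ} (hr : p.rmin < r) :
    HasDerivAt (fun r => Real.sqrt (rho p r)) (Real.sqrt (rho p r) / (2 * r)) r := by
  have hr0 : 0 < r := hp.rmin_pos.trans hr
  have h1 : HasDerivAt (rho p) 1 r := (hasDerivAt_id r).congr_of_eventuallyEq (rho_eventuallyEq hr)
  refine (h1.sqrt (rho_ne_zero r)).congr_deriv ?_
  rw [rho_eq hr.le]
  have h2 : Real.sqrt r ≠ 0 := (Real.sqrt_pos.2 hr0).ne'
  have h3 : Real.sqrt r * Real.sqrt r = r := Real.mul_self_sqrt hr0.le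
  rw [div_eq_div_iff (by positivity) (by positivity)]
  linear_combination (-2) * h3

theorem hasDerivAt_lrad {r : ℝ} (hr : p.rmin < r) : HasDerivAt (lrad p) (1 / r) r := by
  have hr0 : 0 < r := hp.rmin_pos.trans hr
  have h1 : HasDerivAt (rho p) 1 r := (hasDerivAt_id r).congr_of_eventuallyEq (rho_eventuallyEq hr)
  refine ((h1.div_const p.rmin).log (div_ne_zero (rho_ne_zero r) hp.rmin_pos.ne')).congr_deriv ?_
  rw [rho_eq hr.le]
  have := hp.rmin_pos.ne'
  field_simp

theorem hasDerivAt_sinR (n : ℕ) {r : ℝ} (hr : p.rmin < r) :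
    HasDerivAt (sinR p n) ((sinR p n r / 2 + nu p n * cosR p n r) / r) r := by
  have hr0 : r ≠ 0 := (hp.rmin_pos.trans hr).ne'
  have h := (((hasDerivAt_sqrt_rho hr).const_mul (cN p)).mul
    ((hasDerivAt_lrad hr).const_mul (nu p n)).sin)
  refine h.congr_deriv ?_
  rw [sinR, cosR]
  field_simp

theorem hasDerivAt_cosR (n : ℕ) {r : ℝ} (hr : p.rmin < r) :
    HasDerivAt (cosR p n) ((cosR p n r / 2 - nu p n * sinR p n r) / r) r := by
  have hr0 : r ≠ 0 := (hp.rmin_pos.trans hr).ne'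
  have h := (((hasDerivAt_sqrt_rho hr).const_mul (cN p)).mul
    ((hasDerivAt_lrad hr).const_mul (nu p n)).cos)
  refine h.congr_deriv ?_
  rw [sinR, cosR]
  field_simp
  ring

theorem deriv_sinR (n : ℕ) {r : ℝ} (hr : p.rmin < r) :
    deriv (sinR p n) r = (sinR p n r / 2 + nu p n * cosR p n r) / r := (hasDerivAt_sinR n hr).deriv

/-- In t = log r one has r²∂_r² = ∂_t² - ∂_t. The factor √r = e^{t/2} removes the first order term
and leaves ∂_t² - 1/4 acting on the sine. -/
theorem deriv_deriv_sinR (n : ℕ) {r : ℝ} (hr : p.rmin < r) :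
    deriv (deriv (sinR p n)) r = -(nu p n ^ 2 + 1 / 4) * sinR p n r / r ^ 2 := by
  have hr0 : r ≠ 0 := (hp.rmin_pos.trans hr).ne'
  have h1 : deriv (sinR p n) =ᶠ[𝓝 r] fun r => (sinR p n r / 2 + nu p n * cosR p n r) / r :=
    (eventually_gt_nhds hr).mono fun x hx => deriv_sinR n hx
  rw [h1.deriv_eq]
  have h2 := (((hasDerivAt_sinR n hr).div_const 2).add
    ((hasDerivAt_cosR n hr).const_mul (nu p n))).div (hasDerivAt_id r) hr0
  have h3 : deriv (fun r => (sinR p n r / 2 + nu p n * cosR p n r) / r) r = _ := h2.deriv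
  rw [h3]
  simp only [Pi.add_apply, id]
  field_simp
  ring

theorem sinR_rmin (n : ℕ) : sinR p n p.rmin = 0 := by
  rw [sinR, lrad, rho_eq le_rfl, div_self hp.rmin_pos.ne']; simp

theorem sinR_rmax (n : ℕ) : sinR p n p.rmax = 0 := by
  have h1 : nu p n * lrad p p.rmax = ((n + 1 : ℕ) : ℝ) * Real.pi := by
    rw [lrad, rho_eq hp.rmin_lt.le, ← ell, nu]
    have := (ell_pos (p := p)).ne'
    field_simp
    push_cast; ring
  rw [sinR, h1, Real.sin_nat_mul_pi, mul_zero]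

theorem integral_cos_log (j : ℤ) :
    ∫ r in Ioo p.rmin p.rmax, Real.cos (j * Real.pi / ell p * Real.log (r / p.rmin)) / r =
      if j = 0 then ell p else 0 := by
  have h0 := hp.rmin_pos
  have hlt := hp.rmin_lt
  have hl := (ell_pos (p := p)).ne'
  have hpos : ∀ r ∈ uIcc p.rmin p.rmax, 0 < r := fun r hr => by
    rw [uIcc_of_le hlt.le] at hr; linarith [hr.1]
  have hlog : ∀ r ∈ uIcc p.rmin p.rmax,
      HasDerivAt (fun r => Real.log (r / p.rmin)) (1 / r) r := fun r hr => by
    have hr0 := (hpos r hr).ne'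
    refine (((hasDerivAt_id r).div_const p.rmin).log (div_ne_zero hr0 h0.ne')).congr_deriv ?_
    simp only [id]; field_simp
  rw [← integral_Ioc_eq_integral_Ioo, ← intervalIntegral.integral_of_le hlt.le]
  split_ifs with hj
  · subst hj
    have := intervalIntegral.integral_eq_sub_of_hasDerivAt hlog (ContinuousOn.intervalIntegrable
      (continuousOn_const.div continuousOn_id fun r hr => (hpos r hr).ne'))
    simp only [Int.cast_zero, zero_mul, zero_div, Real.cos_zero]
    rw [this, div_self h0.ne', Real.log_one, sub_zero, ell]
  · have hj' : (j : ℝ) * Real.pi / ell p ≠ 0 :=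
      div_ne_zero (mul_ne_zero (by exact_mod_cast hj) Real.pi_pos.ne') hl
    set a := (j : ℝ) * Real.pi / ell p with ha
    have hd : ∀ r ∈ uIcc p.rmin p.rmax, HasDerivAt
        (fun r => Real.sin (a * Real.log (r / p.rmin)) / a)
        (Real.cos (a * Real.log (r / p.rmin)) / r) r := fun r hr => by
      have hr0 := (hpos r hr).ne'
      refine ((((hlog r hr).const_mul a).sin).div_const a).congr_deriv ?_
      field_simp
    rw [intervalIntegral.integral_eq_sub_of_hasDerivAt hd]
    · have h1 : a * Real.log (p.rmax / p.rmin) = j * Real.pi := by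
        rw [ha, ← ell]; field_simp
      rw [h1, Real.sin_int_mul_pi, div_self h0.ne', Real.log_one]; simp
    · refine ContinuousOn.intervalIntegrable ?_
      refine ContinuousOn.div ?_ continuousOn_id fun r hr => (hpos r hr).ne'
      exact Real.continuous_cos.comp_continuousOn (continuousOn_const.mul
        fun r hr => (hlog r hr).continuousAt.continuousWithinAt)

theorem integrableOn_cos_log (a : ℝ) : IntegrableOn
    (fun r => Real.cos (a * Real.log (r / p.rmin)) / r) (Ioo p.rmin p.rmax) := by
  have h0 := hp.rmin_pos
  refine (ContinuousOn.integrableOn_Icc (a := p.rmin) (b := p.rmax) ?_).mono_set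
    Ioo_subset_Icc_self
  have hne : ∀ r ∈ Icc p.rmin p.rmax, r ≠ 0 := fun r hr => by linarith [hr.1]
  refine ContinuousOn.div ?_ continuousOn_id hne
  exact Real.continuous_cos.comp_continuousOn (continuousOn_const.mul
    ((continuousOn_id.div_const _).log fun r hr => div_ne_zero (hne r hr) h0.ne'))

theorem cN_sq : cN p ^ 2 = (Real.pi * ell p)⁻¹ := by
  have := ell_pos (p := p)
  rw [cN, inv_pow, Real.sq_sqrt (by positivity)]

/-- Index n carries the frequency n + 1, so the product formulas involve n - m and n + m + 2; the
second is never zero, which is what gives orthogonality. The weight 1/r is the density of log r. -/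
theorem radial_product (n m : ℕ) {r : ℝ} (hr : r ∈ Ioo p.rmin p.rmax) :
    sinR p n r / rho p r * (sinR p m r / rho p r) = cN p ^ 2 / 2 *
      (Real.cos (((n : ℤ) - m : ℤ) * Real.pi / ell p * Real.log (r / p.rmin)) / r -
        Real.cos (((n : ℤ) + m + 2 : ℤ) * Real.pi / ell p * Real.log (r / p.rmin)) / r) ∧
    cosR p n r / rho p r * (cosR p m r / rho p r) = cN p ^ 2 / 2 *
      (Real.cos (((n : ℤ) - m : ℤ) * Real.pi / ell p * Real.log (r / p.rmin)) / r +
        Real.cos (((n : ℤ) + m + 2 : ℤ) * Real.pi / ell p * Real.log (r / p.rmin)) / r) := by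
  have hr0 : 0 < r := hp.rmin_pos.trans hr.1
  have hl := (ell_pos (p := p)).ne'
  have hs : Real.sqrt r * Real.sqrt r = r := Real.mul_self_sqrt hr0.le
  set t := Real.log (r / p.rmin) with ht
  have e1 : (((n : ℤ) - m : ℤ) : ℝ) * Real.pi / ell p * t = nu p n * t - nu p m * t := by
    rw [nu, nu]; push_cast; field_simp; ring
  have e2 : (((n : ℤ) + m + 2 : ℤ) : ℝ) * Real.pi / ell p * t = nu p n * t + nu p m * t := by
    rw [nu, nu]; push_cast; field_simp; ring
  simp only [sinR, cosR, lrad, rho_eq hr.1.le, ← ht]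
  rw [e1, e2, Real.cos_sub, Real.cos_add]
  set s := Real.sqrt r with hsdef
  have hs0 : s ≠ 0 := (Real.sqrt_pos.2 hr0).ne'
  rw [← hs]
  constructor <;> field_simp <;> ring

theorem integral_radial_sin (n m : ℕ) :
    ∫ r in Ioo p.rmin p.rmax, sinR p n r / rho p r * (sinR p m r / rho p r) =
      if n = m then (2 * Real.pi)⁻¹ else 0 := by
  have hl := (ell_pos (p := p)).ne'
  rw [setIntegral_congr_fun measurableSet_Ioo fun r hr => (radial_product n m hr).1,
    integral_const_mul, integral_sub (integrableOn_cos_log _) (integrableOn_cos_log _),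
    integral_cos_log, integral_cos_log, if_neg (by omega : ¬ ((n : ℤ) + m + 2 = 0)), cN_sq]
  by_cases h : n = m
  · rw [if_pos (by omega), if_pos h]
    field_simp
    ring
  · rw [if_neg (by omega), if_neg h]; ring

theorem integral_radial_cos (n m : ℕ) :
    ∫ r in Ioo p.rmin p.rmax, cosR p n r / rho p r * (cosR p m r / rho p r) =
      if n = m then (2 * Real.pi)⁻¹ else 0 := by
  have hl := (ell_pos (p := p)).ne'
  rw [setIntegral_congr_fun measurableSet_Ioo fun r hr => (radial_product n m hr).2,
    integral_const_mul, integral_add (integrableOn_cos_log _) (integrableOn_cos_log _),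
    integral_cos_log, integral_cos_log, if_neg (by omega : ¬ ((n : ℤ) + m + 2 = 0)), cN_sq]
  by_cases h : n = m
  · rw [if_pos (by omega), if_pos h]
    field_simp
    ring
  · rw [if_neg (by omega), if_neg h]; ring

theorem orthonormal_basisFun : Orthonormal ℂ (basisFun p) := by
  rw [orthonormal_iff_ite]
  rintro ⟨n, k⟩ ⟨m, l⟩
  have hc (n : ℕ) : Continuous fun r => sinR p n r / rho p r :=
    (contDiff_div_rho (contDiff_sinR n)).continuous
  have hpi : (Real.pi : ℂ) ≠ 0 := by exact_mod_cast Real.pi_pos.ne'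
  simp only [basisFun]
  rw [inner_sep (hc n) (hc m), integral_radial_sin]
  by_cases h1 : n = m <;> by_cases h2 : k = l <;> simp [h1, h2]
  field_simp

/-- Orthonormality alone is used: it bounds the operators that send basis vectors to multiples of
these functions. The system is not complete, since the cosine of frequency 0 is absent. -/
theorem orthonormal_cobasisFun : Orthonormal ℂ (cobasisFun p) := by
  rw [orthonormal_iff_ite]
  rintro ⟨n, k⟩ ⟨m, l⟩
  have hc (n : ℕ) : Continuous fun r => cosR p n r / rho p r :=
    (contDiff_div_rho (contDiff_cosR n)).continuous
  have hpi : (Real.pi : ℂ) ≠ 0 := by exact_mod_cast Real.pi_pos.ne'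
  simp only [cobasisFun]
  rw [inner_sep (hc n) (hc m), integral_radial_cos]
  by_cases h1 : n = m <;> by_cases h2 : k = l <;> simp [h1, h2]
  field_simp

end Basis

/-! ### Completeness of the system by Stone–Weierstrass -/

section Completeness

variable (p : Params) [hp : p.Admissible]

/-- The closed annulus. -/
abbrev Annulus (p : Params) : Type := Icc p.rmin p.rmax × Circle

/-- Polar coordinates on the annulus. -/
def polar (x : ℝ × ℝ) : Annulus p := (projIcc p.rmin p.rmax hp.rmin_lt.le x.1, Circle.exp x.2)

/-- The angle in `[0, π]` that corresponds to the radius. -/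
def radialAngle (r : ℝ) : ℝ :=
  Real.pi / ell p * Real.log (projIcc p.rmin p.rmax hp.rmin_lt.le r / p.rmin)

/-- The functions `sin(nθ) e^{ikψ}`, with `θ` the radial angle. -/
def sinExp (i : ℤ × ℤ) (x : ℝ × ℝ) : ℂ :=
  (Real.sin (i.1 * radialAngle p x.1) : ℂ) * Complex.exp (Complex.I * i.2 * x.2)

/-- The function `cos θ` on the annulus. -/
def cosAnnulus : C(Annulus p, ℂ) where
  toFun y := (Real.cos (Real.pi / ell p * Real.log (y.1 / p.rmin)) : ℂ)
  continuous_toFun := by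
    refine Complex.continuous_ofReal.comp (Real.continuous_cos.comp (continuous_const.mul ?_))
    refine Continuous.log (by fun_prop) fun y => ?_
    exact (div_pos (hp.rmin_pos.trans_le y.1.2.1) hp.rmin_pos).ne'

/-- The function `e^{iψ}` on the annulus. -/
def expAnnulus : C(Annulus p, ℂ) where
  toFun y := y.2
  continuous_toFun := by fun_prop

variable {p}

theorem continuous_polar : Continuous (polar p) :=
  (continuous_projIcc.comp continuous_fst).prodMk (Circle.exp.continuous.comp continuous_snd)

theorem continuous_radialAngle : Continuous (radialAngle p) := by
  refine continuous_const.mul (Continuous.log ?_ fun r => ?_)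
  · exact (continuous_subtype_val.comp continuous_projIcc).div_const _
  · exact (div_pos (hp.rmin_pos.trans_le (projIcc p.rmin p.rmax hp.rmin_lt.le r).2.1)
      hp.rmin_pos).ne'

theorem continuous_sinExp (i : ℤ × ℤ) : Continuous (sinExp p i) := by
  have := continuous_radialAngle (p := p)
  unfold sinExp
  fun_prop

theorem radialAngle_eq {r : ℝ} (hr : r ∈ Icc p.rmin p.rmax) :
    radialAngle p r = Real.pi / ell p * Real.log (r / p.rmin) := by
  rw [radialAngle, projIcc_of_mem _ hr]

theorem radialAngle_mem {r : ℝ} (hr : r ∈ Ioo p.rmin p.rmax) : radialAngle p r ∈ Ioo 0 Real.pi := by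
  have hl := ell_pos (p := p)
  have h0 := hp.rmin_pos
  rw [radialAngle_eq (Ioo_subset_Icc_self hr)]
  have h1 : 0 < Real.log (r / p.rmin) := Real.log_pos ((one_lt_div h0).2 hr.1)
  have h2 : Real.log (r / p.rmin) < ell p :=
    Real.log_lt_log (div_pos (h0.trans hr.1) h0) (by have := hr.2; gcongr)
  refine ⟨by positivity, ?_⟩
  rw [div_mul_eq_mul_div, div_lt_iff₀ hl]
  exact mul_lt_mul_of_pos_left h2 Real.pi_pos

theorem cosAnnulus_mul_sinExp (i : ℤ × ℤ) :
    (fun x => cosAnnulus p (polar p x) * sinExp p i x) =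
      (1 / 2 : ℂ) • (sinExp p (i.1 + 1, i.2) + sinExp p (i.1 - 1, i.2)) := by
  ext x
  have e : cosAnnulus p (polar p x) = (Real.cos (radialAngle p x.1) : ℂ) := rfl
  simp only [e, sinExp, Pi.smul_apply, Pi.add_apply, smul_eq_mul]
  have h : Real.cos (radialAngle p x.1) * Real.sin (i.1 * radialAngle p x.1) =
      1 / 2 * (Real.sin ((i.1 + 1 : ℤ) * radialAngle p x.1) +
        Real.sin ((i.1 - 1 : ℤ) * radialAngle p x.1)) := by
    push_cast
    rw [add_mul, sub_mul, one_mul, Real.sin_add, Real.sin_sub]; ring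
  rw [← mul_assoc, ← Complex.ofReal_mul, h]
  push_cast; ring

theorem expAnnulus_mul_sinExp (i : ℤ × ℤ) :
    (fun x => expAnnulus p (polar p x) * sinExp p i x) = sinExp p (i.1, i.2 + 1) := by
  ext x
  have e : expAnnulus p (polar p x) = Complex.exp (x.2 * Complex.I) := Circle.coe_exp x.2
  simp only [e, sinExp]
  rw [mul_left_comm, ← Complex.exp_add]
  push_cast
  congr 2; ring

theorem star_expAnnulus_mul_sinExp (i : ℤ × ℤ) :
    (fun x => (star (expAnnulus p)) (polar p x) * sinExp p i x) = sinExp p (i.1, i.2 - 1) := by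
  ext x
  have e : (star (expAnnulus p)) (polar p x) = Complex.exp (-(x.2 * Complex.I)) := by
    have : (star (expAnnulus p)) (polar p x) = (starRingEnd ℂ) (Complex.exp (x.2 * Complex.I)) := by
      rw [← Circle.coe_exp]; rfl
    rw [this, ← Complex.exp_conj]; simp
  simp only [e, sinExp]
  rw [mul_left_comm, ← Complex.exp_add]
  push_cast
  congr 2; ring

theorem star_cosAnnulus : star (cosAnnulus p) = cosAnnulus p := by
  ext y
  exact Complex.conj_ofReal _

/-- Multiplication by cos θ or e^{±iψ} only shifts the indices of sin(nθ)e^{ikψ}, so the span is a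
module over the star algebra they generate. The statement is carried for q and its star together, so
that the induction passes through products and stars. -/
theorem mul_mem_span_sinExp {q : C(Annulus p, ℂ)}
    (hq : q ∈ StarAlgebra.adjoin ℂ {cosAnnulus p, expAnnulus p}) :
    ∀ Ψ ∈ Submodule.span ℂ (range (sinExp p)), (fun x => q (polar p x) * Ψ x) ∈
      Submodule.span ℂ (range (sinExp p)) := by
  have gen : ∀ q : C(Annulus p, ℂ), (∀ i, (fun x => q (polar p x) * sinExp p i x) ∈
      Submodule.span ℂ (range (sinExp p))) → ∀ Ψ ∈ Submodule.span ℂ (range (sinExp p)),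
      (fun x => q (polar p x) * Ψ x) ∈ Submodule.span ℂ (range (sinExp p)) := by
    intro q h Ψ hΨ
    let M : (ℝ × ℝ → ℂ) →ₗ[ℂ] (ℝ × ℝ → ℂ) :=
      { toFun := fun Ψ x => q (polar p x) * Ψ x
        map_add' := fun a b => by ext x; simp [mul_add]
        map_smul' := fun z a => by ext x; simp [mul_left_comm] }
    have : Submodule.span ℂ (range (sinExp p)) ≤
        (Submodule.span ℂ (range (sinExp p))).comap M := by
      rw [Submodule.span_le]
      rintro _ ⟨i, rfl⟩
      exact h i
    exact this hΨ
  have hB : ∀ i, sinExp p i ∈ Submodule.span ℂ (range (sinExp p)) :=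
    fun i => Submodule.subset_span ⟨i, rfl⟩
  suffices h : (∀ Ψ ∈ Submodule.span ℂ (range (sinExp p)), (fun x => q (polar p x) * Ψ x) ∈
      Submodule.span ℂ (range (sinExp p))) ∧
      (∀ Ψ ∈ Submodule.span ℂ (range (sinExp p)), (fun x => (star q) (polar p x) * Ψ x) ∈
      Submodule.span ℂ (range (sinExp p))) from h.1
  induction hq using StarAlgebra.adjoin_induction with
  | mem q hq =>
    rcases hq with rfl | rfl
    · rw [star_cosAnnulus, and_self]
      refine gen _ fun i => ?_
      rw [cosAnnulus_mul_sinExp]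
      exact Submodule.smul_mem _ _ (Submodule.add_mem _ (hB _) (hB _))
    · refine ⟨gen _ fun i => ?_, gen _ fun i => ?_⟩
      · rw [expAnnulus_mul_sinExp]; exact hB _
      · rw [star_expAnnulus_mul_sinExp]; exact hB _
  | algebraMap z =>
    exact ⟨fun Ψ hΨ => Submodule.smul_mem _ z hΨ,
      fun Ψ hΨ => Submodule.smul_mem _ ((starRingEnd ℂ) z) hΨ⟩
  | add a b _ _ ha hb =>
    refine ⟨fun Ψ hΨ => ?_, fun Ψ hΨ => ?_⟩
    · have := Submodule.add_mem _ (ha.1 Ψ hΨ) (hb.1 Ψ hΨ)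
      simp only [ContinuousMap.add_apply, add_mul]; exact this
    · have := Submodule.add_mem _ (ha.2 Ψ hΨ) (hb.2 Ψ hΨ)
      simp only [star_add, ContinuousMap.add_apply, add_mul]; exact this
  | mul a b _ _ ha hb =>
    refine ⟨fun Ψ hΨ => ?_, fun Ψ hΨ => ?_⟩
    · have := ha.1 _ (hb.1 Ψ hΨ)
      simpa only [ContinuousMap.mul_apply, mul_assoc] using this
    · have := hb.2 _ (ha.2 Ψ hΨ)
      simpa only [star_mul, ContinuousMap.mul_apply, mul_assoc] using this
  | star a _ ha => rw [star_star]; exact ha.symm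

theorem separatesPoints_adjoin :
    (StarAlgebra.adjoin ℂ {cosAnnulus p, expAnnulus p}).SeparatesPoints := by
  intro y y' hne
  have hl := ell_pos (p := p)
  have h0 := hp.rmin_pos
  by_cases h : y.2 = y'.2
  · refine ⟨cosAnnulus p, ⟨cosAnnulus p, StarAlgebra.subset_adjoin _ _ (by simp), rfl⟩, fun he => ?_⟩
    have mem : ∀ y : Annulus p, Real.pi / ell p * Real.log (y.1 / p.rmin) ∈ Icc 0 Real.pi := by
      intro y
      have h1 : 0 ≤ Real.log (y.1 / p.rmin) := Real.log_nonneg ((one_le_div h0).2 y.1.2.1)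
      have h2 : Real.log (y.1 / p.rmin) ≤ ell p :=
        Real.log_le_log (div_pos (h0.trans_le y.1.2.1) h0) (by have := y.1.2.2; gcongr)
      refine ⟨by positivity, ?_⟩
      rw [div_mul_eq_mul_div, div_le_iff₀ hl]
      exact mul_le_mul_of_nonneg_left h2 Real.pi_pos.le
    have h1 := Real.injOn_cos (mem y) (mem y') (Complex.ofReal_injective he)
    have h2 := mul_left_cancel₀ (div_pos Real.pi_pos hl).ne' h1
    have h3 := Real.log_injOn_pos (show (y.1 : ℝ) / p.rmin ∈ Ioi 0 from
      div_pos (h0.trans_le y.1.2.1) h0) (show (y'.1 : ℝ) / p.rmin ∈ Ioi 0 from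
      div_pos (h0.trans_le y'.1.2.1) h0) h2
    exact hne (Prod.ext (Subtype.ext ((div_left_inj' h0.ne').1 h3)) h)
  · refine ⟨expAnnulus p, ⟨expAnnulus p, StarAlgebra.subset_adjoin _ _ (by simp), rfl⟩, fun he => ?_⟩
    exact h (Subtype.ext he)

theorem integral_span_sinExp_eq_zero {w : ℝ × ℝ → ℂ} (hw : Integrable w (volume.restrict (Ω p)))
    (h : ∀ i, ∫ x in Ω p, sinExp p i x * w x = 0) {Ψ : ℝ × ℝ → ℂ}
    (hΨ : Ψ ∈ Submodule.span ℂ (range (sinExp p))) :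
    Integrable (fun x => Ψ x * w x) (volume.restrict (Ω p)) ∧ ∫ x in Ω p, Ψ x * w x = 0 := by
  induction hΨ using Submodule.span_induction with
  | mem Ψ hΨ =>
    obtain ⟨i, rfl⟩ := hΨ
    refine ⟨?_, h i⟩
    obtain ⟨C, -, hC⟩ := exists_bound p (continuous_sinExp (p := p) i)
    exact hw.bdd_mul (continuous_sinExp (p := p) i).aestronglyMeasurable
      ((ae_mem_Ω p).mono fun x hx => hC x (Ω_subset_box p hx))
  | zero => simp
  | add a b _ _ ha hb =>
    have e : (fun x => (a + b) x * w x) = fun x => a x * w x + b x * w x := by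
      ext x; simp [add_mul]
    rw [e, integral_add ha.1 hb.1, ha.2, hb.2, add_zero]
    exact ⟨ha.1.add hb.1, rfl⟩
  | smul z a _ ha =>
    have e : (fun x => (z • a) x * w x) = fun x => z * (a x * w x) := by
      ext x; simp [mul_assoc]
    rw [e, integral_const_mul, ha.2, mul_zero]
    exact ⟨ha.1.const_mul z, rfl⟩

/-- Polynomials in cos θ and e^{±iψ} times sin θ stay in the span of the sines, and such polynomials
are uniformly dense in the continuous functions on the annulus. -/
theorem integral_polar_eq_zero {w : ℝ × ℝ → ℂ} (hw : Integrable w (volume.restrict (Ω p)))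
    (h : ∀ i, ∫ x in Ω p, sinExp p i x * w x = 0) (q : C(Annulus p, ℂ)) :
    ∫ x in Ω p, q (polar p x) * (sinExp p (1, 0) x * w x) = 0 := by
  have hcont : ∀ q : C(Annulus p, ℂ), Continuous fun x => q (polar p x) :=
    fun q => q.continuous.comp (continuous_polar (p := p))
  set I := ∫ x in Ω p, ‖sinExp p (1, 0) x * w x‖ with hI
  have hB : sinExp p (1, 0) ∈ Submodule.span ℂ (range (sinExp p)) :=
    Submodule.subset_span ⟨_, rfl⟩
  have hi := (integral_span_sinExp_eq_zero hw h hB).1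
  have hint : ∀ q : C(Annulus p, ℂ), Integrable
      (fun x => q (polar p x) * (sinExp p (1, 0) x * w x)) (volume.restrict (Ω p)) := fun q =>
    hi.bdd_mul (hcont q).aestronglyMeasurable (Eventually.of_forall fun x => q.norm_coe_le_norm _)
  have htop := ContinuousMap.starSubalgebra_topologicalClosure_eq_top_of_separatesPoints
    (𝕜 := ℂ) (StarAlgebra.adjoin ℂ {cosAnnulus p, expAnnulus p}) separatesPoints_adjoin
  have hq : q ∈ closure (StarAlgebra.adjoin ℂ {cosAnnulus p, expAnnulus p} :
      Set C(Annulus p, ℂ)) := by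
    have : q ∈ (StarAlgebra.adjoin ℂ {cosAnnulus p, expAnnulus p}).topologicalClosure := by
      rw [htop]; trivial
    exact this
  rw [← norm_le_zero_iff]
  refine le_of_forall_pos_le_add fun ε hε => ?_
  have hI0 : 0 ≤ I := integral_nonneg fun x => norm_nonneg _
  obtain ⟨q', hq', hd⟩ := Metric.mem_closure_iff.1 hq (ε / (I + 1)) (by positivity)
  have h0 : ∫ x in Ω p, q' (polar p x) * (sinExp p (1, 0) x * w x) = 0 := by
    have := (integral_span_sinExp_eq_zero hw h (mul_mem_span_sinExp hq' _ hB)).2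
    simpa only [mul_assoc] using this
  have e : ∫ x in Ω p, q (polar p x) * (sinExp p (1, 0) x * w x) =
      ∫ x in Ω p, (q - q') (polar p x) * (sinExp p (1, 0) x * w x) := by
    rw [← sub_zero (∫ x in Ω p, q (polar p x) * (sinExp p (1, 0) x * w x)), ← h0,
      ← integral_sub (hint q) (hint q')]
    simp only [ContinuousMap.sub_apply, sub_mul]
  rw [e]
  calc _ ≤ ∫ x in Ω p, ‖(q - q') (polar p x) * (sinExp p (1, 0) x * w x)‖ :=
        norm_integral_le_integral_norm _
    _ ≤ ∫ x in Ω p, ε / (I + 1) * ‖sinExp p (1, 0) x * w x‖ := by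
        refine integral_mono (hint _).norm (hi.norm.const_mul _) fun x => ?_
        simp only [norm_mul _ (sinExp p (1, 0) x * w x)]
        gcongr
        exact ((q - q').norm_coe_le_norm _).trans (by rw [← dist_eq_norm]; exact hd.le)
    _ = ε / (I + 1) * I := by rw [integral_const_mul]
    _ ≤ 0 + ε := by
        rw [zero_add, div_mul_eq_mul_div, div_le_iff₀ (by positivity)]
        nlinarith

/-- The compact closed rectangle maps onto the annulus by a quotient map that identifies only ψ = 0
with ψ = 2π, and there φ vanishes. -/
theorem exists_lift {φ : ℝ × ℝ → ℝ} (hφ : Continuous φ) (hs : tsupport φ ⊆ Ω p) :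
    ∃ q : C(Annulus p, ℂ), ∀ x ∈ box p, q (polar p x) = φ x := by
  let Q := Icc p.rmin p.rmax × Icc 0 (2 * Real.pi)
  let π : Q → Annulus p := fun y : Q => (y.1, Circle.exp y.2)
  have hπc : Continuous π := continuous_fst.prodMk
    (Circle.exp.continuous.comp (continuous_subtype_val.comp continuous_snd))
  have hπs : Function.Surjective π := by
    rintro ⟨r, z⟩
    obtain ⟨t, ht, rfl⟩ : ∃ t ∈ Icc 0 (2 * Real.pi), Circle.exp t = z := by
      rcases le_or_gt 0 (Complex.arg z) with h | h
      · exact ⟨_, ⟨h, (Complex.arg_le_pi _).trans (by linarith [Real.pi_pos])⟩, Circle.exp_arg z⟩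
      · refine ⟨Complex.arg z + 2 * Real.pi, ⟨by linarith [Complex.neg_pi_lt_arg (z : ℂ),
          Real.pi_pos], by linarith⟩, ?_⟩
        rw [Circle.exp_add, Circle.exp_two_pi, mul_one, Circle.exp_arg]
    exact ⟨(r, ⟨t, ht⟩), rfl⟩
  let π' : C(Q, Annulus p) := ⟨π, hπc⟩
  have hquot : IsQuotientMap π' := hπc.isClosedMap.isQuotientMap hπc hπs
  have hzero : ∀ x, x ∉ Ω p → φ x = 0 := fun x hx => by
    by_contra hne
    exact hx (hs (subset_tsupport _ hne))
  let g : C(Q, ℂ) := ⟨fun y : Q => (φ ((y.1 : ℝ), (y.2 : ℝ)) : ℂ),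
    Complex.continuous_ofReal.comp (hφ.comp ((continuous_subtype_val.comp continuous_fst).prodMk
      (continuous_subtype_val.comp continuous_snd)))⟩
  have hg : Function.FactorsThrough g π' := by
    rintro ⟨r, t⟩ ⟨r', t'⟩ he
    have h1 : r = r' := congrArg Prod.fst he
    have h2 : Circle.exp t = Circle.exp t' := congrArg Prod.snd he
    subst h1
    by_cases ht : t = t'
    · rw [ht]
    obtain ⟨m, hm⟩ := Circle.exp_eq_exp.1 h2
    have ht' : (t : ℝ) ≠ t' := fun h => ht (Subtype.ext h)
    have hpi := Real.pi_pos
    have end_of : ∀ s : Icc 0 (2 * Real.pi), (s : ℝ) = 0 ∨ (s : ℝ) = 2 * Real.pi →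
        φ (r, s) = 0 := fun s hs' => hzero _ fun hmem => by
      have := hmem.2
      rcases hs' with h | h
      · simp [h] at this
      · simp [h] at this
    have hb1 := t.2.1
    have hb2 := t.2.2
    have hb3 := t'.2.1
    have hb4 := t'.2.2
    have hm1 : (m : ℝ) ≤ 1 := by
      by_contra hlt; push Not at hlt; nlinarith
    have hm2 : (-1 : ℝ) ≤ m := by
      by_contra hlt; push Not at hlt; nlinarith
    have hm1' : m ≤ 1 := by exact_mod_cast hm1
    have hm2' : -1 ≤ m := by exact_mod_cast hm2
    have hm0 : m ≠ 0 := fun h => ht' (by rw [hm, h]; simp)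
    have e : φ (r, t) = 0 ∧ φ (r, t') = 0 := by
      rcases (by omega : m = 1 ∨ m = -1) with h | h
      · rw [h] at hm; push_cast at hm
        exact ⟨end_of t (Or.inr (by linarith)), end_of t' (Or.inl (by linarith))⟩
      · rw [h] at hm; push_cast at hm
        exact ⟨end_of t (Or.inl (by linarith)), end_of t' (Or.inr (by linarith))⟩
    change (φ (r, t) : ℂ) = φ (r, t')
    rw [e.1, e.2]
  refine ⟨hquot.lift g hg, fun x hx => ?_⟩
  have h1 : polar p x = π (⟨x.1, hx.1⟩, ⟨x.2, hx.2⟩) := by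
    simp only [polar, π, projIcc_of_mem _ hx.1]
  rw [h1]
  exact DFunLike.congr_fun (hquot.lift_comp g hg) (⟨x.1, hx.1⟩, ⟨x.2, hx.2⟩)

/-- On the support of φ, sin θ is bounded below by some δ > 0. Dividing by max(δ, sin θ) changes
nothing there and is continuous everywhere. -/
theorem exists_polar_mul_sin {φ : ℝ × ℝ → ℝ} (hφ : Continuous φ) (hc : HasCompactSupport φ)
    (hs : tsupport φ ⊆ Ω p) :
    ∃ q : C(Annulus p, ℂ), ∀ x ∈ Ω p, q (polar p x) * sinExp p (1, 0) x = φ x := by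
  have hsin : Continuous fun x : ℝ × ℝ => Real.sin (radialAngle p x.1) :=
    Real.continuous_sin.comp (continuous_radialAngle.comp continuous_fst)
  have hpos : ∀ x ∈ Ω p, 0 < Real.sin (radialAngle p x.1) := fun x hx =>
    Real.sin_pos_of_mem_Ioo (radialAngle_mem hx.1)
  obtain ⟨δ, hδ, hle⟩ : ∃ δ > 0, ∀ x ∈ tsupport φ, δ ≤ Real.sin (radialAngle p x.1) := by
    rcases (tsupport φ).eq_empty_or_nonempty with h | h
    · exact ⟨1, one_pos, by simp [h]⟩
    · obtain ⟨x₀, hx₀, hmin⟩ := (show IsCompact (tsupport φ) from hc).exists_isMinOn h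
        hsin.continuousOn
      exact ⟨_, hpos x₀ (hs hx₀), fun x hx => hmin hx⟩
  have hmax : ∀ x : ℝ × ℝ, max δ (Real.sin (radialAngle p x.1)) ≠ 0 := fun x =>
    (hδ.trans_le (le_max_left _ _)).ne'
  have hsupp : tsupport (fun x => φ x * (max δ (Real.sin (radialAngle p x.1)))⁻¹) ⊆ tsupport φ :=
    tsupport_mul_subset_left
  obtain ⟨q, hq⟩ := exists_lift (p := p) (φ := fun x => φ x *
    (max δ (Real.sin (radialAngle p x.1)))⁻¹)
    (hφ.mul ((continuous_const.max hsin).inv₀ hmax)) (hsupp.trans hs)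
  refine ⟨q, fun x hx => ?_⟩
  rw [hq x (Ω_subset_box p hx)]
  by_cases hx' : x ∈ tsupport φ
  · have h1 := max_eq_right (hle x hx')
    have h2 : (Real.sin (radialAngle p x.1) : ℂ) ≠ 0 := by exact_mod_cast (hpos x hx).ne'
    simp only [h1, sinExp]
    push_cast at h2 ⊢
    field_simp
    simp
  · simp [image_eq_zero_of_notMem_tsupport hx']

/-- Orthogonality to the system says that w = u/√r annihilates all sin(nθ)e^{ikψ}, hence all
continuous functions on the annulus times sin θ, hence all test functions. -/
theorem eq_zero_of_inner_basisFun {u : Y p} (h : ∀ i, inner ℂ (basisFun p i) u = 0) : u = 0 := by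
  set a : ℝ → ℝ := fun r => Real.sqrt (rho p r) / rho p r with ha
  have hac : Continuous a := (contDiff_div_rho contDiff_sqrt_rho).continuous
  set w : ℝ × ℝ → ℂ := fun x => (a x.1 : ℂ) * u x with hw
  have hu : Integrable (u : ℝ × ℝ → ℂ) (volume.restrict (Ω p)) :=
    (Lp.memLp u).integrable (by norm_num)
  have hac' : Continuous fun x : ℝ × ℝ => (a x.1 : ℂ) :=
    Complex.continuous_ofReal.comp (hac.comp continuous_fst)
  have hwi : Integrable w (volume.restrict (Ω p)) := by
    obtain ⟨C, -, hC⟩ := exists_bound p hac'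
    exact hu.bdd_mul hac'.aestronglyMeasurable
      ((ae_mem_Ω p).mono fun x hx => hC x (Ω_subset_box p hx))
  have hcN : (cN p : ℂ) ≠ 0 := by
    have := ell_pos (p := p)
    have h2 := cN_sq (p := p)
    intro h0
    have h3 : cN p = 0 := by exact_mod_cast h0
    rw [h3] at h2
    have : (0 : ℝ) < (Real.pi * ell p)⁻¹ := by positivity
    rw [← h2] at this; norm_num at this
  have hnat : ∀ (n : ℕ) (k : ℤ), ∫ x in Ω p, sinExp p ((n : ℤ) + 1, k) x * w x = 0 := by
    intro n k
    -- The inner product conjugates its first argument, so the exponential with -k tests against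
    -- e^{ikψ}.
    have h1 := h (n, -k)
    rw [basisFun, inner_toY (continuous_sep
      (contDiff_div_rho (contDiff_sinR n)).continuous _)] at h1
    have e : ∫ x in Ω p, (starRingEnd ℂ) (sep (fun r => sinR p n r / rho p r) (-k) x) * u x =
        ∫ x in Ω p, (cN p : ℂ) * (sinExp p ((n : ℤ) + 1, k) x * w x) := by
      refine setIntegral_congr_fun (measurableSet_Ω p) fun x hx => ?_
      have hx1 := hx.1
      have e1 : nu p n * lrad p x.1 = ((n : ℤ) + 1 : ℤ) * radialAngle p x.1 := by
        rw [radialAngle_eq (Ioo_subset_Icc_self hx1), nu, lrad, rho_eq hx1.1.le]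
        push_cast; ring
      simp only [sep, hw, ha, sinR, e1, sinExp, map_mul, Complex.conj_ofReal, ← Complex.exp_conj,
        Complex.conj_I]
      have : (starRingEnd ℂ) ((-k : ℤ) : ℂ) = ((-k : ℤ) : ℂ) := by
        rw [show ((-k : ℤ) : ℂ) = (((-k : ℤ) : ℝ) : ℂ) by push_cast; rfl, Complex.conj_ofReal]
      rw [this]
      push_cast
      ring_nf
    rw [e, integral_const_mul] at h1
    exact (mul_eq_zero.1 h1).resolve_left hcN
  have hall : ∀ i, ∫ x in Ω p, sinExp p i x * w x = 0 := by
    rintro ⟨n, k⟩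
    -- Frequencies n ≤ 0 add no condition, since the sine is odd.
    rcases lt_trichotomy n 0 with hn | hn | hn
    · obtain ⟨m, rfl⟩ : ∃ m : ℕ, n = -((m : ℤ) + 1) := ⟨(-n - 1).toNat, by omega⟩
      have e : ∀ x, sinExp p (-((m : ℤ) + 1), k) x * w x =
          -(sinExp p ((m : ℤ) + 1, k) x * w x) := by
        intro x
        simp only [sinExp]
        rw [show ((-((m : ℤ) + 1) : ℤ) : ℝ) * radialAngle p x.1 =
          -((((m : ℤ) + 1 : ℤ) : ℝ) * radialAngle p x.1) by push_cast; ring, Real.sin_neg]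
        push_cast; ring
      simp only [e]
      rw [integral_neg, hnat, neg_zero]
    · subst hn
      simp [sinExp]
    · obtain ⟨m, rfl⟩ : ∃ m : ℕ, n = (m : ℤ) + 1 := ⟨(n - 1).toNat, by omega⟩
      exact hnat m k
  have hopen := isOpen_Ω p
  have key := hopen.ae_eq_zero_of_integral_contDiff_smul_eq_zero (μ := volume) (f := w)
    (IntegrableOn.locallyIntegrableOn hwi) (by
      intro φ h1 h2 h3
      obtain ⟨q, hq⟩ := exists_polar_mul_sin (p := p) h1.continuous h2 h3
      have h4 := integral_polar_eq_zero hwi hall q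
      have h5 : ∫ x in Ω p, φ x • w x = 0 := by
        rw [← h4]
        refine setIntegral_congr_fun (measurableSet_Ω p) fun x hx => ?_
        simp only [← mul_assoc, hq x hx]
        simp
      rw [← h5]
      symm
      apply setIntegral_eq_integral_of_forall_compl_eq_zero
      intro x hx
      have : φ x = 0 := by
        by_contra hne; exact hx (h3 (subset_tsupport _ hne))
      simp [this])
  refine Y_ext ?_
  have h0 := Lp.coeFn_zero ℂ 2 (volume.restrict (Ω p))
  filter_upwards [h0, (ae_restrict_iff' hopen.measurableSet).2 key] with x h1 h2 _
  rw [h1, Pi.zero_apply]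
  have hane : (a x.1 : ℂ) ≠ 0 := by
    have h6 := rho_pos (p := p) x.1
    have h7 : 0 < a x.1 := div_pos (Real.sqrt_pos.2 h6) h6
    exact_mod_cast h7.ne'
  exact (mul_eq_zero.1 h2).resolve_left hane

variable (p) in
/-- The orthonormal basis of `L²(Ω)` that diagonalizes `r²Δ̃`. -/
def basis : HilbertBasis (ℕ × ℤ) ℂ (Y p) :=
  HilbertBasis.mkOfOrthogonalEqBot orthonormal_basisFun (by
    refine (Submodule.eq_bot_iff _).2 fun u hu => eq_zero_of_inner_basisFun fun i => ?_
    exact (Submodule.mem_orthogonal _ _).1 hu _ (Submodule.subset_span ⟨i, rfl⟩))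

theorem basis_apply (i : ℕ × ℤ) : basis p i = basisFun p i := by
  rw [basis, HilbertBasis.coe_mkOfOrthogonalEqBot]

end Completeness

/-! ### Operators that are diagonal between orthonormal systems -/

section Diagonal

variable {ι E F : Type*} [NormedAddCommGroup E] [InnerProductSpace ℂ E]
  [NormedAddCommGroup F] [InnerProductSpace ℂ F] [CompleteSpace F]

/-- Multiplication of square summable sequences by a bounded sequence. -/
def lpMul (a : ι → ℂ) (C : ℝ) (ha : ∀ i, ‖a i‖ ≤ C) :
    lp (fun _ : ι => ℂ) 2 →L[ℂ] lp (fun _ : ι => ℂ) 2 :=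
  have hle : ∀ (c : lp (fun _ : ι => ℂ) 2) (i : ι), ‖a i * c i‖ ≤ ‖((C : ℂ) • c) i‖ := by
    intro c i
    simp only [lp.coeFn_smul, Pi.smul_apply, norm_mul, norm_smul, Complex.norm_real,
      Real.norm_eq_abs]
    exact mul_le_mul_of_nonneg_right ((ha i).trans (le_abs_self C)) (norm_nonneg _)
  LinearMap.mkContinuous
    { toFun := fun c => ⟨fun i => a i * c i, Memℓp.mono' (lp.memℓp ((C : ℂ) • c)) (hle c)⟩
      map_add' := fun c d => Subtype.ext (funext fun i => mul_add _ _ _)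
      map_smul' := fun z c => Subtype.ext (funext fun i => mul_left_comm _ _ _) }
    |C| fun c => by
      refine (lp.norm_mono (p := 2) (by norm_num) (hle c)).trans ?_
      rw [norm_smul, Complex.norm_real, Real.norm_eq_abs]

variable (b : HilbertBasis ι ℂ E) {v : ι → F} (hv : Orthonormal ℂ v)

theorem clm_ext_basis {G : Type*} [AddCommGroup G] [Module ℂ G] [TopologicalSpace G] [T2Space G]
    {A B : E →L[ℂ] G} (h : ∀ i, A (b i) = B (b i)) : A = B := by
  refine ContinuousLinearMap.ext_on (s := range b) ?_ ?_
  · rw [dense_iff_closure_eq, ← Submodule.topologicalClosure_coe, b.dense_span]; rfl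
  · rintro _ ⟨i, rfl⟩
    exact h i

theorem mem_of_basis_mem {G G' : Type*} [NormedAddCommGroup G] [NormedSpace ℂ G]
    [NormedAddCommGroup G'] [NormedSpace ℂ G'] {A : E →L[ℂ] G} {B : E →L[ℂ] G'}
    {S : Submodule ℂ (G × G')} (hS : IsClosed (S : Set (G × G')))
    (h : ∀ i, (A (b i), B (b i)) ∈ S) (f : E) : (A f, B f) ∈ S := by
  have hcl : IsClosed ((S.comap (A.prod B : E →ₗ[ℂ] G × G') : Submodule ℂ E) : Set E) :=
    hS.preimage (A.prod B).continuous
  have hle : (Submodule.span ℂ (range b)).topologicalClosure ≤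
      S.comap (A.prod B : E →ₗ[ℂ] G × G') :=
    Submodule.topologicalClosure_minimal _
      (Submodule.span_le.2 (by rintro _ ⟨i, rfl⟩; exact h i)) hcl
  exact hle (by rw [b.dense_span]; trivial)

/-- The operator that maps the basis vector `b i` to `a i • v i`, for a bounded sequence `a`. -/
def diagOp (a : ι → ℂ) : E →L[ℂ] F :=
  open Classical in if h : ∃ C, ∀ i, ‖a i‖ ≤ C then
    hv.orthogonalFamily.linearIsometry.toContinuousLinearMap ∘L (lpMul a h.choose h.choose_spec) ∘L
      (b.repr : E →L[ℂ] lp (fun _ : ι => ℂ) 2)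
  else 0

theorem diagOp_basis {a : ι → ℂ} (h : ∃ C, ∀ i, ‖a i‖ ≤ C) (i : ι) :
    diagOp b hv a (b i) = a i • v i := by
  classical
  rw [diagOp, dif_pos h]
  have e : lpMul a h.choose h.choose_spec (b.repr (b i)) = lp.single 2 i (a i) := by
    rw [b.repr_self]
    ext j
    change a j * (lp.single 2 i (1 : ℂ) : lp (fun _ : ι => ℂ) 2) j = _
    by_cases hij : j = i
    · subst hij; simp
    · rw [lp.single_apply_ne _ _ _ hij, lp.single_apply_ne _ _ _ hij, mul_zero]
  change hv.orthogonalFamily.linearIsometry (lpMul a h.choose h.choose_spec (b.repr (b i))) = _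
  rw [e, OrthogonalFamily.linearIsometry_apply_single]
  rfl

theorem norm_diagOp_le {a : ι → ℂ} {C : ℝ} (hC : ∀ i, ‖a i‖ ≤ C) (hC0 : 0 ≤ C) :
    ‖diagOp b hv a‖ ≤ C := by
  have h : ∃ C, ∀ i, ‖a i‖ ≤ C := ⟨C, hC⟩
  refine ContinuousLinearMap.opNorm_le_bound _ hC0 fun f => ?_
  rw [diagOp, dif_pos h]
  change ‖hv.orthogonalFamily.linearIsometry (lpMul a h.choose h.choose_spec (b.repr f))‖ ≤ _
  rw [LinearIsometry.norm_map]
  have := lp.norm_mono (p := 2) (by norm_num) (x := lpMul a h.choose h.choose_spec (b.repr f))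
    (y := (C : ℂ) • b.repr f) fun i => by
      change ‖a i * b.repr f i‖ ≤ _
      simp only [lp.coeFn_smul, Pi.smul_apply, norm_mul, norm_smul, Complex.norm_real,
        Real.norm_eq_abs]
      exact mul_le_mul_of_nonneg_right ((hC i).trans (le_abs_self C)) (norm_nonneg _)
  refine this.trans ?_
  rw [norm_smul, Complex.norm_real, Real.norm_eq_abs, abs_of_nonneg hC0, LinearIsometryEquiv.norm_map]

theorem diagOp_add {a a' : ι → ℂ} (h : ∃ C, ∀ i, ‖a i‖ ≤ C) (h' : ∃ C, ∀ i, ‖a' i‖ ≤ C) :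
    diagOp b hv (fun i => a i + a' i) = diagOp b hv a + diagOp b hv a' := by
  have h2 : ∃ C, ∀ i, ‖a i + a' i‖ ≤ C := by
    obtain ⟨C, hC⟩ := h
    obtain ⟨C', hC'⟩ := h'
    exact ⟨C + C', fun i => (norm_add_le _ _).trans (add_le_add (hC i) (hC' i))⟩
  refine clm_ext_basis b fun i => ?_
  rw [diagOp_basis b hv h2, add_apply, diagOp_basis b hv h,
    diagOp_basis b hv h', add_smul]

/-- The finite truncations have finite rank, and the norm of the remainder is at most the supremum
of the remaining entries. -/
theorem isCompactOperator_diagOp {a : ι → ℂ} (h : Tendsto a cofinite (𝓝 0))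
    (hb : ∃ C, ∀ i, ‖a i‖ ≤ C) : IsCompactOperator (diagOp b hv a) := by
  classical
  have hbs : ∀ s : Finset ι, ∃ C, ∀ i, ‖if i ∈ s then a i else 0‖ ≤ C := fun s => by
    obtain ⟨C, hC⟩ := hb
    refine ⟨max C 0, fun i => ?_⟩
    split_ifs
    · exact (hC i).trans (le_max_left _ _)
    · simp
  have hcomp : ∀ s : Finset ι, IsCompactOperator (diagOp b hv fun i => if i ∈ s then a i else 0) := by
    intro s
    have e : diagOp b hv (fun i => if i ∈ s then a i else 0) =
        ∑ i ∈ s, (a i • (innerSL ℂ (b i)).smulRight (v i)) := by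
      refine clm_ext_basis b fun j => ?_
      rw [diagOp_basis b hv (hbs s)]
      simp only [FunLike.coe_sum, Finset.sum_apply, smul_apply,
        ContinuousLinearMap.smulRight_apply, innerSL_apply_apply, orthonormal_iff_ite.1 b.orthonormal]
      simp
    rw [e]
    have : ∀ t : Finset ι, (∑ i ∈ t, (a i • (innerSL ℂ (b i)).smulRight (v i)) : E →L[ℂ] F) ∈
        compactOperator (RingHom.id ℂ) E F := by
      intro t
      refine Submodule.sum_mem _ fun i _ => Submodule.smul_mem _ _ ?_
      have h1 : IsCompactOperator (innerSL ℂ (b i)) :=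
        isCompactOperator_of_locallyCompactSpace_dom (innerSL ℂ (b i))
      exact h1.clm_comp (ContinuousLinearMap.toSpanSingleton ℂ (v i))
    exact this s
  refine isCompactOperator_of_tendsto (l := (atTop : Filter (Finset ι)))
    (F := fun s => diagOp b hv fun i => if i ∈ s then a i else 0) ?_
    (Eventually.of_forall hcomp)
  rw [Metric.tendsto_nhds]
  intro ε hε
  have hfin : {i | ¬ ‖a i‖ < ε / 2}.Finite := by
    have := h.eventually (Metric.ball_mem_nhds 0 (half_pos hε))
    simpa using this
  filter_upwards [eventually_ge_atTop hfin.toFinset] with s hs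
  rw [dist_eq_norm]
  have e : diagOp b hv (fun i => if i ∈ s then a i else 0) - diagOp b hv a =
      diagOp b hv fun i => if i ∈ s then 0 else - a i := by
    have hb' : ∃ C, ∀ i, ‖if i ∈ s then 0 else - a i‖ ≤ C := by
      obtain ⟨C, hC⟩ := hb
      refine ⟨max C 0, fun i => ?_⟩
      split_ifs
      · simp
      · rw [norm_neg]; exact (hC i).trans (le_max_left _ _)
    refine clm_ext_basis b fun i => ?_
    rw [sub_apply, diagOp_basis b hv (hbs s), diagOp_basis b hv hb,
      diagOp_basis b hv hb', ← sub_smul]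
    split_ifs <;> simp
  rw [e]
  refine (norm_diagOp_le b hv (C := ε / 2) (fun i => ?_) (half_pos hε).le).trans_lt (half_lt_self hε)
  split_ifs with hi
  · rw [norm_zero]; positivity
  · rw [norm_neg]
    by_contra hlt
    exact hi (hs (hfin.mem_toFinset.2 fun h => hlt h.le))

theorem inner_basis_diagOp [CompleteSpace E] {a : ι → ℂ} (h : ∃ C, ∀ i, ‖a i‖ ≤ C) (i : ι) (f : E) :
    inner ℂ (b i) (diagOp b b.orthonormal a f) = a i * inner ℂ (b i) f := by
  classical
  have : (innerSL ℂ (b i)) ∘L (diagOp b b.orthonormal a) = a i • innerSL ℂ (b i) := by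
    refine clm_ext_basis b fun j => ?_
    rw [ContinuousLinearMap.comp_apply, diagOp_basis b b.orthonormal h]
    simp only [innerSL_apply_apply, inner_smul_right, smul_apply, smul_eq_mul,
      orthonormal_iff_ite.1 b.orthonormal]
    split_ifs with hij
    · rw [hij]
    · simp
  exact DFunLike.congr_fun this f

theorem ext_inner_basis {f g : E} (h : ∀ i, inner ℂ (b i) f = inner ℂ (b i) g) : f = g := by
  refine b.repr.injective (lp.ext (funext fun i => ?_))
  rw [b.repr_apply_apply, b.repr_apply_apply, h]

end Diagonal

/-! ### Partially defined operators as relations -/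

section Maps

variable {E F G : Type*} [AddCommGroup E] [Module ℂ E] [AddCommGroup F] [Module ℂ F]
  [AddCommGroup G] [Module ℂ G]

/-- `x` lies in the domain of `T`, and `T x = y`. -/
def Maps (T : E →ₗ.[ℂ] F) (x : E) (y : F) : Prop := ∃ h : x ∈ T.domain, T ⟨x, h⟩ = y

theorem Maps.unique {T : E →ₗ.[ℂ] F} {x : E} {y z : F} (h1 : Maps T x y) (h2 : Maps T x z) :
    y = z := by
  obtain ⟨_, rfl⟩ := h1
  obtain ⟨_, rfl⟩ := h2
  rfl

theorem exists_maps {T : E →ₗ.[ℂ] F} {x : E} (h : x ∈ T.domain) : ∃ y, Maps T x y := ⟨_, h, rfl⟩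

theorem Maps.value_eq {T : E →ₗ.[ℂ] F} {x : E} {y : F} (h : Maps T x y) : value T x = y := by
  obtain ⟨h, rfl⟩ := h
  rw [value, dif_pos h]

theorem mem_preimage_iff {T : E →ₗ.[ℂ] F} {V : Submodule ℂ F} {x : E} :
    x ∈ preimage T V ↔ ∃ y, Maps T x y ∧ y ∈ V := by
  constructor
  · intro h
    exact ⟨_, ⟨preimage_le T V h, rfl⟩, mem_of_mem_preimage T V x h⟩
  · rintro ⟨_, ⟨h, rfl⟩, hV⟩
    exact ⟨⟨x, h⟩, hV, rfl⟩

theorem maps_compose_iff {T : F →ₗ.[ℂ] G} {R : E →ₗ.[ℂ] F} {x : E} {z : G} :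
    Maps (compose T R) x z ↔ ∃ y, Maps R x y ∧ Maps T y z := by
  constructor
  · rintro ⟨h, rfl⟩
    exact ⟨_, ⟨preimage_le R T.domain h, rfl⟩, mem_of_mem_preimage R T.domain x h, rfl⟩
  · rintro ⟨_, ⟨h, rfl⟩, hT, rfl⟩
    exact ⟨⟨⟨x, h⟩, hT, rfl⟩, rfl⟩

theorem Maps.add {T R : E →ₗ.[ℂ] F} {x : E} {y z : F} (h1 : Maps T x y) (h2 : Maps R x z) :
    Maps (T + R) x (y + z) := by
  obtain ⟨h1, rfl⟩ := h1
  obtain ⟨h2, rfl⟩ := h2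
  exact ⟨⟨h1, h2⟩, rfl⟩

theorem Maps.sub {T R : E →ₗ.[ℂ] F} {x : E} {y z : F} (h1 : Maps T x y) (h2 : Maps R x z) :
    Maps (T - R) x (y - z) := by
  obtain ⟨h1, rfl⟩ := h1
  obtain ⟨h2, rfl⟩ := h2
  exact ⟨⟨h1, h2⟩, rfl⟩

theorem Maps.smul {T : E →ₗ.[ℂ] F} {x : E} {y : F} (c : ℂ) (h : Maps T x y) :
    Maps (c • T) x (c • y) := by
  obtain ⟨h, rfl⟩ := h
  exact ⟨h, rfl⟩

theorem maps_everywhere (T : E →ₗ[ℂ] F) (x : E) : Maps (everywhere T) x (T x) := ⟨trivial, rfl⟩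

theorem maps_scalar (c : ℂ) (x : E) : Maps (scalar E c) x (c • x) := ⟨trivial, rfl⟩

theorem Maps.onFirst {T : E →ₗ.[ℂ] E} {x y : E} (h : Maps T x y) (l : ℂ) :
    Maps (onFirst T) (x, l) (y, 0) := by
  obtain ⟨h, rfl⟩ := h
  exact ⟨h, rfl⟩

theorem mem_eigenspace_iff {T : E →ₗ.[ℂ] E} {z : ℂ} {x : E} :
    x ∈ eigenspace T z ↔ Maps T x (z • x) := by
  constructor
  · rintro ⟨y, hy, rfl⟩
    exact ⟨y.2, sub_eq_zero.1 hy⟩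
  · rintro ⟨h, e⟩
    exact ⟨⟨x, h⟩, sub_eq_zero.2 e, rfl⟩

theorem maps_domRestrict_iff {T : E →ₗ.[ℂ] F} {S : Submodule ℂ E} {x : E} {y : F} :
    Maps (T.domRestrict S) x y ↔ x ∈ S ∧ Maps T x y := by
  constructor
  · rintro ⟨h, rfl⟩
    exact ⟨h.1, h.2, rfl⟩
  · rintro ⟨hS, h, rfl⟩
    exact ⟨⟨hS, h⟩, rfl⟩

end Maps

/-! ### Sobolev spaces and a working description of X -/

section SobolevSpaces

variable {p : Params}

theorem maps_weakDeriv_iff {i j : ℕ} {u v : Y p} :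
    Maps (weakDeriv p i j) u v ↔ (u, v) ∈ partsGraph p (interiorTests p) i j := by
  constructor
  · rintro ⟨h, rfl⟩
    exact Submodule.mem_graph_toLinearPMap (partsGraph_unique p i j) ⟨u, h⟩
  · intro h
    have hd : u ∈ (weakDeriv p i j).domain := ⟨(u, v), h, rfl⟩
    refine ⟨hd, ?_⟩
    have h2 := Submodule.mem_graph_toLinearPMap (partsGraph_unique p i j) ⟨u, hd⟩
    have h3 := partsGraph_unique p i j _ (Submodule.sub_mem _ h2 h) (sub_self u)
    exact sub_eq_zero.1 h3

theorem partsGraph_interior_unique {i j : ℕ} {u v w : Y p}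
    (h1 : (u, v) ∈ partsGraph p (interiorTests p) i j)
    (h2 : (u, w) ∈ partsGraph p (interiorTests p) i j) : v = w :=
  (maps_weakDeriv_iff.2 h1).unique (maps_weakDeriv_iff.2 h2)

theorem partsGraph_zero_zero (T : Set (ℝ × ℝ → ℝ)) (u : Y p) : (u, u) ∈ partsGraph p T 0 0 := by
  rw [mem_partsGraph_iff]
  intro φ _ _
  simp [pd]

theorem mem_H_iff {k : ℕ} {u : Y p} :
    u ∈ H p k ↔ ∀ i j, i + j ≤ k → ∃ v, (u, v) ∈ partsGraph p (interiorTests p) i j := by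
  simp only [H, Submodule.mem_iInf]
  refine forall_congr' fun i => forall_congr' fun j => forall_congr' fun _ => ?_
  constructor
  · intro h
    obtain ⟨v, hv⟩ := exists_maps h
    exact ⟨v, maps_weakDeriv_iff.1 hv⟩
  · rintro ⟨v, hv⟩
    exact (maps_weakDeriv_iff.2 hv).1

/-- This recursive form is what the product rule and the regularity arguments use by induction on
the order. -/
theorem mem_H_succ_iff {k : ℕ} {u : Y p} : u ∈ H p (k + 1) ↔
    ∃ v w, (u, v) ∈ partsGraph p (interiorTests p) 1 0 ∧
      (u, w) ∈ partsGraph p (interiorTests p) 0 1 ∧ v ∈ H p k ∧ w ∈ H p k := by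
  constructor
  · intro h
    have h' := mem_H_iff.1 h
    obtain ⟨v, hv⟩ := h' 1 0 (by omega)
    obtain ⟨w, hw⟩ := h' 0 1 (by omega)
    refine ⟨v, w, hv, hw, mem_H_iff.2 fun i j hij => ?_, mem_H_iff.2 fun i j hij => ?_⟩
    · obtain ⟨z, hz⟩ := h' (i + 1) j (by omega)
      exact ⟨z, partsGraph_of_comp stableTests_interior hv hz⟩
    · obtain ⟨z, hz⟩ := h' i (j + 1) (by omega)
      exact ⟨z, partsGraph_of_comp stableTests_interior hw hz⟩
  · rintro ⟨v, w, hv, hw, hvk, hwk⟩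
    refine mem_H_iff.2 fun i j hij => ?_
    rcases i with _ | i
    · rcases j with _ | j
      · exact ⟨u, partsGraph_zero_zero _ u⟩
      · obtain ⟨z, hz⟩ := mem_H_iff.1 hwk 0 j (by omega)
        exact ⟨z, partsGraph_comp stableTests_interior hw hz⟩
    · obtain ⟨z, hz⟩ := mem_H_iff.1 hvk i j (by omega)
      exact ⟨z, partsGraph_comp stableTests_interior hv hz⟩

theorem mem_H_zero (u : Y p) : u ∈ H p 0 := mem_H_iff.2 fun i j hij => by
  obtain ⟨rfl, rfl⟩ : i = 0 ∧ j = 0 := by omega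
  exact ⟨u, partsGraph_zero_zero _ u⟩

theorem H_anti {k l : ℕ} (hkl : k ≤ l) : H p l ≤ H p k := fun _ hu =>
  mem_H_iff.2 fun i j hij => mem_H_iff.1 hu i j (hij.trans hkl)

theorem mulL_mem_H {c : ℝ × ℝ → ℝ} (hc : ContDiff ℝ ∞ c) {k : ℕ} {u : Y p} (hu : u ∈ H p k) :
    mulL p c u ∈ H p k := by
  induction k generalizing c u with
  | zero => exact mem_H_zero _
  | succ k ih =>
    obtain ⟨v, w, hv, hw, hvk, hwk⟩ := mem_H_succ_iff.1 hu
    have hl {u v : Y p} := partsGraph_leibniz (u := u) (v := v) hc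
      (fun φ hφ => mul_mem_interior (p := p) (c := c) hφ)
    have huk := H_anti (Nat.le_succ k) hu
    exact mem_H_succ_iff.2 ⟨_, _, hl.1 hv, hl.2 hw,
      Submodule.add_mem _ (ih hc hvk) (ih (contDiff_dr hc) huk),
      Submodule.add_mem _ (ih hc hwk) (ih (contDiff_dpsi hc) huk)⟩

/-- The `2π`-periodic extension in `ψ` of the restriction of `φ` to `0 ≤ ψ < 2π`. -/
def periodize (φ : ℝ × ℝ → ℝ) (x : ℝ × ℝ) : ℝ :=
  φ (x.1, x.2 - 2 * Real.pi * ⌊x.2 / (2 * Real.pi)⌋)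

theorem periodize_mem (φ : ℝ × ℝ → ℝ) : periodize φ ∈ periodicTests := by
  intro r ψ
  have h2 : (ψ + 2 * Real.pi) / (2 * Real.pi) = ψ / (2 * Real.pi) + 1 := by
    field_simp
  simp only [periodize, h2, Int.floor_add_one, Int.cast_add, Int.cast_one]
  congr 2
  ring

/-- On a strip of two periods the floor is replaced by a sum of two translates, of which at least
one vanishes. The sum is visibly smooth across the seam between the periods. -/
theorem periodize_eq {φ : ℝ × ℝ → ℝ} (h0 : ∀ x, x ∉ Ω p → φ x = 0) (n : ℤ) {x : ℝ × ℝ}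
    (h1 : -(2 * Real.pi) ≤ x.2 - 2 * Real.pi * n) (h2 : x.2 - 2 * Real.pi * n < 2 * Real.pi) :
    periodize φ x = φ (x.1, x.2 - 2 * Real.pi * n) +
      φ (x.1, x.2 - 2 * Real.pi * n + 2 * Real.pi) := by
  have hpi : (0 : ℝ) < 2 * Real.pi := by positivity
  have hz : ∀ t, (t ≤ 0 ∨ 2 * Real.pi ≤ t) → φ (x.1, t) = 0 := by
    intro t ht
    refine h0 _ fun hx => ?_
    rcases ht with ht | ht
    · exact absurd hx.2.1 (not_lt.2 ht)
    · exact absurd hx.2.2 (not_lt.2 ht)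
  rcases le_or_gt 0 (x.2 - 2 * Real.pi * n) with h | h
  · have hf : ⌊x.2 / (2 * Real.pi)⌋ = n := by
      rw [Int.floor_eq_iff, le_div_iff₀ hpi, div_lt_iff₀ hpi]
      constructor <;> nlinarith
    rw [periodize, hf, hz (x.2 - 2 * Real.pi * n + 2 * Real.pi) (Or.inr (by linarith)), add_zero]
  · have hf : ⌊x.2 / (2 * Real.pi)⌋ = n - 1 := by
      rw [Int.floor_eq_iff, le_div_iff₀ hpi, div_lt_iff₀ hpi]
      push_cast
      constructor <;> nlinarith
    rw [periodize, hf, hz (x.2 - 2 * Real.pi * n) (Or.inl h.le), zero_add]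
    push_cast
    congr 2
    ring

theorem contDiff_periodize {φ : ℝ × ℝ → ℝ} (h0 : ∀ x, x ∉ Ω p → φ x = 0)
    (hφ : ContDiff ℝ ∞ φ) : ContDiff ℝ ∞ (periodize φ) := by
  have hpi : (0 : ℝ) < 2 * Real.pi := by positivity
  refine contDiff_iff_contDiffAt.2 fun x => ?_
  -- Rounding to the nearest integer puts the angle, minus 2πn, between -π and π, well inside the
  -- strip where the two translates describe the extension.
  set n : ℤ := ⌊x.2 / (2 * Real.pi) + 1 / 2⌋ with hn
  have h1 := Int.floor_le (x.2 / (2 * Real.pi) + 1 / 2)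
  have h2 := Int.lt_floor_add_one (x.2 / (2 * Real.pi) + 1 / 2)
  rw [← hn] at h1 h2
  have hx : x.2 = 2 * Real.pi * (x.2 / (2 * Real.pi)) := by field_simp
  have hs : ContDiff ℝ ∞ fun y : ℝ × ℝ => φ (y.1, y.2 - 2 * Real.pi * n) +
      φ (y.1, y.2 - 2 * Real.pi * n + 2 * Real.pi) :=
    (hφ.comp (by fun_prop)).add (hφ.comp (by fun_prop))
  refine hs.contDiffAt.congr_of_eventuallyEq ?_
  have ho : IsOpen {y : ℝ × ℝ | -(2 * Real.pi) < y.2 - 2 * Real.pi * n ∧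
      y.2 - 2 * Real.pi * n < 2 * Real.pi} :=
    isOpen_Ioo.preimage (f := fun y : ℝ × ℝ => y.2 - 2 * Real.pi * n) (by fun_prop)
  filter_upwards [ho.mem_nhds (x := x) ⟨by nlinarith, by nlinarith⟩] with y hy
  exact periodize_eq h0 n hy.1.le hy.2

theorem periodize_eq_of_mem {φ : ℝ × ℝ → ℝ} {x : ℝ × ℝ} (hx : x ∈ Ω p) :
    periodize φ x = φ x := by
  have hpi : (0 : ℝ) < 2 * Real.pi := by positivity
  have hf : ⌊x.2 / (2 * Real.pi)⌋ = 0 := by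
    rw [Int.floor_eq_iff, le_div_iff₀ hpi, div_lt_iff₀ hpi]
    have := hx.2.1
    have := hx.2.2
    constructor <;> simp <;> linarith
  simp [periodize, hf]

theorem pd_eqOn {U : Set (ℝ × ℝ)} (hU : IsOpen U) {φ χ : ℝ × ℝ → ℝ} (h : EqOn φ χ U) (i j : ℕ) :
    EqOn (pd i j φ) (pd i j χ) U := by
  have key : ∀ (v : ℝ × ℝ) {φ χ : ℝ × ℝ → ℝ}, EqOn φ χ U →
      EqOn (fun x => fderiv ℝ φ x v) (fun x => fderiv ℝ χ x v) U := by
    intro v φ χ h x hx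
    have : φ =ᶠ[𝓝 x] χ := by
      filter_upwards [hU.mem_nhds hx] with y hy using h hy
    simp only [this.fderiv_eq]
  have hj : EqOn (dpsi^[j] φ) (dpsi^[j] χ) U := by
    induction j with
    | zero => exact h
    | succ j ih => simp only [Function.iterate_succ_apply']; exact key _ ih
  unfold pd
  induction i with
  | zero => exact hj
  | succ i ih => simp only [Function.iterate_succ_apply']; exact key _ ih

/-- A compactly supported test function has a smooth periodic extension that agrees with it on Ω,
together with all its derivatives. -/
theorem partsGraph_periodic_le (i j : ℕ) :
    partsGraph p periodicTests i j ≤ partsGraph p (interiorTests p) i j := by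
  rintro w hw φ ⟨_, hs⟩ hφ
  have h0 : ∀ x, x ∉ Ω p → φ x = 0 := fun x hx => by
    by_contra hne
    exact hx (hs (subset_tsupport _ hne))
  have := hw _ (periodize_mem φ) (contDiff_periodize h0 hφ)
  have he : EqOn (periodize φ) φ (Ω p) := fun x hx => periodize_eq_of_mem hx
  rw [setIntegral_congr_fun (measurableSet_Ω p) (g := fun x => pd i j φ x • w.1 x)
    (fun x hx => by simp only [pd_eqOn (isOpen_Ω p) he i j hx]),
    setIntegral_congr_fun (measurableSet_Ω p) (f := fun x => periodize φ x • w.2 x)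
      (g := fun x => φ x • w.2 x)
    (fun x hx => by simp only [he hx])] at this
  exact this

theorem partsGraph_univ_le (i j : ℕ) :
    partsGraph p univ i j ≤ partsGraph p (interiorTests p) i j :=
  partsGraph_anti (subset_univ _) i j

/-- By uniqueness of weak derivatives, the periodic ψ-derivative of u is the weak one. Periodicity
of ∂_ψ u is therefore a second periodic integration by parts. -/
theorem mem_X_iff {u : Y p} : u ∈ X p ↔ u ∈ H p 2 ∧ (∃ v, (u, v) ∈ partsGraph p univ 1 0) ∧
    ∃ w z, (u, w) ∈ partsGraph p periodicTests 0 1 ∧ (w, z) ∈ partsGraph p periodicTests 0 1 := by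
  simp only [X, Submodule.mem_inf]
  constructor
  · rintro ⟨⟨⟨h1, ⟨⟨_, v⟩, hv, rfl⟩⟩, ⟨⟨u, w⟩, hw, rfl⟩⟩, h4⟩
    refine ⟨h1, ⟨v, hv⟩, ?_⟩
    obtain ⟨w', hw', ⟨⟨w2, z⟩, hz, (rfl : w2 = w')⟩⟩ := mem_preimage_iff.1 h4
    have : w = w2 :=
      partsGraph_interior_unique (partsGraph_periodic_le 0 1 hw) (maps_weakDeriv_iff.1 hw')
    subst this
    exact ⟨w, z, hw, hz⟩
  · rintro ⟨h1, ⟨v, hv⟩, w, z, hw, hz⟩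
    exact ⟨⟨⟨h1, ⟨_, hv, rfl⟩⟩, ⟨_, hw, rfl⟩⟩, mem_preimage_iff.2
      ⟨w, maps_weakDeriv_iff.2 (partsGraph_periodic_le 0 1 hw), ⟨_, hz, rfl⟩⟩⟩

end SobolevSpaces

/-! ### Integration by parts against R(r) e^{ikψ} -/

section ComplexTests

variable {p : Params}

theorem inner_fderiv_of_real {u v : Y p} {e : ℝ × ℝ} {F : ℝ × ℝ → ℂ} (hF : ContDiff ℝ ∞ F)
    (hre : inner ℂ (toY p fun x => (fderiv ℝ (fun y => (F y).re) x e : ℂ)) u =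
      (-1) * inner ℂ (toY p fun x => ((F x).re : ℂ)) v)
    (him : inner ℂ (toY p fun x => (fderiv ℝ (fun y => (F y).im) x e : ℂ)) u =
      (-1) * inner ℂ (toY p fun x => ((F x).im : ℂ)) v) :
    inner ℂ (toY p fun x => fderiv ℝ F x e) u = -inner ℂ (toY p F) v := by
  have hd := hF.differentiable (by simp)
  have cre : ContDiff ℝ ∞ fun y => (F y).re := Complex.reCLM.contDiff.comp hF
  have cim : ContDiff ℝ ∞ fun y => (F y).im := Complex.imCLM.contDiff.comp hF
  have ere : ∀ x, fderiv ℝ (fun y => (F y).re) x e = (fderiv ℝ F x e).re := fun x => by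
    have := (Complex.reCLM.hasFDerivAt.comp x (hd x).hasFDerivAt).fderiv
    exact DFunLike.congr_fun this e
  have eim : ∀ x, fderiv ℝ (fun y => (F y).im) x e = (fderiv ℝ F x e).im := fun x => by
    have := (Complex.imCLM.hasFDerivAt.comp x (hd x).hasFDerivAt).fderiv
    exact DFunLike.congr_fun this e
  have hc' : Continuous fun x => fderiv ℝ F x e :=
    (hF.continuous_fderiv (by simp)).clm_apply continuous_const
  simp only [ere] at hre
  simp only [eim] at him
  have split : ∀ {G : ℝ × ℝ → ℂ}, Continuous G → ∀ w : Y p, inner ℂ (toY p G) w =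
      inner ℂ (toY p fun x => ((G x).re : ℂ)) w -
        Complex.I * inner ℂ (toY p fun x => ((G x).im : ℂ)) w := by
    intro G hG w
    have c1 : Continuous fun x => ((G x).re : ℂ) := by fun_prop
    have c2 : Continuous fun x => ((G x).im : ℂ) := by fun_prop
    have : toY p G = (toY p fun x => ((G x).re : ℂ)) +
        Complex.I • (toY p fun x => ((G x).im : ℂ)) := by
      have c3 : Continuous fun x => Complex.I * ((G x).im : ℂ) := continuous_const.mul c2
      rw [← toY_smul c2, ← toY_add c1 c3]
      refine toY_congr hG (c1.add c3) fun x _ => ?_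
      rw [mul_comm, Complex.re_add_im]
    rw [this, inner_add_left, inner_smul_left, Complex.conj_I]
    ring
  rw [split hc' u, split hF.continuous v, hre, him]
  ring

theorem inner_sep_deriv {u v : Y p} (h : (u, v) ∈ partsGraph p univ 1 0) {R : ℝ → ℝ}
    (hR : ContDiff ℝ ∞ R) (k : ℤ) :
    inner ℂ (toY p (sep (deriv R) k)) u = -inner ℂ (toY p (sep R k)) v := by
  have hF := contDiff_sep hR k
  have cre : ContDiff ℝ ∞ fun y => (sep R k y).re := Complex.reCLM.contDiff.comp hF
  have cim : ContDiff ℝ ∞ fun y => (sep R k y).im := Complex.imCLM.contDiff.comp hF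
  rw [← inner_fderiv_of_real (e := (1, 0)) hF (by simpa [pd, dr] using mem_partsGraph_iff.1 h _ trivial cre)
    (by simpa [pd, dr] using mem_partsGraph_iff.1 h _ trivial cim)]
  simp only [fderiv_sep_left hR]

theorem inner_sep_deriv_of_vanishing [hp : p.Admissible] {u v : Y p}
    (h : (u, v) ∈ partsGraph p (interiorTests p) 1 0) {R : ℝ → ℝ}
    (hR : ContDiff ℝ ∞ R) (h1 : R p.rmin = 0) (h2 : R p.rmax = 0) (k : ℤ) :
    inner ℂ (toY p (sep (deriv R) k)) u = -inner ℂ (toY p (sep R k)) v := by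
  have hF := contDiff_sep hR k
  have cre : ContDiff ℝ ∞ fun y => (sep R k y).re := Complex.reCLM.contDiff.comp hF
  have cim : ContDiff ℝ ∞ fun y => (sep R k y).im := Complex.imCLM.contDiff.comp hF
  rw [← inner_fderiv_of_real (e := (1, 0)) hF
    (by simpa [dr] using inner_dr_of_vanishing h cre (by simp [sep, h1]) (by simp [sep, h2]))
    (by simpa [dr] using inner_dr_of_vanishing h cim (by simp [sep, h1]) (by simp [sep, h2]))]
  simp only [fderiv_sep_left hR]

theorem inner_sep_psi {u v : Y p} (h : (u, v) ∈ partsGraph p periodicTests 0 1) {R : ℝ → ℝ}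
    (hR : ContDiff ℝ ∞ R) (k : ℤ) :
    inner ℂ (toY p (sep R k)) v = Complex.I * k * inner ℂ (toY p (sep R k)) u := by
  have hF := contDiff_sep hR k
  have cre : ContDiff ℝ ∞ fun y => (sep R k y).re := Complex.reCLM.contDiff.comp hF
  have cim : ContDiff ℝ ∞ fun y => (sep R k y).im := Complex.imCLM.contDiff.comp hF
  have hre : (fun y => (sep R k y).re) ∈ periodicTests := fun r ψ => by simp only [sep_periodic]
  have him : (fun y => (sep R k y).im) ∈ periodicTests := fun r ψ => by simp only [sep_periodic]
  have := inner_fderiv_of_real (e := (0, 1)) (u := u) (v := v) hF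
    (by simpa [pd, dpsi] using mem_partsGraph_iff.1 h _ hre cre)
    (by simpa [pd, dpsi] using mem_partsGraph_iff.1 h _ him cim)
  simp only [fderiv_sep_right hR] at this
  rw [toY_smul hF.continuous, inner_smul_left] at this
  rw [← neg_eq_iff_eq_neg.2 this]
  simp

end ComplexTests

/-! ### The solution operator of Δ̃ on X and its derivatives -/

section Green

variable (p : Params)

/-- The eigenvalues of `-r²Δ̃`. -/
def mu (i : ℕ × ℤ) : ℝ := nu p i.1 ^ 2 + 1 / 4 + 4 * (i.2 : ℝ) ^ 2

/-- The radius, as a globally defined smooth positive function. -/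
def rad (x : ℝ × ℝ) : ℝ := rho p x.1

/-- The inverse of the radius. -/
def radInv (x : ℝ × ℝ) : ℝ := (rho p x.1)⁻¹

variable [hp : p.Admissible]

/-- The solution operator `f ↦ u` of the problem `Δ̃u = f / r`, `u ∈ X`. -/
def green : Y p →L[ℂ] Y p :=
  mulL p (rad p) ∘L diagOp (basis p) orthonormal_basisFun fun i => ((-1 : ℂ) / mu p i)

/-- `∂_r` of the solution operator. -/
def greenR : Y p →L[ℂ] Y p :=
  diagOp (basis p) orthonormal_basisFun (fun i => ((-1 / 2 : ℂ) / mu p i)) +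
    diagOp (basis p) orthonormal_cobasisFun fun i => -(nu p i.1 : ℂ) / mu p i

/-- `∂_ψ` of the solution operator. -/
def greenP : Y p →L[ℂ] Y p :=
  mulL p (rad p) ∘L diagOp (basis p) orthonormal_basisFun fun i => -(Complex.I * i.2) / mu p i

/-- `∂_r²` of the solution operator. -/
def greenRR : Y p →L[ℂ] Y p :=
  mulL p (radInv p) ∘L diagOp (basis p) orthonormal_basisFun fun i =>
    ((nu p i.1 : ℂ) ^ 2 + 1 / 4) / mu p i

/-- `∂_r∂_ψ` of the solution operator. -/
def greenRP : Y p →L[ℂ] Y p :=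
  diagOp (basis p) orthonormal_basisFun (fun i => -(Complex.I * i.2 / 2) / mu p i) +
    diagOp (basis p) orthonormal_cobasisFun fun i => -(Complex.I * i.2 * nu p i.1) / mu p i

/-- `∂_ψ²` of the solution operator. -/
def greenPP : Y p →L[ℂ] Y p :=
  mulL p (rad p) ∘L diagOp (basis p) orthonormal_basisFun fun i => (i.2 : ℂ) ^ 2 / mu p i

variable {p}

theorem mu_ge (i : ℕ × ℤ) : 1 / 4 ≤ mu p i := by
  unfold mu; nlinarith [sq_nonneg (nu p i.1), sq_nonneg (i.2 : ℝ)]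

theorem mu_pos (i : ℕ × ℤ) : 0 < mu p i := lt_of_lt_of_le (by norm_num) (mu_ge i)

theorem mu_ne_zero (i : ℕ × ℤ) : (mu p i : ℂ) ≠ 0 := by exact_mod_cast (mu_pos i).ne'

theorem exists_bound_div_mu {x : ℕ × ℤ → ℂ} (h : ∀ i, ‖x i‖ ≤ 4 * mu p i) :
    ∃ C, ∀ i, ‖x i / mu p i‖ ≤ C := by
  refine ⟨4, fun i => ?_⟩
  rw [norm_div, Complex.norm_real, Real.norm_eq_abs, abs_of_pos (mu_pos i),
    div_le_iff₀ (mu_pos i)]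
  exact h i

/-- The constant 1/4 in μ is what dominates the first powers: t ≤ t² + 1/4. These bounds make all
derivatives of `green` up to order two bounded. -/
theorem abs_le_mu (i : ℕ × ℤ) : |(i.2 : ℝ)| ≤ mu p i ∧ nu p i.1 ≤ mu p i ∧
    |(i.2 : ℝ)| * nu p i.1 ≤ mu p i ∧ nu p i.1 ^ 2 + 1 / 4 ≤ mu p i ∧ (i.2 : ℝ) ^ 2 ≤ mu p i := by
  have h1 := sq_abs (i.2 : ℝ)
  have h0 := abs_nonneg (i.2 : ℝ)
  unfold mu
  rw [← h1]
  set t := |(i.2 : ℝ)|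
  set n := nu p i.1
  refine ⟨?_, ?_, ?_, ?_, ?_⟩ <;> nlinarith [sq_nonneg (n - 1 / 2), sq_nonneg (t - 1 / 2), sq_nonneg (n - t)]

theorem continuous_rad : Continuous (rad p) := (contDiff_rho p).continuous.comp continuous_fst

theorem continuous_radInv : Continuous (radInv p) :=
  continuous_rad.inv₀ fun x => rho_ne_zero x.1

theorem contDiff_rad : ContDiff ℝ ∞ (rad p) := (contDiff_rho p).comp contDiff_fst

theorem contDiff_radInv : ContDiff ℝ ∞ (radInv p) := contDiff_rad.inv fun x => rho_ne_zero x.1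

theorem rad_eq {x : ℝ × ℝ} (hx : x ∈ Ω p) : rad p x = x.1 := rho_eq hx.1.1.le

theorem mulL_rad_radInv (u : Y p) : mulL p (rad p) (mulL p (radInv p) u) = u := by
  rw [mulL_mulL continuous_rad continuous_radInv continuous_const (e := fun _ => 1)
    (fun x _ => mul_inv_cancel₀ (rho_ne_zero x.1)), mulL_one continuous_const fun _ _ => rfl]

theorem mulL_radInv_rad (u : Y p) : mulL p (radInv p) (mulL p (rad p) u) = u := by
  rw [mulL_mulL continuous_radInv continuous_rad continuous_const (e := fun _ => 1)
    (fun x _ => inv_mul_cancel₀ (rho_ne_zero x.1)), mulL_one continuous_const fun _ _ => rfl]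

theorem contDiff_deriv {R : ℝ → ℝ} (hR : ContDiff ℝ ∞ R) : ContDiff ℝ ∞ (deriv R) :=
  (contDiff_infty_iff_deriv.1 hR).2

variable (p) in
/-- The eigenfunctions of `r²Δ̃`. -/
def eigenFun (i : ℕ × ℤ) : Y p := toY p (sep (sinR p i.1) i.2)

theorem mulL_rad_basisFun (i : ℕ × ℤ) : mulL p (rad p) (basisFun p i) = eigenFun p i :=
  mulL_toY continuous_rad (contDiff_sep (contDiff_div_rho (p := p) (contDiff_sinR i.1)) _).continuous
    (contDiff_sep (contDiff_sinR i.1) _).continuous fun x _ => by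
      have := rho_ne_zero (p := p) x.1
      have : (rho p x.1 : ℂ) ≠ 0 := by exact_mod_cast this
      simp only [sep, rad]
      push_cast
      field_simp

theorem toY_sep_deriv_sinR (i : ℕ × ℤ) : toY p (sep (deriv (sinR p i.1)) i.2) =
    (1 / 2 : ℂ) • basisFun p i + (nu p i.1 : ℂ) • cobasisFun p i := by
  have c1 := (contDiff_sep (contDiff_div_rho (p := p) (contDiff_sinR (p := p) i.1)) i.2).continuous
  have c2 := (contDiff_sep (contDiff_div_rho (p := p) (contDiff_cosR (p := p) i.1)) i.2).continuous
  rw [basisFun, cobasisFun, ← toY_smul c1, ← toY_smul c2,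
    ← toY_add (F := fun x => _ * sep _ _ x) (G := fun x => _ * sep _ _ x)
      (continuous_const.mul c1) (continuous_const.mul c2)]
  refine toY_congr (contDiff_sep (contDiff_deriv (contDiff_sinR (p := p) i.1)) _).continuous
    ((continuous_const.mul c1).add (continuous_const.mul c2)) fun x hx => ?_
  have hr : p.rmin < x.1 := hx.1.1
  have : (x.1 : ℂ) ≠ 0 := by exact_mod_cast (hp.rmin_pos.trans hr).ne'
  simp only [sep, deriv_sinR _ hr, rho_eq hr.le]
  push_cast
  field_simp

theorem toY_sep_deriv_deriv_sinR (i : ℕ × ℤ) : toY p (sep (deriv (deriv (sinR p i.1))) i.2) =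
    (-((nu p i.1 : ℂ) ^ 2 + 1 / 4)) • mulL p (radInv p) (basisFun p i) := by
  have c1 := (contDiff_sep (contDiff_div_rho (p := p) (contDiff_sinR (p := p) i.1)) i.2).continuous
  rw [← map_smul, basisFun, ← toY_smul c1]
  symm
  refine mulL_toY continuous_radInv (continuous_const.mul c1)
    (contDiff_sep (contDiff_deriv (contDiff_deriv (contDiff_sinR (p := p) i.1))) _).continuous fun x hx => ?_
  have hr : p.rmin < x.1 := hx.1.1
  have : (x.1 : ℂ) ≠ 0 := by exact_mod_cast (hp.rmin_pos.trans hr).ne'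
  simp only [sep, deriv_deriv_sinR _ hr, rho_eq hr.le, radInv]
  push_cast
  field_simp

theorem sep_mem_left {R : ℝ → ℝ} (hR : ContDiff ℝ ∞ R) (k : ℤ) {T : Set (ℝ × ℝ → ℝ)}
    (h : ∀ φ ∈ T, ∀ ψ, φ (p.rmin, ψ) * R p.rmin = 0 ∧ φ (p.rmax, ψ) * R p.rmax = 0) :
    (toY p (sep R k), toY p (sep (deriv R) k)) ∈ partsGraph p T 1 0 := by
  have := toY_mem_partsGraph_left (p := p) (contDiff_sep hR k) (T := T) (by
    intro φ hφ ψ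
    obtain ⟨h1, h2⟩ := h φ hφ ψ
    simp only [sep, ← mul_assoc, ← Complex.ofReal_mul, h1, h2, Complex.ofReal_zero, zero_mul])
  simp only [fderiv_sep_left hR] at this
  exact this

theorem sep_mem_right {R : ℝ → ℝ} (hR : ContDiff ℝ ∞ R) (k : ℤ) :
    (toY p (sep R k), (Complex.I * k) • toY p (sep R k)) ∈ partsGraph p periodicTests 0 1 := by
  have := toY_mem_partsGraph_right (p := p) (contDiff_sep hR k) (T := periodicTests) (by
    intro φ hφ r
    have h1 := hφ r 0
    have h2 := sep_periodic R k r 0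
    rw [zero_add] at h1 h2
    rw [h1, h2])
  simp only [fderiv_sep_right hR] at this
  rwa [toY_smul (contDiff_sep hR k).continuous] at this

theorem green_basis (i : ℕ × ℤ) : green p (basis p i) = (-1 / mu p i : ℂ) • eigenFun p i := by
  rw [green, ContinuousLinearMap.comp_apply, diagOp_basis _ _ (exists_bound_div_mu fun i => by
    have := mu_ge (p := p) i; norm_num; linarith), map_smul, mulL_rad_basisFun]

theorem greenR_basis (i : ℕ × ℤ) : greenR p (basis p i) =
    (-1 / mu p i : ℂ) • toY p (sep (deriv (sinR p i.1)) i.2) := by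
  rw [greenR, add_apply, diagOp_basis _ _ (exists_bound_div_mu fun i => by
    have := mu_ge (p := p) i; norm_num; linarith), diagOp_basis _ _ (exists_bound_div_mu fun i => by
    have := abs_le_mu (p := p) i
    have := mu_pos (p := p) i
    rw [norm_neg, Complex.norm_real, Real.norm_eq_abs, abs_of_pos (nu_pos _)]; linarith),
    toY_sep_deriv_sinR, smul_add, smul_smul, smul_smul]
  congr 2 <;> ring

theorem norm_I_mul_int (k : ℤ) : ‖Complex.I * (k : ℂ)‖ = |(k : ℝ)| := by
  rw [norm_mul, Complex.norm_I, one_mul, Complex.norm_intCast]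

theorem greenP_basis (i : ℕ × ℤ) : greenP p (basis p i) =
    (-1 / mu p i : ℂ) • (Complex.I * i.2) • eigenFun p i := by
  rw [greenP, ContinuousLinearMap.comp_apply, diagOp_basis _ _ (exists_bound_div_mu fun i => by
    have := abs_le_mu (p := p) i
    have := mu_pos (p := p) i
    rw [norm_neg, norm_I_mul_int]; linarith), map_smul, mulL_rad_basisFun, smul_smul]
  congr 1; ring

theorem greenRR_basis (i : ℕ × ℤ) : greenRR p (basis p i) =
    (-1 / mu p i : ℂ) • toY p (sep (deriv (deriv (sinR p i.1))) i.2) := by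
  rw [greenRR, ContinuousLinearMap.comp_apply, diagOp_basis _ _ (exists_bound_div_mu fun i => by
    have := abs_le_mu (p := p) i
    have := mu_pos (p := p) i
    have e : ((nu p i.1 : ℂ) ^ 2 + 1 / 4) = ((nu p i.1 ^ 2 + 1 / 4 : ℝ) : ℂ) := by push_cast; ring
    rw [e, Complex.norm_real, Real.norm_eq_abs, abs_of_pos (by positivity)]; linarith), map_smul,
    toY_sep_deriv_deriv_sinR, smul_smul]
  congr 1; ring

theorem greenRP_basis (i : ℕ × ℤ) : greenRP p (basis p i) =
    (-1 / mu p i : ℂ) • (Complex.I * i.2) • toY p (sep (deriv (sinR p i.1)) i.2) := by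
  rw [greenRP, add_apply, diagOp_basis _ _ (exists_bound_div_mu fun i => by
    have := abs_le_mu (p := p) i
    have := mu_pos (p := p) i
    rw [norm_neg, norm_div, norm_I_mul_int]; norm_num; linarith),
    diagOp_basis _ _ (exists_bound_div_mu fun i => by
    have := abs_le_mu (p := p) i
    have := mu_pos (p := p) i
    rw [norm_neg, norm_mul, norm_I_mul_int, Complex.norm_real, Real.norm_eq_abs,
      abs_of_pos (nu_pos _)]; linarith),
    toY_sep_deriv_sinR, smul_add, smul_add, smul_smul, smul_smul, smul_smul, smul_smul]
  congr 2 <;> ring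

theorem greenPP_basis (i : ℕ × ℤ) : greenPP p (basis p i) =
    (-1 / mu p i : ℂ) • (Complex.I * i.2) • (Complex.I * i.2) • eigenFun p i := by
  rw [greenPP, ContinuousLinearMap.comp_apply, diagOp_basis _ _ (exists_bound_div_mu fun i => by
    have := abs_le_mu (p := p) i
    have := mu_pos (p := p) i
    rw [norm_pow, Complex.norm_intCast, sq_abs]; linarith), map_smul, mulL_rad_basisFun, smul_smul,
    smul_smul]
  congr 1
  linear_combination ((i.2 : ℂ) ^ 2 / mu p i) * Complex.I_sq

theorem green_mem_univ (f : Y p) : (green p f, greenR p f) ∈ partsGraph p univ 1 0 := by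
  refine mem_of_basis_mem (basis p) (isClosed_partsGraph _ _ _) (fun i => ?_) f
  rw [green_basis, greenR_basis]
  exact Submodule.smul_mem _ _ (sep_mem_left (contDiff_sinR _) _ fun φ _ ψ => by
    simp [sinR_rmin, sinR_rmax])

theorem green_mem_periodic (f : Y p) : (green p f, greenP p f) ∈ partsGraph p periodicTests 0 1 := by
  refine mem_of_basis_mem (basis p) (isClosed_partsGraph _ _ _) (fun i => ?_) f
  rw [green_basis, greenP_basis]
  exact Submodule.smul_mem _ _ (sep_mem_right (contDiff_sinR _) _)

/-- The r-derivative contains cosines, which do not vanish at the radii. So, unlike for `green` and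
`greenP`, the test functions must have compact support. -/
theorem greenR_mem_interior (f : Y p) :
    (greenR p f, greenRR p f) ∈ partsGraph p (interiorTests p) 1 0 := by
  refine mem_of_basis_mem (basis p) (isClosed_partsGraph _ _ _) (fun i => ?_) f
  rw [greenR_basis, greenRR_basis]
  refine Submodule.smul_mem _ _ (sep_mem_left (contDiff_deriv (contDiff_sinR _)) _ fun φ hφ ψ => ?_)
  have h0 : ∀ x, x ∉ Ω p → φ x = 0 := fun x hx => by
    by_contra hne
    exact hx (hφ.2 (subset_tsupport _ hne))
  rw [h0 _ fun h => lt_irrefl _ h.1.1, h0 _ fun h => lt_irrefl _ h.1.2]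
  simp

theorem greenR_mem_periodic (f : Y p) :
    (greenR p f, greenRP p f) ∈ partsGraph p periodicTests 0 1 := by
  refine mem_of_basis_mem (basis p) (isClosed_partsGraph _ _ _) (fun i => ?_) f
  rw [greenR_basis, greenRP_basis]
  exact Submodule.smul_mem _ _ (sep_mem_right (contDiff_deriv (contDiff_sinR _)) _)

theorem greenP_mem_univ (f : Y p) : (greenP p f, greenRP p f) ∈ partsGraph p univ 1 0 := by
  refine mem_of_basis_mem (basis p) (isClosed_partsGraph _ _ _) (fun i => ?_) f
  rw [greenP_basis, greenRP_basis]
  exact Submodule.smul_mem _ _ (Submodule.smul_mem _ (Complex.I * i.2)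
    (sep_mem_left (contDiff_sinR _) _ fun φ _ ψ => by simp [sinR_rmin, sinR_rmax]))

theorem greenP_mem_periodic (f : Y p) :
    (greenP p f, greenPP p f) ∈ partsGraph p periodicTests 0 1 := by
  refine mem_of_basis_mem (basis p) (isClosed_partsGraph _ _ _) (fun i => ?_) f
  rw [greenP_basis, greenPP_basis]
  exact Submodule.smul_mem _ _ (Submodule.smul_mem _ (Complex.I * i.2)
    (sep_mem_right (contDiff_sinR _) _))

theorem green_mem_X (f : Y p) : green p f ∈ X p := by
  refine mem_X_iff.2 ⟨?_, ⟨_, green_mem_univ f⟩, _, _, green_mem_periodic f, greenP_mem_periodic f⟩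
  have h1 : ∀ {v vr vp : Y p}, (v, vr) ∈ partsGraph p (interiorTests p) 1 0 →
      (v, vp) ∈ partsGraph p (interiorTests p) 0 1 → v ∈ H p 1 := fun h1 h2 =>
    mem_H_succ_iff.2 ⟨_, _, h1, h2, mem_H_zero _, mem_H_zero _⟩
  exact mem_H_succ_iff.2 ⟨_, _, partsGraph_univ_le _ _ (green_mem_univ f),
    partsGraph_periodic_le _ _ (green_mem_periodic f),
    h1 (greenR_mem_interior f) (partsGraph_periodic_le _ _ (greenR_mem_periodic f)),
    h1 (partsGraph_univ_le _ _ (greenP_mem_univ f))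
      (partsGraph_periodic_le _ _ (greenP_mem_periodic f))⟩

/-- This is the equation Δ̃u = f/r. On a basis vector it reads (ν² + 1/4 + 4k²)/μ = 1. -/
theorem greenRR_add_greenPP (f : Y p) :
    greenRR p f + (4 : ℂ) • mulL p (radInv p) (mulL p (radInv p) (greenPP p f)) =
      mulL p (radInv p) f := by
  have : greenRR p + (4 : ℂ) • (mulL p (radInv p) ∘L mulL p (radInv p) ∘L greenPP p) =
      mulL p (radInv p) := by
    refine clm_ext_basis (basis p) fun i => ?_
    simp only [add_apply, smul_apply, ContinuousLinearMap.comp_apply]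
    rw [greenRR_basis, greenPP_basis, toY_sep_deriv_deriv_sinR, ← mulL_rad_basisFun, basis_apply]
    simp only [map_smul, mulL_radInv_rad]
    rw [smul_smul, smul_smul, smul_smul, smul_smul, ← add_smul]
    have h0 := mu_ne_zero (p := p) i
    have e : (mu p i : ℂ) = (nu p i.1 : ℂ) ^ 2 + 1 / 4 + 4 * (i.2 : ℂ) ^ 2 := by
      simp [mu]
    have h1 : (-1 / mu p i : ℂ) * -((nu p i.1 : ℂ) ^ 2 + 1 / 4) +
        4 * (-1 / mu p i * (Complex.I * i.2) * (Complex.I * i.2)) = 1 := by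
      field_simp
      rw [e]
      linear_combination (-16 * (i.2 : ℂ) ^ 2) * Complex.I_sq
    refine Eq.trans (congrArg (· • mulL p (radInv p) (basisFun p i)) (Eq.trans ?_ h1)) (one_smul ℂ _)
    ring
  exact DFunLike.congr_fun this f

theorem inner_basis_radInv_green (i : ℕ × ℤ) (f : Y p) :
    inner ℂ (basis p i) (mulL p (radInv p) (green p f)) =
      (-1 / mu p i : ℂ) * inner ℂ (basis p i) f := by
  rw [green, ContinuousLinearMap.comp_apply, mulL_radInv_rad]
  have : ∀ h : Orthonormal ℂ (basisFun p),
      diagOp (basis p) h (fun i => (-1 : ℂ) / mu p i) =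
        diagOp (basis p) (basis p).orthonormal fun i => (-1 : ℂ) / mu p i := fun h => by
    congr 1
    exact funext fun i => (basis_apply i).symm
  rw [this, inner_basis_diagOp _ (exists_bound_div_mu fun i => by
    have := mu_ge (p := p) i; norm_num; linarith)]

/-- The basis coefficients of u/r are computed by integrating by parts twice in each variable. All
boundary terms drop because of the conditions in X, so they agree with those of green(rΔ̃u)/r. -/
theorem exists_eq_green {u : Y p} (hu : u ∈ X p) : ∃ f, u = green p f := by
  obtain ⟨h2, ⟨v, hv⟩, w, z, hw, hz⟩ := mem_X_iff.1 hu
  obtain ⟨q, hq⟩ := mem_H_iff.1 h2 2 0 le_rfl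
  have hvq : (v, q) ∈ partsGraph p (interiorTests p) 1 0 :=
    partsGraph_of_comp stableTests_interior (partsGraph_univ_le _ _ hv) hq
  -- This is r Δ̃u = r u_rr + (4/r) u_ψψ.
  refine ⟨mulL p (rad p) q + (4 : ℂ) • mulL p (radInv p) z, ?_⟩
  rw [← mulL_rad_radInv u, ← mulL_rad_radInv (green p _)]
  congr 1
  refine ext_inner_basis (basis p) fun i => ?_
  rw [inner_basis_radInv_green, basis_apply, inner_add_right, inner_smul_right, ← inner_mulL,
    ← inner_mulL, ← inner_mulL, mulL_rad_basisFun]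
  have hc := contDiff_sinR (p := p) i.1
  have hb := contDiff_div_rho (p := p) hc
  have hbb := contDiff_div_rho (p := p) hb
  have e1 : mulL p (radInv p) (basisFun p i) =
      toY p (sep (fun r => sinR p i.1 r / rho p r / rho p r) i.2) :=
    mulL_toY continuous_radInv (contDiff_sep hb _).continuous (contDiff_sep hbb _).continuous
      fun x _ => by
        have := rho_ne_zero (p := p) x.1
        simp only [sep, radInv]
        push_cast
        field_simp
  -- The first integration by parts uses that the sine vanishes at the radii, since u_r has no
  -- boundary condition; the second uses that u vanishes there, since the derivative of the
  -- eigenfunction does not.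
  have e2 : inner ℂ (eigenFun p i) q =
      -((nu p i.1 : ℂ) ^ 2 + 1 / 4) * inner ℂ (mulL p (radInv p) (basisFun p i)) u := by
    have a1 := inner_sep_deriv_of_vanishing hvq hc (sinR_rmin _) (sinR_rmax _) i.2
    have a2 := inner_sep_deriv hv (contDiff_deriv hc) i.2
    rw [toY_sep_deriv_deriv_sinR, inner_smul_left, a1, neg_neg] at a2
    rw [eigenFun, ← a2]
    simp [map_ofNat]
  have e3 : inner ℂ (mulL p (radInv p) (basisFun p i)) z =
      -(i.2 : ℂ) ^ 2 * inner ℂ (mulL p (radInv p) (basisFun p i)) u := by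
    rw [e1, inner_sep_psi hz hbb, inner_sep_psi hw hbb]
    linear_combination ((i.2 : ℂ) ^ 2 *
      inner ℂ (toY p (sep (fun r => sinR p i.1 r / rho p r / rho p r) i.2)) u) * Complex.I_sq
  rw [e2, e3]
  have h0 := mu_ne_zero (p := p) i
  have e : (mu p i : ℂ) = (nu p i.1 : ℂ) ^ 2 + 1 / 4 + 4 * (i.2 : ℂ) ^ 2 := by
    simp [mu]
  field_simp
  rw [e]
  ring

end Green

/-! ### Periodic H¹ functions and their gradients -/

section Gradients

variable {p : Params}

/-- `w ∈ H¹(Ω)` is periodic in `ψ`, and `(wr, wψ)` is its weak gradient. -/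
structure HasGrad (w wr wψ : Y p) : Prop where
  left : (w, wr) ∈ partsGraph p (interiorTests p) 1 0
  right : (w, wψ) ∈ partsGraph p periodicTests 0 1

theorem HasGrad.interior {w wr wψ : Y p} (h : HasGrad w wr wψ) :
    (w, wψ) ∈ partsGraph p (interiorTests p) 0 1 := partsGraph_periodic_le 0 1 h.right

theorem HasGrad.add {w wr wψ v vr vψ : Y p} (h1 : HasGrad w wr wψ) (h2 : HasGrad v vr vψ) :
    HasGrad (w + v) (wr + vr) (wψ + vψ) :=
  ⟨Submodule.add_mem _ h1.left h2.left, Submodule.add_mem _ h1.right h2.right⟩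

theorem HasGrad.sub {w wr wψ v vr vψ : Y p} (h1 : HasGrad w wr wψ) (h2 : HasGrad v vr vψ) :
    HasGrad (w - v) (wr - vr) (wψ - vψ) :=
  ⟨Submodule.sub_mem _ h1.left h2.left, Submodule.sub_mem _ h1.right h2.right⟩

theorem HasGrad.smul {w wr wψ : Y p} (c : ℂ) (h : HasGrad w wr wψ) :
    HasGrad (c • w) (c • wr) (c • wψ) :=
  ⟨Submodule.smul_mem _ c h.left, Submodule.smul_mem _ c h.right⟩

theorem HasGrad.mulL {w wr wψ : Y p} {c : ℝ × ℝ → ℝ} (hc : ContDiff ℝ ∞ c)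
    (hp : c ∈ periodicTests) (h : HasGrad w wr wψ) :
    HasGrad (mulL p c w) (mulL p c wr + mulL p (dr c) w) (mulL p c wψ + mulL p (dpsi c) w) :=
  ⟨(partsGraph_leibniz hc fun _ hφ => mul_mem_interior hφ).1 h.left,
    (partsGraph_leibniz hc fun _ hφ => mul_mem_periodic hp hφ).2 h.right⟩

theorem HasGrad.mem_H_succ {w wr wψ : Y p} (h : HasGrad w wr wψ) {k : ℕ} (h1 : wr ∈ H p k)
    (h2 : wψ ∈ H p k) : w ∈ H p (k + 1) :=
  mem_H_succ_iff.2 ⟨wr, wψ, h.left, h.interior, h1, h2⟩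

theorem HasGrad.mem_H_one {w wr wψ : Y p} (h : HasGrad w wr wψ) : w ∈ H p 1 :=
  h.mem_H_succ (mem_H_zero _) (mem_H_zero _)

theorem mem_H_of_left {u v : Y p} {k : ℕ} (hu : u ∈ H p (k + 1))
    (h : (u, v) ∈ partsGraph p (interiorTests p) 1 0) : v ∈ H p k := by
  obtain ⟨v', w, hv, -, hv', -⟩ := mem_H_succ_iff.1 hu
  rwa [partsGraph_interior_unique h hv]

theorem mem_H_of_right {u v : Y p} {k : ℕ} (hu : u ∈ H p (k + 1))
    (h : (u, v) ∈ partsGraph p (interiorTests p) 0 1) : v ∈ H p k := by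
  obtain ⟨v', w, -, hw, -, hw'⟩ := mem_H_succ_iff.1 hu
  rwa [partsGraph_interior_unique h hw]

end Gradients

/-! ### Smooth coefficients; V and Δ̃ on explicit functions -/

section Coefficients

variable (p : Params)

/-- The coefficient `f`, extended smoothly. -/
def coefF (x : ℝ × ℝ) : ℝ := f p (rad p x, x.2)

/-- The coefficient `g`, extended smoothly. -/
def coefG (x : ℝ × ℝ) : ℝ := g p (rad p x, x.2)

/-- The coefficient `h`, extended smoothly. -/
def coefH (x : ℝ × ℝ) : ℝ := h p (rad p x, x.2)

theorem coefF_mem : coefF p ∈ periodicTests := fun _ _ => rfl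

theorem coefG_mem : coefG p ∈ periodicTests := fun r ψ => by simp [coefG, g, rad]

variable {p} [hp : p.Admissible]

theorem contDiff_coefF : ContDiff ℝ ∞ (coefF p) := by
  have h1 := contDiff_rad (p := p)
  have h2 : ∀ x, 2 * rad p x ≠ 0 := fun x => mul_ne_zero two_ne_zero (rho_ne_zero x.1)
  exact ((contDiff_const.mul h1).sub (contDiff_const.mul (h1.pow 3))).add
    (contDiff_const.div (contDiff_const.mul h1) h2)

theorem contDiff_coefG : ContDiff ℝ ∞ (coefG p) := by
  have h1 := contDiff_rad (p := p)
  exact (contDiff_const.mul (h1.pow 2)).mul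
    (contDiff_const.add (contDiff_const.mul contDiff_snd.cos))

theorem contDiff_coefH : ContDiff ℝ ∞ (coefH p) := by
  have h1 := contDiff_rad (p := p)
  have h2 : ∀ x, 2 * rad p x ^ 2 ≠ 0 := fun x =>
    mul_ne_zero two_ne_zero (pow_ne_zero 2 (rho_ne_zero x.1))
  exact ((contDiff_const.sub (contDiff_const.mul (h1.pow 2))).sub
    (contDiff_const.div (contDiff_const.mul (h1.pow 2)) h2)).sub
    (((contDiff_const.mul (h1.pow 2)).mul contDiff_const).mul contDiff_snd.sin)

theorem coef_eq {x : ℝ × ℝ} (hx : x ∈ Ω p) :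
    f p x = coefF p x ∧ g p x = coefG p x ∧ h p x = coefH p x := by
  simp only [coefF, coefG, coefH, rad_eq hx, and_self]

theorem dr_coefF_add_dpsi_coefG {x : ℝ × ℝ} (hx : x ∈ Ω p) :
    dr (coefF p) x + dpsi (coefG p) x = coefH p x := by
  have hr : p.rmin < x.1 := hx.1.1
  have h0 : x.1 ≠ 0 := (hp.rmin_pos.trans hr).ne'
  have e1 : dr (coefF p) x = p.α - 3 * p.a * x.1 ^ 2 - p.σ ^ 2 / (2 * x.1 ^ 2) := by
    refine (hasDerivAt_slice_left (contDiff_coefF.differentiable (by simp)) x.1 x.2).unique ?_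
    have h1 : HasDerivAt (fun t : ℝ => p.α * t - p.a * t ^ 3 + p.σ ^ 2 / (2 * t))
        (p.α - 3 * p.a * x.1 ^ 2 - p.σ ^ 2 / (2 * x.1 ^ 2)) x.1 := by
      have a1 := ((hasDerivAt_id x.1).const_mul p.α).sub ((hasDerivAt_pow 3 x.1).const_mul p.a)
      have a2 := ((hasDerivAt_id x.1).const_mul 2).inv (by simpa using h0)
      refine ((a1.add (a2.const_mul (p.σ ^ 2))).congr_deriv ?_).congr_of_eventuallyEq ?_
      · simp only [id]
        field_simp
        norm_num
        ring
      · exact Eventually.of_forall fun t => by simp [div_eq_mul_inv]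
    refine h1.congr_of_eventuallyEq ?_
    filter_upwards [rho_eventuallyEq hr] with t ht
    simp only [coefF, f, rad, ht]
  have e2 : dpsi (coefG p) x =
      -(2 * x.1 ^ 2 * Real.sqrt (p.a ^ 2 + p.b ^ 2) * Real.sin x.2) := by
    refine (hasDerivAt_slice_right (contDiff_coefG.differentiable (by simp)) x.1 x.2).unique ?_
    have h1 := (((Real.hasDerivAt_cos x.2).const_mul (Real.sqrt (p.a ^ 2 + p.b ^ 2))).const_add
      p.b).const_mul (2 * x.1 ^ 2)
    refine (h1.congr_deriv (by ring)).congr_of_eventuallyEq (Eventually.of_forall fun t => ?_)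
    simp only [coefG, g, rad, rho_eq hr.le]
  rw [e1, e2, coefH, rad_eq hx, h]
  ring

theorem maps_mult {c d : ℝ × ℝ → ℝ} (hd : Continuous d) (hcd : ∀ x ∈ Ω p, c x = d x) (u : Y p) :
    Maps (mult p c) u (mulL p d u) := by
  have hu : u ∈ (mult p c).domain := by
    refine (memLp_congr_ae ?_).1 (mem_mult_domain_of_continuous hd u)
    filter_upwards [ae_mem_Ω p] with x hx
    rw [hcd x hx]
  refine ⟨hu, Y_ext ?_⟩
  filter_upwards [coeFn_mult ⟨u, hu⟩, coeFn_mulL hd u] with x h1 h2 hx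
  rw [h1, h2, hcd x hx, Complex.real_smul]

/-- `V w = f ∂_r w + g ∂_ψ w`, in terms of the gradient of `w`. -/
def transport (wr wψ : Y p) : Y p := mulL p (coefF p) wr + mulL p (coefG p) wψ

theorem maps_V {w wr wψ : Y p} (h1 : (w, wr) ∈ partsGraph p (interiorTests p) 1 0)
    (h2 : (w, wψ) ∈ partsGraph p (interiorTests p) 0 1) : Maps (V p) w (transport wr wψ) :=
  (maps_compose_iff.2 ⟨_, maps_weakDeriv_iff.2 h1,
      maps_mult contDiff_coefF.continuous (fun _ hx => (coef_eq hx).1) _⟩).add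
    (maps_compose_iff.2 ⟨_, maps_weakDeriv_iff.2 h2,
      maps_mult contDiff_coefG.continuous (fun _ hx => (coef_eq hx).2.1) _⟩)

theorem maps_lap {w wrr wψψ : Y p} (h1 : (w, wrr) ∈ partsGraph p (interiorTests p) 2 0)
    (h2 : (w, wψψ) ∈ partsGraph p (interiorTests p) 0 2) :
    Maps (lap p) w (wrr + (4 : ℂ) • mulL p (radInv p) (mulL p (radInv p) wψψ)) := by
  refine (maps_weakDeriv_iff.2 h1).add (maps_compose_iff.2 ⟨_, maps_weakDeriv_iff.2 h2, ?_⟩)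
  have hc : Continuous fun x => 4 * (radInv p x * radInv p x) :=
    continuous_const.mul (continuous_radInv.mul continuous_radInv)
  have e : (4 : ℂ) • mulL p (radInv p) (mulL p (radInv p) wψψ) =
      mulL p (fun x => 4 * (radInv p x * radInv p x)) wψψ := by
    rw [mulL_mulL (e := fun x => radInv p x * radInv p x) continuous_radInv continuous_radInv
      (continuous_radInv.mul continuous_radInv) fun _ _ => rfl]
    have := mulL_const (p := p) (a := 4) (mulL p (fun x => radInv p x * radInv p x) wψψ)
    push_cast at this
    rw [← this]
    exact mulL_mulL continuous_const (continuous_radInv.mul continuous_radInv) hc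
      (fun _ _ => rfl) wψψ
  rw [e]
  refine maps_mult hc (fun x hx => ?_) wψψ
  have h0 : x.1 ≠ 0 := (hp.rmin_pos.trans hx.1.1).ne'
  have : radInv p x = x.1⁻¹ := by rw [← rad_eq hx]; rfl
  rw [this]
  field_simp

theorem exists_maps_lap {w : Y p} (hw : w ∈ H p 2) : ∃ y, Maps (lap p) w y := by
  obtain ⟨a, ha⟩ := mem_H_iff.1 hw 2 0 le_rfl
  obtain ⟨b, hb⟩ := mem_H_iff.1 hw 0 2 le_rfl
  exact ⟨_, maps_lap ha hb⟩

/-- `V` applied to the solution operator. -/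
def greenV (p : Params) [p.Admissible] : Y p →L[ℂ] Y p :=
  mulL p (coefF p) ∘L greenR p + mulL p (coefG p) ∘L greenP p

theorem greenV_apply (φ : Y p) : greenV p φ = transport (greenR p φ) (greenP p φ) := rfl

theorem hasGrad_green (φ : Y p) : HasGrad (green p φ) (greenR p φ) (greenP p φ) :=
  ⟨partsGraph_univ_le _ _ (green_mem_univ φ), green_mem_periodic φ⟩

theorem hasGrad_greenR (φ : Y p) : HasGrad (greenR p φ) (greenRR p φ) (greenRP p φ) :=
  ⟨greenR_mem_interior φ, greenR_mem_periodic φ⟩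

theorem hasGrad_greenP (φ : Y p) : HasGrad (greenP p φ) (greenRP p φ) (greenPP p φ) :=
  ⟨partsGraph_univ_le _ _ (greenP_mem_univ φ), greenP_mem_periodic φ⟩

theorem exists_hasGrad_greenV (φ : Y p) : ∃ a b, HasGrad (greenV p φ) a b :=
  ⟨_, _, ((hasGrad_greenR φ).mulL contDiff_coefF (coefF_mem p)).add
    ((hasGrad_greenP φ).mulL contDiff_coefG (coefG_mem p))⟩

theorem maps_lap_green (φ : Y p) : Maps (lap p) (green p φ) (mulL p (radInv p) φ) := by
  rw [← greenRR_add_greenPP]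
  exact maps_lap (partsGraph_comp stableTests_interior (hasGrad_green φ).left (hasGrad_greenR φ).left)
    (partsGraph_comp stableTests_interior (hasGrad_green φ).interior (hasGrad_greenP φ).interior)

theorem maps_V_green (φ : Y p) : Maps (V p) (green p φ) (greenV p φ) :=
  maps_V (hasGrad_green φ).left (hasGrad_green φ).interior

end Coefficients

/-! ### Green's formulas for the solution operator -/

section IntegrationByParts

variable {p : Params} [hp : p.Admissible]

/-- Solutions vanish at both radii, so w needs no boundary condition in r. By continuity it is
enough to take φ in the basis. -/
theorem inner_green_left {w wr : Y p} (h : (w, wr) ∈ partsGraph p (interiorTests p) 1 0) (φ : Y p) :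
    inner ℂ wr (green p φ) = -inner ℂ w (greenR p φ) := by
  have : innerSL ℂ wr ∘L green p = -(innerSL ℂ w ∘L greenR p) := by
    refine clm_ext_basis (basis p) fun i => ?_
    have := inner_sep_deriv_of_vanishing h (contDiff_sinR (p := p) i.1) (sinR_rmin _) (sinR_rmax _) i.2
    simp only [neg_apply, ContinuousLinearMap.comp_apply, green_basis,
      greenR_basis, innerSL_apply_apply, inner_smul_right, eigenFun]
    rw [← inner_conj_symm w, this, map_neg, inner_conj_symm]
    ring
  exact DFunLike.congr_fun this φ

theorem inner_green_right {w wψ : Y p} (h : (w, wψ) ∈ partsGraph p periodicTests 0 1) (φ : Y p) :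
    inner ℂ wψ (green p φ) = -inner ℂ w (greenP p φ) := by
  have : innerSL ℂ wψ ∘L green p = -(innerSL ℂ w ∘L greenP p) := by
    refine clm_ext_basis (basis p) fun i => ?_
    have := inner_sep_psi h (contDiff_sinR (p := p) i.1) i.2
    simp only [neg_apply, ContinuousLinearMap.comp_apply, green_basis,
      greenP_basis, innerSL_apply_apply, inner_smul_right, eigenFun]
    rw [← inner_conj_symm wψ, this, map_mul, inner_conj_symm]
    simp only [map_mul, Complex.conj_I, map_intCast]
    ring
  exact DFunLike.congr_fun this φ

theorem inner_greenR_left {w wr : Y p} (h : (w, wr) ∈ partsGraph p univ 1 0) (φ : Y p) :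
    inner ℂ wr (greenR p φ) = -inner ℂ w (greenRR p φ) := by
  have : innerSL ℂ wr ∘L greenR p = -(innerSL ℂ w ∘L greenRR p) := by
    refine clm_ext_basis (basis p) fun i => ?_
    have := inner_sep_deriv h (contDiff_deriv (contDiff_sinR (p := p) i.1)) i.2
    simp only [neg_apply, ContinuousLinearMap.comp_apply, greenRR_basis,
      greenR_basis, innerSL_apply_apply, inner_smul_right]
    rw [← inner_conj_symm w, this, map_neg, inner_conj_symm]
    ring
  exact DFunLike.congr_fun this φ

theorem inner_greenP_right {w wψ : Y p} (h : (w, wψ) ∈ partsGraph p periodicTests 0 1) (φ : Y p) :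
    inner ℂ wψ (greenP p φ) = -inner ℂ w (greenPP p φ) := by
  have : innerSL ℂ wψ ∘L greenP p = -(innerSL ℂ w ∘L greenPP p) := by
    refine clm_ext_basis (basis p) fun i => ?_
    have := inner_sep_psi h (contDiff_sinR (p := p) i.1) i.2
    simp only [neg_apply, ContinuousLinearMap.comp_apply, greenPP_basis,
      greenP_basis, innerSL_apply_apply, inner_smul_right, eigenFun]
    rw [← inner_conj_symm wψ, this, map_mul, inner_conj_symm]
    simp only [map_mul, Complex.conj_I, map_intCast]
    ring
  exact DFunLike.congr_fun this φ

/-- The formal adjoint of `V` is `-V - h`. -/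
theorem inner_greenV {w wr wψ : Y p} (hw : HasGrad w wr wψ) (φ : Y p) :
    inner ℂ w (greenV p φ) =
      -inner ℂ (transport wr wψ + mulL p (coefH p) w) (green p φ) := by
  have h1 := inner_green_left (hw.mulL contDiff_coefF (coefF_mem p)).left φ
  have h2 := inner_green_right (hw.mulL contDiff_coefG (coefG_mem p)).right φ
  have h3 := mulL_add (contDiff_dr contDiff_coefF).continuous
    (contDiff_dpsi contDiff_coefG).continuous (contDiff_coefH (p := p)).continuous
    (fun x hx => dr_coefF_add_dpsi_coefG hx) w
  rw [greenV_apply, transport, inner_add_right, ← inner_mulL, ← inner_mulL, ← h3, transport,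
    ← neg_eq_iff_eq_neg.2 h1, ← neg_eq_iff_eq_neg.2 h2]
  simp only [inner_add_left]
  ring

/-- Green's formula: the operator `Δ̃` is symmetric. -/
theorem inner_radInv_green (φ χ : Y p) :
    inner ℂ (mulL p (radInv p) φ) (green p χ) = inner ℂ (green p φ) (mulL p (radInv p) χ) := by
  have h2 : innerSL ℂ φ ∘L (mulL p (radInv p) ∘L green p) =
      innerSL ℂ (mulL p (radInv p) (green p φ)) := by
    refine clm_ext_basis (basis p) fun i => ?_
    have h3 := inner_basis_radInv_green i φ
    simp only [ContinuousLinearMap.comp_apply, innerSL_apply_apply, green_basis]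
    rw [map_smul, ← mulL_rad_basisFun, mulL_radInv_rad, inner_smul_right, ← basis_apply,
      ← inner_conj_symm (mulL p (radInv p) (green p φ)), h3, map_mul, inner_conj_symm]
    simp
  exact (inner_mulL _ _ _).trans ((DFunLike.congr_fun h2 χ).trans (inner_mulL _ _ _))

theorem radInv_mem_periodic : radInv p ∈ periodicTests := fun _ _ => rfl

theorem dpsi_radInv : dpsi (radInv p) = fun _ => 0 := by
  funext x
  have h1 : HasDerivAt (fun t => radInv p (x.1, t)) (fderiv ℝ (radInv p) x (0, 1)) x.2 :=
    hasDerivAt_slice_right (contDiff_radInv.differentiable (by simp)) _ _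
  exact h1.unique (hasDerivAt_const x.2 (radInv p x))

theorem mulL_zero_fun (u : Y p) : mulL p (fun _ => 0) u = 0 := by
  rw [mulL_const]; simp

theorem radInv_right {w wψ : Y p} (h : (w, wψ) ∈ partsGraph p periodicTests 0 1) :
    (mulL p (radInv p) w, mulL p (radInv p) wψ) ∈ partsGraph p periodicTests 0 1 := by
  have := (partsGraph_leibniz (contDiff_radInv (p := p)) fun _ hφ => mul_mem_periodic radInv_mem_periodic hφ).2 h
  rwa [dpsi_radInv, mulL_zero_fun, add_zero] at this

/-- The Dirichlet form of `-Δ̃`. -/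
theorem dirichlet (φ χ : Y p) :
    inner ℂ (greenR p φ) (greenR p χ) + 4 * inner ℂ (mulL p (radInv p) (greenP p φ))
      (mulL p (radInv p) (greenP p χ)) = -inner ℂ (green p φ) (mulL p (radInv p) χ) := by
  have h1 := inner_greenR_left (green_mem_univ φ) χ
  have h2 := inner_greenP_right (radInv_right (radInv_right (green_mem_periodic φ))) χ
  have h3 := inner_mulL (radInv p) (mulL p (radInv p) (greenP p φ)) (greenP p χ)
  have h4 := inner_mulL (radInv p) (mulL p (radInv p) (green p φ)) (greenPP p χ)
  have h5 := inner_mulL (radInv p) (green p φ) (mulL p (radInv p) (greenPP p χ))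
  rw [← greenRR_add_greenPP χ, inner_add_right, inner_smul_right, ← h5, ← h4, h1, ← h3, h2]
  ring

/-- The range of `green` contains r times every basis vector. -/
theorem eq_zero_of_inner_green {x : Y p} (h : ∀ φ, inner ℂ (green p φ) x = 0) : x = 0 := by
  have h1 : mulL p (rad p) x = 0 := by
    refine ext_inner_basis (basis p) fun i => ?_
    have := h (basis p i)
    rw [green_basis, inner_smul_left, ← mulL_rad_basisFun, inner_mulL, ← basis_apply] at this
    rw [inner_zero_right]
    refine (mul_eq_zero.1 this).resolve_left ?_
    exact (map_ne_zero _).2 (div_ne_zero (by norm_num) (mu_ne_zero i))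
  rw [← mulL_radInv_rad x, h1, map_zero]

end IntegrationByParts

/-! ### Solvability with a large zero order term, and very weak solutions -/

section Resolvent

variable {p : Params} [hp : p.Admissible]

variable (p) in
/-- The operator that is diagonal with entries `μ / (μ + m)`. -/
def resFactor (m : ℝ) : Y p →L[ℂ] Y p :=
  diagOp (basis p) orthonormal_basisFun fun i => (mu p i / (mu p i + m) : ℂ)

theorem resFactor_bound {m : ℝ} (hm : 0 ≤ m) :
    ∃ C, ∀ i, ‖(mu p i / (mu p i + m) : ℂ)‖ ≤ C := by
  refine ⟨1, fun i => ?_⟩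
  have h0 := mu_pos (p := p) i
  rw [← Complex.ofReal_add, ← Complex.ofReal_div, Complex.norm_real, Real.norm_eq_abs,
    abs_of_nonneg (by positivity), div_le_one (by positivity)]
  linarith

theorem resFactor_basis {m : ℝ} (hm : 0 ≤ m) (i : ℕ × ℤ) :
    resFactor p m (basis p i) = (mu p i / (mu p i + m) : ℂ) • basis p i := by
  rw [resFactor, diagOp_basis _ _ (resFactor_bound hm), basis_apply]

/-- Each of the three summands that bound x is some t with t² ≤ μ, and t ≤ εt² + 1/ε ≤ ε(μ + m) once
m ≥ 1/ε². This accounts for the factor 3. -/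
theorem norm_diagOp_comp_resFactor_le {v : ℕ × ℤ → Y p} (hv : Orthonormal ℂ v) {x : ℕ × ℤ → ℂ}
    (hb : ∃ C, ∀ i, ‖x i / mu p i‖ ≤ C)
    (hx : ∀ i, ‖x i‖ ≤ 1 / 2 + nu p i.1 + |(i.2 : ℝ)|) {ε m : ℝ} (hε : 0 < ε)
    (hm : 1 / ε ^ 2 ≤ m) :
    ‖diagOp (basis p) hv (fun i => x i / mu p i) ∘L resFactor p m‖ ≤ 3 * ε := by
  have hm0 : 0 < m := lt_of_lt_of_le (by positivity) hm
  have hle : ∀ i, ‖x i / (mu p i + m : ℝ)‖ ≤ 3 * ε := fun i => by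
    have h0 := mu_pos (p := p) i
    rw [norm_div, Complex.norm_real, Real.norm_eq_abs, abs_of_pos (by positivity),
      div_le_iff₀ (by positivity)]
    refine (hx i).trans ?_
    have key : ∀ t : ℝ, 0 ≤ t → t ^ 2 ≤ mu p i → t ≤ ε * (mu p i + m) := by
      intro t ht h
      have h1 : ε * (1 / ε ^ 2) = 1 / ε := by field_simp
      have h2 : ε * (1 / ε ^ 2) ≤ ε * m := by gcongr
      have h3 : t ≤ ε * t ^ 2 + 1 / ε := by
        have h4 : (0 : ℝ) ≤ (ε * t - 1) ^ 2 / ε := by positivity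
        have h5 : (ε * t - 1) ^ 2 / ε = ε * t ^ 2 - 2 * t + 1 / ε := by field_simp; ring
        linarith
      nlinarith
    have k1 := key (1 / 2) (by norm_num) (by have := mu_ge (p := p) i; norm_num at this ⊢; linarith)
    have k2 := key (nu p i.1) (nu_pos _).le (by unfold mu; nlinarith [sq_nonneg (i.2 : ℝ)])
    have k3 := key |(i.2 : ℝ)| (abs_nonneg _) (by
      rw [sq_abs]; unfold mu; nlinarith [sq_nonneg (i.2 : ℝ), sq_nonneg (nu p i.1)])
    linarith
  have e : diagOp (basis p) hv (fun i => x i / mu p i) ∘L resFactor p m =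
      diagOp (basis p) hv fun i => x i / (mu p i + m : ℝ) := by
    refine clm_ext_basis (basis p) fun i => ?_
    have h0 := mu_ne_zero (p := p) i
    rw [ContinuousLinearMap.comp_apply, resFactor_basis hm0.le, map_smul, diagOp_basis _ _ hb,
      diagOp_basis _ _ ⟨_, hle⟩, smul_smul]
    congr 1
    push_cast
    field_simp
  rw [e]
  exact norm_diagOp_le _ _ hle (by positivity)

/-- Since μ/(μ + m) · (1 + m/μ) = 1, the factor inverts 1 - m r⁻¹ green. In terms of u =
green(resFactor φ) this reads Δ̃u - m u/r² = φ/r. -/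
theorem sub_green_resFactor {m : ℝ} (hm : 0 ≤ m) (φ : Y p) :
    resFactor p m φ - (m : ℂ) • mulL p (radInv p) (green p (resFactor p m φ)) = φ := by
  have : resFactor p m - (m : ℂ) • (mulL p (radInv p) ∘L green p ∘L resFactor p m) =
      ContinuousLinearMap.id ℂ _ := by
    refine clm_ext_basis (basis p) fun i => ?_
    simp only [sub_apply, smul_apply, ContinuousLinearMap.comp_apply, resFactor_basis hm, map_smul,
      green_basis, ContinuousLinearMap.id_apply]
    rw [← mulL_rad_basisFun, mulL_radInv_rad, ← basis_apply, smul_smul, smul_smul, ← sub_smul]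
    have h0 := mu_pos (p := p) i
    have h1 := mu_ne_zero (p := p) i
    have h2 : (mu p i + m : ℂ) ≠ 0 := by exact_mod_cast (by positivity : mu p i + m ≠ 0)
    refine Eq.trans (congrArg (· • basis p i) ?_) (one_smul ℂ _)
    field_simp
    ring
  exact DFunLike.congr_fun this φ

/-- Derivatives of order at most one are of lower order than Δ̃ - m/r², so their composition with
its solution operator tends to zero as m grows. -/
theorem exists_small (ε : ℝ) (hε : 0 < ε) : ∃ m0 : ℝ, 0 ≤ m0 ∧ ∀ m ≥ m0,
    ‖green p ∘L resFactor p m‖ ≤ ε ∧ ‖greenR p ∘L resFactor p m‖ ≤ ε ∧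
      ‖greenP p ∘L resFactor p m‖ ≤ ε := by
  set C := 6 * (1 + ‖mulL p (rad p)‖) with hC
  have hC0 : 0 < C := by positivity
  set δ := ε / C with hδ
  have hδ0 : 0 < δ := by positivity
  refine ⟨1 / δ ^ 2, by positivity, fun m hm => ?_⟩
  have hk : ∀ i : ℕ × ℤ, 0 ≤ nu p i.1 ∧ 0 ≤ |(i.2 : ℝ)| := fun i => ⟨(nu_pos (p := p) _).le, abs_nonneg _⟩
  have hb : ∃ C, ∀ i, ‖(-1 / 2 : ℂ) / mu p i‖ ≤ C := exists_bound_div_mu (p := p) (x := fun _ => -1 / 2) fun i => by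
    have := mu_ge (p := p) i; norm_num; linarith
  have d1 := norm_diagOp_comp_resFactor_le (p := p) (m := m) orthonormal_basisFun (x := fun _ => -1 / 2)
    hb (fun i => by
      have := hk i; norm_num; linarith) hδ0 hm
  -- The numerator 1 need not satisfy the bound required of x, so it is split into two halves; hence
  -- the 6 = 2 · 3 in the constant.
  have d1' : ‖diagOp (basis p) (orthonormal_basisFun (p := p)) (fun i => ((-1 : ℂ) / mu p i)) ∘L
      resFactor p m‖ ≤ 2 * (3 * δ) := by
    have e : diagOp (basis p) (orthonormal_basisFun (p := p)) (fun i => ((-1 : ℂ) / mu p i)) =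
        diagOp (basis p) (orthonormal_basisFun (p := p)) (fun i => ((-1 / 2 : ℂ) / mu p i)) +
        diagOp (basis p) (orthonormal_basisFun (p := p)) (fun i => ((-1 / 2 : ℂ) / mu p i)) := by
      rw [← diagOp_add _ _ hb hb]
      congr 1; funext i; ring
    rw [e, ContinuousLinearMap.add_comp]
    exact (norm_add_le _ _).trans (by linarith)
  have d2 := norm_diagOp_comp_resFactor_le (p := p) (m := m) orthonormal_cobasisFun
    (x := fun i => -(nu p i.1 : ℂ))
    (exists_bound_div_mu fun i => by
      have := abs_le_mu (p := p) i
      have := mu_pos (p := p) i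
      rw [norm_neg, Complex.norm_real, Real.norm_eq_abs, abs_of_pos (nu_pos _)]; linarith)
    (fun i => by
      have := hk i
      rw [norm_neg, Complex.norm_real, Real.norm_eq_abs, abs_of_pos (nu_pos _)]; linarith) hδ0 hm
  have d3 := norm_diagOp_comp_resFactor_le (p := p) (m := m) orthonormal_basisFun
    (x := fun i => -(Complex.I * i.2))
    (exists_bound_div_mu fun i => by
      have := abs_le_mu (p := p) i
      have := mu_pos (p := p) i
      rw [norm_neg, norm_I_mul_int]; linarith)
    (fun i => by
      have := hk i
      rw [norm_neg, norm_I_mul_int]; linarith) hδ0 hm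
  have hεδ : ε = 6 * (1 + ‖mulL p (rad p)‖) * δ := by rw [hδ, ← hC]; field_simp
  have hr := norm_nonneg (mulL p (rad p))
  refine ⟨?_, ?_, ?_⟩
  · rw [green, ContinuousLinearMap.comp_assoc]
    refine (ContinuousLinearMap.opNorm_comp_le _ _).trans ?_
    have := mul_le_mul_of_nonneg_left d1' hr
    nlinarith
  · rw [greenR, ContinuousLinearMap.add_comp]
    refine (norm_add_le _ _).trans ?_
    nlinarith
  · rw [greenP, ContinuousLinearMap.comp_assoc]
    refine (ContinuousLinearMap.opNorm_comp_le _ _).trans ?_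
    have := mul_le_mul_of_nonneg_left d3 hr
    nlinarith

/-- The Dirichlet problem for `Δ̃ + lower order terms - m / r²` is solvable for large `m`. -/
theorem exists_surjective (A0 A1 A2 : Y p →L[ℂ] Y p) : ∃ m0 : ℝ, ∀ m ≥ m0, ∀ F : Y p, ∃ φ : Y p,
    mulL p (radInv p) φ - (m : ℂ) • mulL p (radInv p) (mulL p (radInv p) (green p φ)) +
      (A1 (greenR p φ) + A2 (greenP p φ) + A0 (green p φ)) = F := by
  set C := 1 + ‖mulL p (rad p)‖ * (‖A1‖ + ‖A2‖ + ‖A0‖) with hC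
  have hC0 : 0 < C := by positivity
  obtain ⟨m0, hm0, h⟩ := exists_small (p := p) (1 / (2 * C)) (by positivity)
  refine ⟨m0, fun m hm F => ?_⟩
  obtain ⟨h0, h1, h2⟩ := h m hm
  -- With φ = resFactor ψ the problem, multiplied by r, becomes (1 + B)ψ = rF, and a Neumann series
  -- solves it.
  set B : Y p →L[ℂ] Y p := mulL p (rad p) ∘L (A1 ∘L greenR p ∘L resFactor p m +
    A2 ∘L greenP p ∘L resFactor p m + A0 ∘L green p ∘L resFactor p m) with hB
  have hle : ∀ (A D : Y p →L[ℂ] Y p), ‖D‖ ≤ 1 / (2 * C) → ‖A ∘L D‖ ≤ ‖A‖ * (1 / (2 * C)) :=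
    fun A D hD => (ContinuousLinearMap.opNorm_comp_le _ _).trans (by gcongr)
  have hBn : ‖B‖ < 1 := by
    have h3 : ‖B‖ ≤ ‖mulL p (rad p)‖ * (‖A1‖ * (1 / (2 * C)) + ‖A2‖ * (1 / (2 * C)) +
        ‖A0‖ * (1 / (2 * C))) := by
      refine (ContinuousLinearMap.opNorm_comp_le _ _).trans ?_
      gcongr
      refine (norm_add_le _ _).trans (add_le_add ((norm_add_le _ _).trans (add_le_add ?_ ?_)) ?_)
      · exact hle _ _ h1
      · exact hle _ _ h2
      · exact hle _ _ h0
    have h4 : ‖mulL p (rad p)‖ * (‖A1‖ * (1 / (2 * C)) + ‖A2‖ * (1 / (2 * C)) +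
        ‖A0‖ * (1 / (2 * C))) = (C - 1) / (2 * C) := by
      rw [hC]; ring
    have h5 : (C - 1) / (2 * C) < 1 := by
      rw [div_lt_one (by positivity)]; linarith
    linarith
  obtain ⟨U, hU⟩ := isUnit_one_sub_of_norm_lt_one (x := -B) (by rwa [norm_neg])
  set ψ := (U⁻¹ : (Y p →L[ℂ] Y p)ˣ).1 (mulL p (rad p) F) with hψ
  have e1 : ψ + B ψ = mulL p (rad p) F := by
    have : (U.1 * U⁻¹.1) (mulL p (rad p) F) = mulL p (rad p) F := by
      rw [← Units.val_mul, mul_inv_cancel]; rfl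
    rw [hU] at this
    rw [hψ]
    simpa using this
  refine ⟨resFactor p m ψ, ?_⟩
  rw [← map_smul, ← map_sub, sub_green_resFactor (hm0.trans hm)]
  have e2 := congrArg (mulL p (radInv p)) e1
  rw [map_add, mulL_radInv_rad, hB, ContinuousLinearMap.comp_apply, mulL_radInv_rad] at e2
  exact e2

/-- Weak solutions of `Δ̃G + lower order terms = F` in `L²` are strong solutions. -/
theorem exists_eq_green_of_weak {κ : ℝ} {G F : Y p}
    (hG : ∀ φ, inner ℂ (mulL p (radInv p) φ + (κ : ℂ) • greenV p φ) G = inner ℂ (green p φ) F) :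
    ∃ γ, G = green p γ := by
  -- Both Δ̃ + κV - m/r² and its formal adjoint Δ̃ - κ(V + h) - m/r² are made surjective, by taking
  -- m at least both thresholds.
  obtain ⟨m1, h1⟩ := exists_surjective (p := p) 0 ((κ : ℂ) • mulL p (coefF p))
    ((κ : ℂ) • mulL p (coefG p))
  obtain ⟨m2, h2⟩ := exists_surjective (p := p) (-((κ : ℂ) • mulL p (coefH p)))
    (-((κ : ℂ) • mulL p (coefF p))) (-((κ : ℂ) • mulL p (coefG p)))
  set m := max m1 m2
  -- The strong solution of the adjoint problem with G itself in the zero order term is the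
  -- candidate. The difference D is then orthogonal to the range of the first operator, which is
  -- everything.
  obtain ⟨γ, hγ⟩ := h2 m (le_max_right _ _) (F - (m : ℂ) • mulL p (radInv p) (mulL p (radInv p) G))
  refine ⟨γ, ?_⟩
  set D := G - green p γ with hD
  have hself : ∀ φ, inner ℂ (mulL p (radInv p) φ + (κ : ℂ) • greenV p φ) (green p γ) =
      inner ℂ (green p φ) (mulL p (radInv p) γ -
        (κ : ℂ) • (greenV p γ + mulL p (coefH p) (green p γ))) := by
    intro φ
    have h3 := inner_greenV (hasGrad_green γ) φ
    have h4 := congrArg (starRingEnd ℂ) h3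
    rw [map_neg, inner_conj_symm, inner_conj_symm] at h4
    rw [inner_add_left, inner_smul_left, inner_radInv_green, h4, inner_sub_right, inner_smul_right,
      Complex.conj_ofReal, greenV_apply]
    ring
  have hD1 : ∀ φ, inner ℂ (mulL p (radInv p) φ + (κ : ℂ) • greenV p φ -
      (m : ℂ) • mulL p (radInv p) (mulL p (radInv p) (green p φ))) D = 0 := by
    intro φ
    have e : mulL p (radInv p) γ - (κ : ℂ) • (greenV p γ + mulL p (coefH p) (green p γ)) =
        F - (m : ℂ) • mulL p (radInv p) (mulL p (radInv p) D) := by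
      have e1 : F = (mulL p (radInv p) γ - (m : ℂ) • mulL p (radInv p) (mulL p (radInv p) (green p γ)) +
          (-((κ : ℂ) • mulL p (coefF p) (greenR p γ)) + -((κ : ℂ) • mulL p (coefG p) (greenP p γ)) +
            -((κ : ℂ) • mulL p (coefH p) (green p γ)))) +
          (m : ℂ) • mulL p (radInv p) (mulL p (radInv p) G) := by
        have := hγ
        simp only [neg_apply, smul_apply] at this
        rw [this]; abel
      rw [e1, hD, greenV_apply, transport, map_sub, map_sub]
      simp only [smul_add, smul_sub]
      abel
    rw [inner_sub_left, hD, inner_sub_right, hG, hself, e, ← hD, inner_smul_left, inner_sub_right,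
      inner_smul_right, Complex.conj_ofReal, inner_mulL, inner_mulL]
    ring
  obtain ⟨φ, hφ⟩ := h1 m (le_max_left _ _) D
  have h5 := hD1 φ
  have h6 : mulL p (radInv p) φ + (κ : ℂ) • greenV p φ -
      (m : ℂ) • mulL p (radInv p) (mulL p (radInv p) (green p φ)) = D := by
    rw [← hφ, greenV_apply, transport]
    simp only [smul_apply, zero_apply, smul_add]
    abel
  rw [h6, inner_self_eq_zero] at h5
  exact sub_eq_zero.1 h5

end Resolvent

/-! ### Elliptic regularity from H² to H⁴ -/

section Regularity

variable {p : Params}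

/-- `w ∈ H¹(Ω)` is periodic in `ψ`. -/
def PeriodicH1 (w : Y p) : Prop := ∃ a b, HasGrad w a b

theorem PeriodicH1.add {w v : Y p} : PeriodicH1 w → PeriodicH1 v → PeriodicH1 (w + v) :=
  fun ⟨_, _, h1⟩ ⟨_, _, h2⟩ => ⟨_, _, h1.add h2⟩

theorem PeriodicH1.sub {w v : Y p} : PeriodicH1 w → PeriodicH1 v → PeriodicH1 (w - v) :=
  fun ⟨_, _, h1⟩ ⟨_, _, h2⟩ => ⟨_, _, h1.sub h2⟩

theorem PeriodicH1.smul {w : Y p} (c : ℂ) : PeriodicH1 w → PeriodicH1 (c • w) :=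
  fun ⟨_, _, h⟩ => ⟨_, _, h.smul c⟩

theorem PeriodicH1.mulL {w : Y p} {c : ℝ × ℝ → ℝ} (hc : ContDiff ℝ ∞ c) (hp : c ∈ periodicTests) :
    PeriodicH1 w → PeriodicH1 (mulL p c w) :=
  fun ⟨_, _, h⟩ => ⟨_, _, h.mulL hc hp⟩

theorem PeriodicH1.mem_H_one {w : Y p} : PeriodicH1 w → w ∈ H p 1 := fun ⟨_, _, h⟩ => h.mem_H_one

variable [hp : p.Admissible]

theorem rad_mem_periodic : rad p ∈ periodicTests := fun _ _ => rfl

theorem green_mem_H_two (φ : Y p) : green p φ ∈ H p 2 := (mem_X_iff.1 (green_mem_X φ)).1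

/-- The coefficients of Δ̃ do not depend on ψ, so ∂_ψ commutes with the solution operator. -/
theorem greenP_eq_green {φ φψ : Y p} (h : (φ, φψ) ∈ partsGraph p periodicTests 0 1) :
    greenP p φ = green p φψ := by
  rw [← mulL_rad_radInv (greenP p φ), ← mulL_rad_radInv (green p φψ)]
  congr 1
  refine ext_inner_basis (basis p) fun i => ?_
  have e : ∀ h : Orthonormal ℂ (basisFun p),
      diagOp (basis p) h (fun i => -(Complex.I * i.2) / mu p i) =
        diagOp (basis p) (basis p).orthonormal fun i => -(Complex.I * i.2) / mu p i := fun h => by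
    congr 1
    exact funext fun i => (basis_apply i).symm
  have h1 := inner_sep_psi h (contDiff_div_rho (p := p) (contDiff_sinR (p := p) i.1)) i.2
  rw [inner_basis_radInv_green, greenP, ContinuousLinearMap.comp_apply, mulL_radInv_rad, e,
    inner_basis_diagOp _ (exists_bound_div_mu fun i => by
      have := abs_le_mu (p := p) i
      have := mu_pos (p := p) i
      rw [norm_neg, norm_I_mul_int]; linarith), basis_apply, basisFun, h1]
  ring

theorem PeriodicH1.of_eq_green {c : ℝ} (hc : c ≠ 0) {P Q γ : Y p}
    (h : (c : ℂ) • P + Q = green p γ) (hQ : PeriodicH1 Q) : PeriodicH1 P := by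
  have : P = (c : ℂ)⁻¹ • (green p γ - Q) := by
    rw [← h, add_sub_cancel_right, smul_smul, inv_mul_cancel₀ (by exact_mod_cast hc), one_smul]
  rw [this]
  exact (PeriodicH1.sub ⟨_, _, hasGrad_green γ⟩ hQ).smul _

/-- Elliptic regularity, from `H²` to `H⁴`. -/
theorem green_mem_H_four {c : ℝ} (hc : c ≠ 0) {t a l : ℂ} {φ χ γ : Y p}
    (h : (c : ℂ) • mulL p (radInv p) φ +
      t • (greenV p φ - a • green p φ - l • green p χ) = green p γ) : green p φ ∈ H p 4 := by
  have hc' : (c : ℂ) ≠ 0 := by exact_mod_cast hc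
  have solve : ∀ {P Q W : Y p}, (c : ℂ) • P + Q = W → P = (c : ℂ)⁻¹ • (W - Q) := by
    rintro P Q W rfl
    rw [add_sub_cancel_right, smul_smul, inv_mul_cancel₀ hc', one_smul]
  have hV := ((hasGrad_greenR φ).mulL contDiff_coefF (coefF_mem p)).add
    ((hasGrad_greenP φ).mulL contDiff_coefG (coefG_mem p))
  -- The equation expresses φ/r through quantities with at most one derivative of u, which lie in H¹
  -- and are periodic. So φ has a periodic ψ-derivative.
  have hP := (((hasGrad_green γ).sub (((hV.sub ((hasGrad_green φ).smul a)).sub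
    ((hasGrad_green χ).smul l)).smul t))).smul (c : ℂ)⁻¹
  rw [← transport, ← greenV_apply, ← solve h] at hP
  set P := mulL p (radInv p) φ with hPdef
  have hφ := hP.mulL (contDiff_rad (p := p)) rad_mem_periodic
  rw [hPdef, mulL_rad_radInv, ← hPdef] at hφ
  set φr := _ + mulL p (dr (rad p)) P
  set Pψ := (c : ℂ)⁻¹ • (greenP p γ - t • (_ - a • greenP p φ - l • greenP p χ)) with hPψ
  set φψ := mulL p (rad p) Pψ + mulL p (dpsi (rad p)) P
  -- Now ∂_ψ u is itself a solution, with data φψ, so the terms of the differentiated equation are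
  -- again in H¹ and ψ may be differentiated once more.
  have e1 : greenP p φ = green p φψ := greenP_eq_green hφ.right
  have e2 : greenRP p φ = greenR p φψ := partsGraph_interior_unique (hasGrad_greenP φ).left
    (by rw [e1]; exact (hasGrad_green φψ).left)
  have e3 : greenPP p φ = greenP p φψ := partsGraph_interior_unique (hasGrad_greenP φ).interior
    (by rw [e1]; exact (hasGrad_green φψ).interior)
  have hψ : PeriodicH1 Pψ := by
    refine PeriodicH1.smul _ (PeriodicH1.sub ⟨_, _, hasGrad_greenP γ⟩ (PeriodicH1.smul _
      (PeriodicH1.sub (PeriodicH1.sub (PeriodicH1.add (PeriodicH1.add ?_ ?_)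
        (PeriodicH1.add ?_ ?_)) (PeriodicH1.smul _ ?_)) (PeriodicH1.smul _ ?_))))
    · rw [e2]; exact PeriodicH1.mulL contDiff_coefF (coefF_mem p) ⟨_, _, hasGrad_greenR _⟩
    · exact PeriodicH1.mulL (contDiff_dpsi contDiff_coefF)
        (stableTests_periodic.dpsi_mem _ (coefF_mem p) contDiff_coefF) ⟨_, _, hasGrad_greenR _⟩
    · rw [e3]; exact PeriodicH1.mulL contDiff_coefG (coefG_mem p) ⟨_, _, hasGrad_greenP _⟩
    · exact PeriodicH1.mulL (contDiff_dpsi contDiff_coefG)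
        (stableTests_periodic.dpsi_mem _ (coefG_mem p) contDiff_coefG) ⟨_, _, hasGrad_greenP _⟩
    · exact ⟨_, _, hasGrad_greenP _⟩
    · exact ⟨_, _, hasGrad_greenP _⟩
  obtain ⟨φψr, φψψ, hφψ⟩ : PeriodicH1 φψ := (hψ.mulL (contDiff_rad (p := p)) rad_mem_periodic).add
    (PeriodicH1.mulL (contDiff_dpsi (contDiff_rad (p := p)))
      (stableTests_periodic.dpsi_mem _ rad_mem_periodic contDiff_rad) ⟨_, _, hP⟩)
  have f1 : greenP p φψ = green p φψψ := greenP_eq_green hφψ.right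
  have f2 : greenRP p φψ = greenR p φψψ := partsGraph_interior_unique (hasGrad_greenP φψ).left
    (by rw [f1]; exact (hasGrad_green φψψ).left)
  -- The ψ-derivatives are under control; the missing second r-derivative is read off from Δ̃u =
  -- φ/r.
  have hRR : greenRR p φ = P - (4 : ℂ) • mulL p (radInv p) (mulL p (radInv p) (green p φψψ)) := by
    rw [← f1, ← e3, hPdef, ← greenRR_add_greenPP φ, add_sub_cancel_right]
  have hK : mulL p (radInv p) (mulL p (radInv p) (green p φψψ)) ∈ H p 2 :=
    mulL_mem_H contDiff_radInv (mulL_mem_H contDiff_radInv (green_mem_H_two _))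
  have hRR1 : greenRR p φ ∈ H p 1 := by
    rw [hRR]
    exact Submodule.sub_mem _ hP.mem_H_one (Submodule.smul_mem _ _ (H_anti (by norm_num) hK))
  have hR2 : greenR p φ ∈ H p 2 := (hasGrad_greenR φ).mem_H_succ hRR1
    (by rw [e2]; exact (hasGrad_greenR φψ).mem_H_one)
  have hPH : greenP p φ ∈ H p 2 := by rw [e1]; exact green_mem_H_two _
  have hP2 : P ∈ H p 2 := by
    rw [solve h]
    refine Submodule.smul_mem _ _ (Submodule.sub_mem _ (green_mem_H_two _) (Submodule.smul_mem _ _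
      (Submodule.sub_mem _ (Submodule.sub_mem _ (Submodule.add_mem _ (mulL_mem_H contDiff_coefF hR2)
        (mulL_mem_H contDiff_coefG hPH)) (Submodule.smul_mem _ _ (green_mem_H_two _)))
        (Submodule.smul_mem _ _ (green_mem_H_two _)))))
  have hRR2 : greenRR p φ ∈ H p 2 := by
    rw [hRR]
    exact Submodule.sub_mem _ hP2 (Submodule.smul_mem _ _ hK)
  have hRRψ : (greenRR p φ, greenRR p φψ) ∈ partsGraph p (interiorTests p) 0 1 := by
    have h1 := partsGraph_comp stableTests_interior (hasGrad_greenR φ).interior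
      (e2 ▸ (hasGrad_greenR φψ).left)
    exact partsGraph_of_comp stableTests_interior (hasGrad_greenR φ).left h1
  have hRψ2 : greenR p φψ ∈ H p 2 := (hasGrad_greenR φψ).mem_H_succ (mem_H_of_right hRR2 hRRψ)
    (by rw [f2]; exact (hasGrad_greenR φψψ).mem_H_one)
  exact (hasGrad_green φ).mem_H_succ
    ((hasGrad_greenR φ).mem_H_succ hRR2 (by rwa [e2]))
    (by rw [e1]; exact (hasGrad_green φψ).mem_H_succ hRψ2 (by rw [f1]; exact green_mem_H_two _))

end Regularity

/-! ### Linearity of the relation in the vector -/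

section MapsLinear

variable {E F : Type*} [AddCommGroup E] [Module ℂ E] [AddCommGroup F] [Module ℂ F]
  {T : E →ₗ.[ℂ] F} {x x' : E} {y y' : F}

theorem Maps.add_vec (h : Maps T x y) (h' : Maps T x' y') : Maps T (x + x') (y + y') := by
  obtain ⟨h, rfl⟩ := h
  obtain ⟨h', rfl⟩ := h'
  exact ⟨add_mem h h', T.map_add ⟨x, h⟩ ⟨x', h'⟩⟩

theorem Maps.smul_vec (c : ℂ) (h : Maps T x y) : Maps T (c • x) (c • y) := by
  obtain ⟨h, rfl⟩ := h
  exact ⟨Submodule.smul_mem _ c h, T.map_smul c ⟨x, h⟩⟩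

end MapsLinear

theorem Maps.of_eq {E F : Type*} [AddCommGroup E] [Module ℂ E] [AddCommGroup F] [Module ℂ F]
    {T : E →ₗ.[ℂ] F} {x : E} {y y' : F} (h : Maps T x y) (e : y' = y) : Maps T x y' := e ▸ h

/-! ### The family of operators and the weak form of its eigenvalue equation -/

section Family

variable {p : Params} [hp : p.Admissible]

variable (p) in
/-- The factor in front of the inner product of `pair`. -/
def pairConst : ℝ := (2 * Real.pi * (p.rmax - p.rmin))⁻¹

theorem pairConst_pos : 0 < pairConst p := by
  have := sub_pos.2 hp.rmin_lt
  unfold pairConst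
  positivity

theorem pair_apply (w u : Y p) : pair p w u = (pairConst p : ℂ) * inner ℂ w u := rfl

variable (p) in
/-- `A u - l ū` for `u = green φ`. -/
def residual (ubar : Y p) (lbar : ℝ) (φ : Y p) (l : ℂ) : Y p :=
  ((p.σ ^ 2 / 2 : ℝ) : ℂ) • mulL p (radInv p) φ + greenV p φ - (lbar : ℂ) • green p φ - l • ubar

variable {ubar : Y p} {lbar etaL etaS s : ℝ} {φ γ : Y p} {l : ℂ}

theorem maps_A : Maps (A p lbar) (green p φ)
    (((p.σ ^ 2 / 2 : ℝ) : ℂ) • mulL p (radInv p) φ + greenV p φ - (lbar : ℂ) • green p φ) :=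
  (((maps_lap_green φ).smul _).add (maps_V_green φ)).sub (maps_scalar _ _)

theorem maps_S : Maps (S p ubar lbar) (green p φ, l)
    (residual p ubar lbar φ l, (pairConst p : ℂ) * inner ℂ ubar (green p φ)) := by
  unfold S
  refine ((maps_A.onFirst l).add (maps_everywhere _ _)).of_eq (Prod.ext ?_ ?_)
  · change _ = _ + -(l • ubar)
    rw [residual, sub_eq_add_neg _ (l • ubar)]
  · exact (zero_add _).symm

theorem maps_Astar {w wr wψ y : Y p} (hw : HasGrad w wr wψ) (hy : Maps (lap p) w y) :
    Maps (Astar p lbar) w (((p.σ ^ 2 / 2 : ℝ) : ℂ) • y - transport wr wψ - mulL p (coefH p) w -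
      (lbar : ℂ) • w) :=
  (((hy.smul _).sub (maps_V hw.left hw.interior)).sub
    (maps_mult contDiff_coefH.continuous (fun _ hx => (coef_eq hx).2.2) _)).sub (maps_scalar _ _)

theorem maps_Sstar {w wr wψ y : Y p} (hw : HasGrad w wr wψ) (hy : Maps (lap p) w y) (k : ℂ) :
    Maps (Sstar p ubar lbar) (w, k) (((p.σ ^ 2 / 2 : ℝ) : ℂ) • y - transport wr wψ -
      mulL p (coefH p) w - (lbar : ℂ) • w + k • ubar, -((pairConst p : ℂ) * inner ℂ ubar w)) := by
  unfold Sstar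
  refine (((maps_Astar hw hy).onFirst k).add (maps_everywhere _ _)).of_eq (Prod.ext rfl ?_)
  exact (zero_add _).symm

theorem maps_base {y : Y p} (hy : Maps (lap p) (mulL p (radInv p) φ) y) :
    Maps (base p ubar lbar etaL etaS) (green p φ, l)
      ((s2 p etaL : ℂ) • y + (s1 p lbar etaL : ℂ) • mulL p (radInv p) φ +
        (s0 p ubar lbar etaS : ℂ) • green p φ, (sl p ubar etaS : ℂ) * l) := by
  unfold base
  refine ((Maps.onFirst ((((maps_compose_iff.2 ⟨_, maps_lap_green φ, hy⟩).smul _).add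
    ((maps_lap_green φ).smul _)).add (maps_scalar _ _)) l).add (maps_everywhere _ _)).of_eq
      (Prod.ext ?_ ?_)
  · exact (add_zero _).symm
  · exact (zero_add _).symm

theorem greenV_mem_H_two (h : green p φ ∈ H p 4) : greenV p φ ∈ H p 2 :=
  Submodule.add_mem _
    (mulL_mem_H contDiff_coefF (H_anti (by norm_num) (mem_H_of_left h (hasGrad_green φ).left)))
    (mulL_mem_H contDiff_coefG (H_anti (by norm_num) (mem_H_of_right h (hasGrad_green φ).interior)))

theorem radInv_mem_H_two (h : green p φ ∈ H p 4) : mulL p (radInv p) φ ∈ H p 2 := by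
  rw [← greenRR_add_greenPP]
  exact Submodule.add_mem _
    (mem_H_of_left (mem_H_of_left h (hasGrad_green φ).left) (hasGrad_greenR φ).left)
    (Submodule.smul_mem _ _ (mulL_mem_H contDiff_radInv (mulL_mem_H contDiff_radInv
      (mem_H_of_right (mem_H_of_right h (hasGrad_green φ).interior) (hasGrad_greenP φ).interior))))

variable (p) in
/-- The function `G` whose membership in `X` is the second boundary condition. -/
def flux (ubar : Y p) (lbar etaL s : ℝ) (φ : Y p) (l : ℂ) : Y p :=
  ((s * (p.σ ^ 2 / 2) : ℝ) : ℂ) • residual p ubar lbar φ l +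
    (((1 - s) * s2 p etaL : ℝ) : ℂ) • mulL p (radInv p) φ

/-- The operator of `Z`, in terms of `flux`. -/
theorem maps_Z_operator : Maps ((s : ℂ) • L p + (((1 - s) * (2 * s2 p etaL / p.σ ^ 2) : ℝ) : ℂ) • lap p)
    (green p φ) (((2 / p.σ ^ 2 : ℝ) : ℂ) • flux p ubar lbar etaL s φ l +
      (s : ℂ) • ((lbar : ℂ) • green p φ + l • ubar)) := by
  have h := ((((maps_lap_green φ).smul ((p.σ ^ 2 / 2 : ℝ) : ℂ)).add (maps_V_green φ)).smul (s : ℂ)).add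
    ((maps_lap_green φ).smul (((1 - s) * (2 * s2 p etaL / p.σ ^ 2) : ℝ) : ℂ))
  refine h.of_eq ?_
  have h0 : (p.σ : ℂ) ≠ 0 := by exact_mod_cast hp.σ_pos.ne'
  rw [flux, residual]
  push_cast
  match_scalars <;> field_simp <;> ring

/-- The operator in Z and 2/σ² times the flux differ by s(λ̄u + lū), which lies in X. Hence l may be
arbitrary here. -/
theorem mem_Z_iff (hu : ubar ∈ X p) : green p φ ∈ Z p etaL s ↔
    green p φ ∈ H p 4 ∧ ∃ γ, flux p ubar lbar etaL s φ l = green p γ := by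
  have hlow : (s : ℂ) • ((lbar : ℂ) • green p φ + l • ubar) ∈ X p :=
    Submodule.smul_mem _ _ (Submodule.add_mem _ (Submodule.smul_mem _ _ (green_mem_X φ))
      (Submodule.smul_mem _ _ hu))
  have h0 : ((2 / p.σ ^ 2 : ℝ) : ℂ) ≠ 0 := by
    have := hp.σ_pos
    exact_mod_cast (by positivity : (2 / p.σ ^ 2 : ℝ) ≠ 0)
  simp only [Z, Submodule.mem_inf, mem_preimage_iff]
  constructor
  · rintro ⟨⟨h4, -⟩, q, hq, hqX⟩
    refine ⟨h4, exists_eq_green ?_⟩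
    rw [hq.unique (maps_Z_operator (ubar := ubar) (lbar := lbar) (l := l)),
      Submodule.add_mem_iff_left _ hlow] at hqX
    exact (Submodule.smul_mem_iff _ h0).1 hqX
  · rintro ⟨h4, γ, hγ⟩
    refine ⟨⟨h4, green_mem_X φ⟩, _, maps_Z_operator (ubar := ubar) (lbar := lbar) (l := l), ?_⟩
    rw [hγ]
    exact Submodule.add_mem _ (Submodule.smul_mem _ _ (green_mem_X γ)) hlow

/-- The fourth order terms of S*S and of the base operator occur only in the combination Δ̃(flux),
which equals γ/r. -/
theorem maps_family (hu : ubar ∈ X p) (h4 : green p φ ∈ H p 4)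
    (hγ : flux p ubar lbar etaL s φ l = green p γ) {wr wψ : Y p}
    (hw : HasGrad (residual p ubar lbar φ l) wr wψ) :
    Maps (family p ubar lbar etaL etaS s) (green p φ, l)
      (mulL p (radInv p) γ - (s : ℂ) • (transport wr wψ +
          mulL p (coefH p) (residual p ubar lbar φ l)) +
        ((-(s : ℂ) * lbar) • residual p ubar lbar φ l +
          ((s : ℂ) * ((pairConst p : ℂ) * inner ℂ ubar (green p φ))) • ubar +
          (1 - (s : ℂ)) • ((s1 p lbar etaL : ℂ) • mulL p (radInv p) φ +
            (s0 p ubar lbar etaS : ℂ) • green p φ)),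
       -(s : ℂ) * ((pairConst p : ℂ) * inner ℂ ubar (residual p ubar lbar φ l)) +
        (1 - (s : ℂ)) * ((sl p ubar etaS : ℂ) * l)) := by
  refine maps_domRestrict_iff.2 ⟨(mem_Z_iff (lbar := lbar) (l := l) hu).2 ⟨h4, γ, hγ⟩, ?_⟩
  have hwH : residual p ubar lbar φ l ∈ H p 2 :=
    Submodule.sub_mem _ (Submodule.sub_mem _ (Submodule.add_mem _
      (Submodule.smul_mem _ _ (radInv_mem_H_two h4)) (greenV_mem_H_two h4))
      (Submodule.smul_mem _ _ (green_mem_H_two φ))) (Submodule.smul_mem _ _ (mem_X_iff.1 hu).1)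
  obtain ⟨y, hy⟩ := exists_maps_lap hwH
  obtain ⟨z, hz⟩ := exists_maps_lap (radInv_mem_H_two h4)
  have hsum := (hy.smul_vec ((s * (p.σ ^ 2 / 2) : ℝ) : ℂ)).add_vec
    (hz.smul_vec (((1 - s) * s2 p etaL : ℝ) : ℂ))
  change Maps _ (flux p ubar lbar etaL s φ l) _ at hsum
  rw [hγ] at hsum
  rw [(maps_lap_green γ).unique hsum]
  convert ((maps_compose_iff.2 ⟨_, maps_S, maps_Sstar hw hy _⟩).smul (s : ℂ)).add
    ((maps_base hz).smul ((1 - s : ℝ) : ℂ)) using 1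
  refine Prod.ext ?_ ?_
  · simp only [Prod.smul_mk, Prod.mk_add_mk]
    push_cast
    module
  · simp only [Prod.smul_mk, Prod.mk_add_mk, smul_eq_mul]
    push_cast
    ring

/-- The lower order terms of the eigenvalue equation. -/
def lowerOrder (ubar : Y p) (lbar etaL etaS s : ℝ) (φ : Y p) (l z : ℂ) : Y p :=
  (-(s : ℂ) * lbar) • residual p ubar lbar φ l +
    ((s : ℂ) * ((pairConst p : ℂ) * inner ℂ ubar (green p φ))) • ubar +
    (1 - (s : ℂ)) • ((s1 p lbar etaL : ℂ) • mulL p (radInv p) φ +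
      (s0 p ubar lbar etaS : ℂ) • green p φ) - z • green p φ

theorem leading_pos (hs0 : 0 ≤ s) (hs1 : s ≤ 1) (hη : etaL < 1) :
    0 < s * (p.σ ^ 4 / 4) + (1 - s) * s2 p etaL := by
  have h1 : 0 < p.σ ^ 4 / 4 := by have := hp.σ_pos; positivity
  have h2 : 0 < s2 p etaL := mul_pos (by linarith) h1
  rcases hs0.eq_or_lt with rfl | h
  · simpa using h2
  · have : 0 ≤ (1 - s) * s2 p etaL := mul_nonneg (by linarith) h2.le
    have : 0 < s * (p.σ ^ 4 / 4) := mul_pos h h1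
    linarith

theorem flux_eq : flux p ubar lbar etaL s φ l =
    ((s * (p.σ ^ 4 / 4) + (1 - s) * s2 p etaL : ℝ) : ℂ) • mulL p (radInv p) φ +
      ((s * (p.σ ^ 2 / 2) : ℝ) : ℂ) • (greenV p φ - (lbar : ℂ) • green p φ - l • ubar) := by
  rw [flux, residual]
  push_cast
  match_scalars <;> ring

theorem periodicH1_lower (hu : ubar ∈ X p) :
    PeriodicH1 (greenV p φ - (lbar : ℂ) • green p φ - l • ubar) := by
  obtain ⟨χ, rfl⟩ := exists_eq_green hu
  exact (PeriodicH1.sub (exists_hasGrad_greenV φ) (PeriodicH1.smul _ ⟨_, _, hasGrad_green φ⟩)).sub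
    (PeriodicH1.smul _ ⟨_, _, hasGrad_green χ⟩)

theorem inner_greenV_left {w wr wψ : Y p} (hw : HasGrad w wr wψ) (χ : Y p) :
    inner ℂ (greenV p χ) w = -inner ℂ (green p χ) (transport wr wψ + mulL p (coefH p) w) := by
  have h := congrArg (starRingEnd ℂ) (inner_greenV hw χ)
  rwa [map_neg, inner_conj_symm, inner_conj_symm] at h

/-- Up to first order terms the flux is a positive multiple of Δ̃u, for every s in [0, 1]. So
regularity of the flux is inherited by Δ̃u, and then by u and by Au - lū. -/
theorem regularity (hu : ubar ∈ X p) (hs0 : 0 ≤ s) (hs1 : s ≤ 1) (hη : etaL < 1)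
    (hγ : flux p ubar lbar etaL s φ l = green p γ) :
    green p φ ∈ H p 4 ∧ PeriodicH1 (residual p ubar lbar φ l) := by
  have hc := (leading_pos (p := p) hs0 hs1 hη).ne'
  have hQ := periodicH1_lower (φ := φ) (lbar := lbar) (l := l) hu
  rw [flux_eq] at hγ
  refine ⟨?_, ?_⟩
  · obtain ⟨χ, rfl⟩ := exists_eq_green hu
    exact green_mem_H_four hc hγ
  · have hP := PeriodicH1.of_eq_green hc hγ (hQ.smul _)
    have := (hP.smul ((p.σ ^ 2 / 2 : ℝ) : ℂ)).add hQ
    convert this using 1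
    rw [residual]
    abel

/-- The eigenvalue equation for `family` in weak form. -/
theorem mem_eigenspace_family_iff (hu : ubar ∈ X p) (hs0 : 0 ≤ s) (hs1 : s ≤ 1) (hη : etaL < 1)
    {z : ℂ} : (green p φ, l) ∈ eigenspace (family p ubar lbar etaL etaS s) z ↔
      (∀ χ, inner ℂ (mulL p (radInv p) χ) (flux p ubar lbar etaL s φ l) +
        s * inner ℂ (greenV p χ) (residual p ubar lbar φ l) +
        inner ℂ (green p χ) (lowerOrder ubar lbar etaL etaS s φ l z) = 0) ∧
      -(s : ℂ) * ((pairConst p : ℂ) * inner ℂ ubar (residual p ubar lbar φ l)) +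
        (1 - (s : ℂ)) * ((sl p ubar etaS : ℂ) * l) = z * l := by
  rw [mem_eigenspace_iff]
  have key : ∀ {γ wr wψ : Y p}, flux p ubar lbar etaL s φ l = green p γ →
      HasGrad (residual p ubar lbar φ l) wr wψ → ∀ χ,
      inner ℂ (mulL p (radInv p) χ) (flux p ubar lbar etaL s φ l) +
        s * inner ℂ (greenV p χ) (residual p ubar lbar φ l) +
        inner ℂ (green p χ) (lowerOrder ubar lbar etaL etaS s φ l z) =
      inner ℂ (green p χ) (mulL p (radInv p) γ - (s : ℂ) • (transport wr wψ +
          mulL p (coefH p) (residual p ubar lbar φ l)) +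
        ((-(s : ℂ) * lbar) • residual p ubar lbar φ l +
          ((s : ℂ) * ((pairConst p : ℂ) * inner ℂ ubar (green p φ))) • ubar +
          (1 - (s : ℂ)) • ((s1 p lbar etaL : ℂ) • mulL p (radInv p) φ +
            (s0 p ubar lbar etaS : ℂ) • green p φ)) - z • green p φ) := by
    intro γ wr wψ hγ hw χ
    rw [hγ, inner_radInv_green, inner_greenV_left hw, lowerOrder]
    simp only [inner_add_right, inner_sub_right, inner_smul_right]
    ring
  constructor
  · intro h
    have hZ := (maps_domRestrict_iff.1 h).1
    obtain ⟨h4, γ, hγ⟩ := (mem_Z_iff (lbar := lbar) (l := l) hu).1 hZ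
    obtain ⟨-, wr, wψ, hw⟩ := regularity hu hs0 hs1 hη hγ
    have he := (maps_family (etaS := etaS) hu h4 hγ hw).unique h
    refine ⟨fun χ => ?_, congrArg Prod.snd he⟩
    rw [key hγ hw]
    exact (congrArg (fun y => inner ℂ (green p χ) y)
      (sub_eq_zero.2 (congrArg Prod.fst he))).trans (inner_zero_right _)
  · rintro ⟨h1, h2⟩
    have hc := leading_pos (p := p) hs0 hs1 hη
    set c := s * (p.σ ^ 4 / 4) + (1 - s) * s2 p etaL with hcdef
    have hc' : (c : ℂ) ≠ 0 := by exact_mod_cast hc.ne'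
    set Q := greenV p φ - (lbar : ℂ) • green p φ - l • ubar with hQdef
    obtain ⟨Qr, Qψ, hQ⟩ : PeriodicH1 (((s * (1 - s * (p.σ ^ 4 / 4) / c) : ℝ) : ℂ) • Q) :=
      (periodicH1_lower hu).smul _
    -- The factor in front of the flux is chosen so that Δ̃u cancels and only a periodic H¹
    -- remainder is left. The weak equation then becomes a second order problem for the flux alone,
    -- with right hand side in L².
    have hres : (s : ℂ) • residual p ubar lbar φ l =
        ((s * (p.σ ^ 2 / 2) / c : ℝ) : ℂ) • flux p ubar lbar etaL s φ l +
          ((s * (1 - s * (p.σ ^ 4 / 4) / c) : ℝ) : ℂ) • Q := by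
      have : residual p ubar lbar φ l = ((p.σ ^ 2 / 2 : ℝ) : ℂ) • mulL p (radInv p) φ + Q := by
        rw [residual, hQdef]; abel
      rw [this, flux_eq, ← hcdef, ← hQdef]
      push_cast
      match_scalars <;> field_simp <;> ring
    obtain ⟨γ, hγ⟩ := exists_eq_green_of_weak (p := p) (κ := s * (p.σ ^ 2 / 2) / c)
      (G := flux p ubar lbar etaL s φ l) (F := transport Qr Qψ + mulL p (coefH p)
        (((s * (1 - s * (p.σ ^ 4 / 4) / c) : ℝ) : ℂ) • Q) -
          lowerOrder ubar lbar etaL etaS s φ l z) (by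
      intro χ
      have h3 := h1 χ
      have h4 := inner_greenV_left hQ χ
      rw [← inner_smul_right, hres, inner_add_right, h4, inner_smul_right] at h3
      rw [inner_add_left, inner_smul_left, Complex.conj_ofReal, inner_sub_right]
      linear_combination h3)
    obtain ⟨h4, wr, wψ, hw⟩ := regularity hu hs0 hs1 hη hγ
    convert maps_family (etaS := etaS) hu h4 hγ hw using 1
    refine Prod.ext ?_ h2.symm
    symm
    exact sub_eq_zero.1 (eq_zero_of_inner_green fun χ =>
      (key hγ hw χ).symm.trans (h1 χ))

end Family

/-! ### Solution operators of a monotone family of forms -/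

section FormFamily

variable {H : Type*} [NormedAddCommGroup H] [InnerProductSpace ℂ H] [CompleteSpace H]

/-- A bounded coercive operator is invertible. -/
theorem exists_equiv_of_coercive {M : H →L[ℂ] H} {c : ℝ} (hc : 0 < c)
    (hM : ∀ x, c * ‖x‖ ^ 2 ≤ (inner ℂ (M x) x).re) : ∃ U : H ≃L[ℂ] H, ∀ x, U x = M x := by
  have hbound : ∀ x, c * ‖x‖ ≤ ‖M x‖ := fun x => by
    have h1 : (inner ℂ (M x) x).re ≤ ‖M x‖ * ‖x‖ := (Complex.re_le_norm _).trans (norm_inner_le_norm _ _)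
    rcases (norm_nonneg x).eq_or_lt with h0 | h0
    · rw [← h0]; simp
    · have := (hM x).trans h1
      nlinarith
  have hanti : AntilipschitzWith (Real.toNNReal c⁻¹) M := by
    refine M.antilipschitz_of_bound fun x => ?_
    rw [Real.coe_toNNReal _ (by positivity)]
    have := hbound x
    field_simp
    linarith
  have hker : M.ker = ⊥ := LinearMap.ker_eq_bot.2 hanti.injective
  have hrange : M.range = ⊤ := by
    have hcl : IsClosed (M.range : Set H) := hanti.isClosed_range M.uniformContinuous
    rw [← hcl.submodule_topologicalClosure_eq, Submodule.topologicalClosure_eq_top_iff,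
      Submodule.eq_bot_iff]
    intro x hx
    have h2 := (Submodule.mem_orthogonal _ x).1 hx (M x) ⟨x, rfl⟩
    have h3 := hM x
    rw [h2] at h3
    have : ‖x‖ ^ 2 ≤ 0 := by
      simp only [Complex.zero_re] at h3
      nlinarith
    exact norm_eq_zero.1 (pow_eq_zero_iff two_ne_zero |>.1 (le_antisymm this (sq_nonneg _)))
  exact ⟨ContinuousLinearEquiv.ofBijective M hker hrange, fun _ => rfl⟩

/-- The inverses of ordered positive operators are ordered the other way round. -/
theorem re_inner_inverse_anti {M M' : H →L[ℂ] H} (hsymm : ∀ x y, inner ℂ (M x) y = inner ℂ x (M y))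
    (hpos : ∀ x, 0 ≤ (inner ℂ (M x) x).re)
    (hle : ∀ x, (inner ℂ (M x) x).re ≤ (inner ℂ (M' x) x).re) {a b ξ : H} (ha : M a = ξ)
    (hb : M' b = ξ) : (inner ℂ b ξ).re ≤ (inner ℂ a ξ).re := by
  -- 0 ≤ (M(a - b), a - b) = (a, ξ) - 2 Re(b, ξ) + (Mb, b), and (Mb, b) ≤ (M'b, b) = (ξ, b), in real
  -- parts.
  have h1 := hpos (a - b)
  have h2 := hle b
  rw [map_sub, inner_sub_left, inner_sub_right, inner_sub_right, hsymm b a, ha] at h1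
  rw [hb] at h2
  have e1 : (inner ℂ ξ a).re = (inner ℂ a ξ).re := by
    rw [← inner_conj_symm ξ a, Complex.conj_re]
  have e2 : (inner ℂ ξ b).re = (inner ℂ b ξ).re := by
    rw [← inner_conj_symm ξ b, Complex.conj_re]
  simp only [Complex.sub_re] at h1
  linarith

/-- The solution operators of a family of eigenvalue problems
`s ⟨S v, S y⟩ + (1 - s) ⟨v, N y⟩ = z ⟨Φ v, Φ y⟩`. -/
theorem exists_solution_operators {Φ S N : H →L[ℂ] H} (hΦc : IsCompactOperator Φ)
    (hΦd : ∀ x, (∀ y, inner ℂ (Φ y) x = 0) → x = 0)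
    (hN : ∀ x y, inner ℂ (N x) y = inner ℂ x (N y)) {c m : ℝ} (hc : 0 < c)
    (hco : ∀ x, c * ‖x‖ ^ 2 ≤ (inner ℂ (N x) x).re + m * ‖Φ x‖ ^ 2)
    (hSN : ∀ x, (inner ℂ (N x) x).re ≤ ‖S x‖ ^ 2) :
    ∃ T : Icc (0 : ℝ) 1 → H →L[ℂ] H, (∀ i, IsCompactOperator (T i)) ∧
      (∀ i, (T i : H →ₗ[ℂ] H).IsSymmetric) ∧ (∀ i x, x ≠ 0 → 0 < (inner ℂ (T i x) x).re) ∧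
      (∀ i j : Icc (0 : ℝ) 1, i ≤ j → ∀ x, (inner ℂ (T j x) x).re ≤ (inner ℂ (T i x) x).re) ∧
      ∀ (i : Icc (0 : ℝ) 1) (z : ℂ) (x : H), (z + m) • T i x = x ↔
        ∃ y, Φ y = x ∧ ∀ v, ((i : ℝ) : ℂ) * inner ℂ (S v) (S y) + (1 - ((i : ℝ) : ℂ)) * inner ℂ v (N y) =
          z * inner ℂ (Φ v) (Φ y) := by
  set M : Icc (0 : ℝ) 1 → H →L[ℂ] H := fun i =>
    ((i : ℝ) : ℂ) • (S.adjoint ∘L S) + ((1 - i : ℝ) : ℂ) • N + (m : ℂ) • (Φ.adjoint ∘L Φ) with hM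
  have hMv : ∀ i v y, inner ℂ v (M i y) = ((i : ℝ) : ℂ) * inner ℂ (S v) (S y) +
      (1 - ((i : ℝ) : ℂ)) * inner ℂ v (N y) + m * inner ℂ (Φ v) (Φ y) := by
    intro i v y
    simp only [hM, add_apply, smul_apply, ContinuousLinearMap.comp_apply, inner_add_right,
      inner_smul_right, ContinuousLinearMap.adjoint_inner_right]
    push_cast
    ring
  have hMs : ∀ i x y, inner ℂ (M i x) y = inner ℂ x (M i y) := by
    intro i x y
    rw [← inner_conj_symm, hMv, hMv]
    simp only [map_add, map_mul, map_sub, map_one, Complex.conj_ofReal, inner_conj_symm]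
    rw [hN]
  have hMre : ∀ i x, (inner ℂ (M i x) x).re = i * ‖S x‖ ^ 2 +
      (1 - i) * (inner ℂ (N x) x).re + m * ‖Φ x‖ ^ 2 := by
    intro i x
    rw [hMs, hMv, ← hN, inner_self_eq_norm_sq_to_K, inner_self_eq_norm_sq_to_K]
    have e1 : ∀ t : ℝ, ((t : ℂ) ^ 2) = ((t ^ 2 : ℝ) : ℂ) := fun t => by push_cast; ring
    simp only [Complex.coe_algebraMap, e1, Complex.add_re, Complex.re_ofReal_mul, Complex.ofReal_re, ← Complex.ofReal_one,
      ← Complex.ofReal_sub]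
  have hMmono : ∀ i j : Icc (0 : ℝ) 1, i ≤ j → ∀ x,
      (inner ℂ (M i x) x).re ≤ (inner ℂ (M j x) x).re := by
    intro i j hij x
    rw [hMre, hMre]
    have := hSN x
    have hij' : (i : ℝ) ≤ j := hij
    nlinarith
  -- Since ‖Sx‖² dominates the form of N, coercivity of the shifted N carries over to every convex
  -- combination, with the same constant.
  have hMco : ∀ i x, c * ‖x‖ ^ 2 ≤ (inner ℂ (M i x) x).re := by
    intro i x
    rw [hMre]
    have h1 := hSN x
    have h2 := hco x
    have hi : (0 : ℝ) ≤ i := i.2.1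
    nlinarith
  choose U hU using fun i => exists_equiv_of_coercive hc (hMco i)
  have hMU : ∀ i x, M i ((U i).symm x) = x := fun i x => by rw [← hU, (U i).apply_symm_apply]
  have hT : ∀ i x y, inner ℂ (Φ ((U i).symm (Φ.adjoint x))) y =
      inner ℂ ((U i).symm (Φ.adjoint x)) (Φ.adjoint y) := fun i x y =>
    (ContinuousLinearMap.adjoint_inner_right Φ _ _).symm
  -- T = Φ M⁻¹ Φ* inherits compactness from Φ, strict positivity from the dense range of Φ, and the
  -- reversed order from the inversion of M.
  refine ⟨fun i => Φ ∘L ((U i).symm : H →L[ℂ] H) ∘L Φ.adjoint, fun i => ?_, fun i x y => ?_,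
    fun i x hx => ?_, fun i j hij x => ?_, fun i z x => ?_⟩
  · exact hΦc.comp_clm (((U i).symm : H →L[ℂ] H) ∘L Φ.adjoint)
  · change inner ℂ (Φ ((U i).symm (Φ.adjoint x))) y = inner ℂ x (Φ ((U i).symm (Φ.adjoint y)))
    rw [hT, ← ContinuousLinearMap.adjoint_inner_left Φ ((U i).symm _) x]
    conv_lhs => rw [← hMU i (Φ.adjoint y)]
    rw [← hMs, hMU]
  · change 0 < (inner ℂ (Φ ((U i).symm (Φ.adjoint x))) x).re
    rw [hT]
    set a := (U i).symm (Φ.adjoint x) with ha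
    have h1 : Φ.adjoint x = M i a := (hMU i _).symm
    have h2 := hMco i a
    rw [h1, ← hMs]
    have h3 : a ≠ 0 := by
      intro h0
      rw [h0, map_zero] at h1
      exact hx (hΦd x fun y => by
        rw [← ContinuousLinearMap.adjoint_inner_right, h1, inner_zero_right])
    have h4 : 0 < ‖a‖ := norm_pos_iff.2 h3
    have : 0 < c * ‖a‖ ^ 2 := by positivity
    linarith
  · change (inner ℂ (Φ ((U j).symm (Φ.adjoint x))) x).re ≤ (inner ℂ (Φ ((U i).symm (Φ.adjoint x))) x).re
    rw [hT, hT]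
    refine re_inner_inverse_anti (hMs i) (fun y => ?_) (hMmono i j hij) (hMU i _) (hMU j _)
    exact le_trans (by positivity) (hMco i y)
  · change (z + m) • Φ ((U i).symm (Φ.adjoint x)) = x ↔ _
    have hweak : ∀ y, (∀ v, ((i : ℝ) : ℂ) * inner ℂ (S v) (S y) +
        (1 - ((i : ℝ) : ℂ)) * inner ℂ v (N y) = z * inner ℂ (Φ v) (Φ y)) ↔
        M i y = (z + m) • Φ.adjoint (Φ y) := by
      intro y
      constructor
      · intro h
        refine ext_inner_left ℂ fun v => ?_
        rw [hMv, h v, inner_smul_right, ContinuousLinearMap.adjoint_inner_right]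
        ring
      · intro h v
        have h1 := hMv i v y
        rw [h, inner_smul_right, ContinuousLinearMap.adjoint_inner_right] at h1
        linear_combination -h1
    simp only [hweak]
    constructor
    -- The witness (z + m) M⁻¹ Φ* x needs no division, so z = -m is not a special case.
    · intro h
      refine ⟨(z + m) • (U i).symm (Φ.adjoint x), by rw [map_smul, h], ?_⟩
      rw [map_smul Φ, h, map_smul, hMU]
    · rintro ⟨y, rfl, hy⟩
      rw [← map_smul, ← map_smul, ← hy, ← hU, (U i).symm_apply_apply]

end FormFamily

/-! ### Bounds for V and h -/

section PointwiseBounds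

variable {p : Params}

theorem norm_sq_eq_integral (u : Y p) : ‖u‖ ^ 2 = ∫ x in Ω p, ‖u x‖ ^ 2 := by
  have h1 : ((‖u‖ ^ 2 : ℝ) : ℂ) = inner ℂ u u := by
    rw [inner_self_eq_norm_sq_to_K]; simp
  have h2 : ((∫ x in Ω p, ‖u x‖ ^ 2 : ℝ) : ℂ) = inner ℂ u u := by
    rw [inner_eq_integral, ← integral_complex_ofReal]
    refine integral_congr_ae (Eventually.of_forall fun x => ?_)
    beta_reduce
    rw [Complex.mul_conj, Complex.normSq_eq_norm_sq]
  exact_mod_cast h1.trans h2.symm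

theorem integrable_norm_sq (u : Y p) : Integrable (fun x => ‖u x‖ ^ 2) (volume.restrict (Ω p)) :=
  (Lp.memLp u).integrable_norm_pow two_ne_zero

theorem re_inner_mulL_self {c : ℝ × ℝ → ℝ} (hc : Continuous c) (u : Y p) :
    (inner ℂ u (mulL p c u)).re = ∫ x in Ω p, c x * ‖u x‖ ^ 2 := by
  have h : inner ℂ u (mulL p c u) = ((∫ x in Ω p, c x * ‖u x‖ ^ 2 : ℝ) : ℂ) := by
    rw [inner_eq_integral, ← integral_complex_ofReal]
    refine integral_congr_ae ((coeFn_mulL hc u).mono fun x hx => ?_)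
    beta_reduce
    rw [hx, mul_assoc, Complex.mul_conj, Complex.normSq_eq_norm_sq]
    push_cast
    ring
  rw [h, Complex.ofReal_re]

theorem le_re_inner_mulL {c : ℝ × ℝ → ℝ} (hc : Continuous c) {m : ℝ} (hm : ∀ x ∈ Ω p, m ≤ c x)
    (u : Y p) : m * ‖u‖ ^ 2 ≤ (inner ℂ u (mulL p c u)).re := by
  obtain ⟨C, hC0, hC⟩ := exists_bound p hc
  rw [re_inner_mulL_self hc, norm_sq_eq_integral, ← integral_const_mul]
  refine integral_mono_ae ((integrable_norm_sq u).const_mul m)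
    ((integrable_norm_sq u).bdd_mul (c := C) hc.aestronglyMeasurable
      ((ae_mem_Ω p).mono fun x hx => hC x (Ω_subset_box p hx))) ?_
  filter_upwards [ae_mem_Ω p] with x hx
  exact mul_le_mul_of_nonneg_right (hm x hx) (by positivity)

variable [hp : p.Admissible]

theorem bddAbove_range_of_continuous {c d : ℝ × ℝ → ℝ} (hd : Continuous d)
    (h : ∀ x ∈ Ω p, c x = d x) : BddAbove (range fun x : Ω p => c x) ∧
      BddBelow (range fun x : Ω p => c x) := by
  obtain ⟨C, -, hC⟩ := exists_bound p hd
  have hb : ∀ x : Ω p, |c x| ≤ C := fun x => by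
    rw [h x x.2]; exact hC x (Ω_subset_box p x.2)
  constructor
  · refine ⟨C, ?_⟩
    rintro _ ⟨x, rfl⟩
    exact (abs_le.1 (hb x)).2
  · refine ⟨-C, ?_⟩
    rintro _ ⟨x, rfl⟩
    exact (abs_le.1 (hb x)).1

theorem coef_sq_le {x : ℝ × ℝ} (hx : x ∈ Ω p) :
    coefF p x ^ 2 + rad p x ^ 2 / 4 * coefG p x ^ 2 ≤ CV p ^ 2 := by
  have b1 := (bddAbove_range_of_continuous (p := p) (c := fun x => f p x ^ 2)
    (d := fun x => coefF p x ^ 2) (contDiff_coefF.continuous.pow 2)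
    fun x hx => by simp only [(coef_eq hx).1]).1
  have b2 := (bddAbove_range_of_continuous (p := p) (c := fun x => x.1 ^ 2 / 4 * g p x ^ 2)
    (d := fun x => rad p x ^ 2 / 4 * coefG p x ^ 2)
    (((continuous_rad.pow 2).div_const 4).mul (contDiff_coefG.continuous.pow 2))
    fun x hx => by simp only [(coef_eq hx).2.1, rad_eq hx]).1
  have h1 := le_ciSup b1 ⟨x, hx⟩
  have h2 := le_ciSup b2 ⟨x, hx⟩
  have h0 : 0 ≤ (⨆ x : Ω p, f p x ^ 2) + ⨆ x : Ω p, x.1.1 ^ 2 / 4 * g p x ^ 2 :=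
    add_nonneg (Real.iSup_nonneg fun _ => by positivity) (Real.iSup_nonneg fun _ => by positivity)
  rw [CV, Real.sq_sqrt h0, ← (coef_eq hx).1, ← (coef_eq hx).2.1, rad_eq hx]
  exact add_le_add h1 h2

/-- Cauchy–Schwarz pointwise for the pairs (f, rg/2) and (a, 2b/r). These weights match the
Dirichlet form of Δ̃ and explain the factor r²/4 in C_V. -/
theorem norm_transport_sq_le (a b : Y p) :
    ‖transport a b‖ ^ 2 ≤ CV p ^ 2 * (‖a‖ ^ 2 + 4 * ‖mulL p (radInv p) b‖ ^ 2) := by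
  simp only [norm_sq_eq_integral]
  rw [← integral_const_mul, ← integral_add (integrable_norm_sq _) ((integrable_norm_sq _).const_mul _),
    ← integral_const_mul]
  refine integral_mono_ae (integrable_norm_sq _)
    (((integrable_norm_sq _).add ((integrable_norm_sq _).const_mul _)).const_mul _) ?_
  filter_upwards [ae_mem_Ω p, Lp.coeFn_add (mulL p (coefF p) a) (mulL p (coefG p) b),
    coeFn_mulL (p := p) (contDiff_coefF (p := p)).continuous a, coeFn_mulL (p := p) (contDiff_coefG (p := p)).continuous b,
    coeFn_mulL (continuous_radInv (p := p)) b] with x hx h1 h2 h3 h4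
  simp only [transport, h1, Pi.add_apply, h2, h3, h4]
  have h5 := coef_sq_le hx
  have hr : rad p x ≠ 0 := rho_ne_zero (p := p) x.1
  have hri : radInv p x = (rad p x)⁻¹ := rfl
  set F := coefF p x
  set G := coefG p x
  set A := ‖a x‖ with hA
  set B := ‖b x‖ with hB
  have h6 : ‖(F : ℂ) * a x + (G : ℂ) * b x‖ ≤ |F| * A + |G| * B := by
    refine (norm_add_le _ _).trans_eq ?_
    rw [norm_mul, norm_mul, Complex.norm_real, Complex.norm_real, Real.norm_eq_abs, Real.norm_eq_abs]
  have h7 : ‖(radInv p x : ℂ) * b x‖ ^ 2 = (B / rad p x) ^ 2 := by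
    rw [norm_mul, Complex.norm_real, Real.norm_eq_abs, mul_pow, sq_abs, hri]
    field_simp
    rw [hB]
  rw [h7]
  have h8 : (|F| * A + |G| * B) ^ 2 ≤ (F ^ 2 + rad p x ^ 2 / 4 * G ^ 2) *
      (A ^ 2 + 4 * (B / rad p x) ^ 2) := by
    rw [← sq_abs F, ← sq_abs G]
    have e : (|F| ^ 2 + rad p x ^ 2 / 4 * |G| ^ 2) * (A ^ 2 + 4 * (B / rad p x) ^ 2) -
        (|F| * A + |G| * B) ^ 2 = (2 * |F| * (B / rad p x) - rad p x / 2 * |G| * A) ^ 2 := by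
      field_simp
      ring
    nlinarith [sq_nonneg (2 * |F| * (B / rad p x) - rad p x / 2 * |G| * A)]
  calc ‖(F : ℂ) * a x + (G : ℂ) * b x‖ ^ 2 ≤ (|F| * A + |G| * B) ^ 2 := by gcongr
    _ ≤ _ := h8
    _ ≤ _ := by gcongr

theorem norm_greenV_sq_le (φ : Y p) :
    ‖greenV p φ‖ ^ 2 ≤ -(CV p ^ 2 * (inner ℂ (green p φ) (mulL p (radInv p) φ)).re) := by
  have h1 := norm_transport_sq_le (greenR p φ) (greenP p φ)
  have h2 := congrArg Complex.re (dirichlet φ φ)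
  rw [inner_self_eq_norm_sq_to_K, inner_self_eq_norm_sq_to_K] at h2
  have h3 : ‖greenR p φ‖ ^ 2 + 4 * ‖mulL p (radInv p) (greenP p φ)‖ ^ 2 =
      -(inner ℂ (green p φ) (mulL p (radInv p) φ)).re := by
    rw [Complex.neg_re] at h2
    rw [← h2]
    have e1 : ∀ s t : ℝ, ((s : ℂ) ^ 2 + 4 * (t : ℂ) ^ 2) = ((s ^ 2 + 4 * t ^ 2 : ℝ) : ℂ) :=
      fun s t => by push_cast; ring
    simp only [Complex.coe_algebraMap, e1, Complex.ofReal_re]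
  rw [greenV_apply]
  rw [h3] at h1
  linarith

/-- The adjoint of V is -V - h, so the symmetric part of V is multiplication by -h/2. -/
theorem re_inner_greenV_self (φ : Y p) : 2 * (inner ℂ (green p φ) (greenV p φ)).re =
    -(inner ℂ (green p φ) (mulL p (coefH p) (green p φ))).re := by
  have h := congrArg Complex.re (inner_greenV (hasGrad_green φ) φ)
  rw [← greenV_apply, inner_add_left, inner_mulL, Complex.neg_re, Complex.add_re,
    ← inner_conj_symm (greenV p φ), Complex.conj_re] at h
  linarith

theorem inf_mul_le (lbar : ℝ) (u : Y p) : (⨅ x : Ω p, lbar * h p x) * ‖u‖ ^ 2 ≤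
    lbar * (inner ℂ u (mulL p (coefH p) u)).re := by
  have hc : Continuous (coefH p) := contDiff_coefH.continuous
  have hc' : Continuous fun x => lbar * coefH p x := continuous_const.mul hc
  have h1 := le_re_inner_mulL hc' (m := ⨅ x : Ω p, lbar * h p x) (fun x hx => by
      rw [← (coef_eq hx).2.2]
      exact ciInf_le (bddAbove_range_of_continuous (p := p) (c := fun x => lbar * h p x) hc'
        fun x hx => by rw [(coef_eq hx).2.2]).2 ⟨x, hx⟩) u
  rw [re_inner_mulL_self hc'] at h1
  rw [re_inner_mulL_self hc, ← integral_const_mul]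
  simpa only [mul_assoc] using h1

end PointwiseBounds

/-! ### The base form lies below ‖S(u, λ)‖² -/

section LowerBound

variable {p : Params} [hp : p.Admissible]

theorem normSq_eq (u : Y p) : normSq p u = pairConst p * ‖u‖ ^ 2 := by
  rw [normSq, pair_apply, inner_self_eq_norm_sq_to_K]
  have e1 : ((pairConst p : ℂ) * (‖u‖ : ℂ) ^ 2) = ((pairConst p * ‖u‖ ^ 2 : ℝ) : ℂ) := by
    push_cast; ring
  simp only [Complex.coe_algebraMap, e1, Complex.ofReal_re]

/-- With x = ‖a + b‖ and y = ‖b‖, the triangle inequality reduces the claim to the nonnegativity of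
(ηx - (1 - η)y)²/η. -/
theorem norm_add_sq_lower {E : Type*} [NormedAddCommGroup E] {η : ℝ} (hη : 0 < η)
    (hη1 : η < 1) (a b : E) :
    (1 - η) * ‖a‖ ^ 2 ≤ ‖a + b‖ ^ 2 + (1 - η) / η * ‖b‖ ^ 2 := by
  have h1 : ‖a‖ ≤ ‖a + b‖ + ‖b‖ := by simpa using norm_sub_le (a + b) b
  have h2 : ‖a‖ ^ 2 ≤ (‖a + b‖ + ‖b‖) ^ 2 := by gcongr
  set x := ‖a + b‖
  set y := ‖b‖
  have h3 : x ^ 2 + (1 - η) / η * y ^ 2 - (1 - η) * (x + y) ^ 2 = (η * x - (1 - η) * y) ^ 2 / η := by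
    field_simp
    ring
  have h4 : 0 ≤ (η * x - (1 - η) * y) ^ 2 / η := by positivity
  nlinarith

theorem inner_A_green (lbar : ℝ) (φ χ : Y p) :
    inner ℂ (((p.σ ^ 2 / 2 : ℝ) : ℂ) • mulL p (radInv p) φ + greenV p φ - (lbar : ℂ) • green p φ)
      (green p χ) = inner ℂ (green p φ) (((p.σ ^ 2 / 2 : ℝ) : ℂ) • mulL p (radInv p) χ -
        transport (greenR p χ) (greenP p χ) - mulL p (coefH p) (green p χ) -
          (lbar : ℂ) • green p χ) := by
  have h1 := inner_greenV_left (hasGrad_green χ) φ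
  simp only [inner_add_left, inner_sub_left, inner_smul_left, inner_add_right, inner_sub_right,
    inner_smul_right, Complex.conj_ofReal] at h1 ⊢
  rw [inner_radInv_green, h1]
  ring

/-- The base form bounds `‖S(u, l)‖²` from below. -/
theorem base_le_residual {ubar : Y p} (hu : ubar ∈ X p) (lbar : ℝ) {etaL etaS : ℝ}
    (hL : 0 < etaL) (hL1 : etaL < 1) (hS : 0 < etaS) (φ : Y p) (l : ℂ) :
    s2 p etaL * ‖mulL p (radInv p) φ‖ ^ 2 +
      s1 p lbar etaL * (inner ℂ (green p φ) (mulL p (radInv p) φ)).re +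
      s0 p ubar lbar etaS * ‖green p φ‖ ^ 2 + (pairConst p)⁻¹ * sl p ubar etaS * ‖l‖ ^ 2 ≤
      ‖residual p ubar lbar φ l‖ ^ 2 := by
  obtain ⟨χ, rfl⟩ := exists_eq_green hu
  set P := mulL p (radInv p) φ with hP
  set u := green p φ with hu'
  set v := greenV p φ with hv
  set W := ((p.σ ^ 2 / 2 : ℝ) : ℂ) • P + v with hW
  set ad := ((p.σ ^ 2 / 2 : ℝ) : ℂ) • mulL p (radInv p) χ -
    transport (greenR p χ) (greenP p χ) - mulL p (coefH p) (green p χ) - (lbar : ℂ) • green p χ with had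
  have hval : value (Astar p lbar) (green p χ) = ad :=
    (maps_Astar (hasGrad_green χ) (maps_lap_green χ)).value_eq
  have hκ := pairConst_pos (p := p)
  -- Separating the second order part from Vu costs the factor 1 - ηL, which gives s₂. The price in
  -- ‖Vu‖² is paid by the Dirichlet form and gives the C_V² term of s₁.
  have n1 := norm_add_sq_lower hL hL1 (((p.σ ^ 2 / 2 : ℝ) : ℂ) • P) v
  rw [norm_smul, Complex.norm_real, Real.norm_eq_abs, mul_pow, sq_abs] at n1
  have n2 := mul_le_mul_of_nonneg_left (norm_greenV_sq_le φ)
    (div_nonneg (sub_nonneg.2 hL1.le) hL.le)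
  have n3 := norm_sub_sq (𝕜 := ℂ) W ((lbar : ℂ) • u)
  -- The cross term with λ̄u supplies -λ̄σ² in s₁ through Δ̃ and inf(λ̄h) in s₀ through V.
  have n4 : (inner ℂ W ((lbar : ℂ) • u)).re = lbar * (p.σ ^ 2 / 2 * (inner ℂ u P).re + (inner ℂ u v).re) := by
    rw [inner_smul_right, Complex.re_ofReal_mul, ← inner_conj_symm, Complex.conj_re, hW, inner_add_right,
      inner_smul_right, Complex.add_re, Complex.re_ofReal_mul]
  have n4' := re_inner_greenV_self φ
  have n5 := inf_mul_le lbar u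
  have n6 := norm_sub_sq (𝕜 := ℂ) (W - (lbar : ℂ) • u) (l • green p χ)
  have n7 : (inner ℂ (W - (lbar : ℂ) • u) (l • green p χ)).re ≤ ‖l‖ * (‖u‖ * ‖ad‖) := by
    rw [inner_smul_right, hW, hP, hv, hu', inner_A_green]
    refine (Complex.re_le_norm _).trans ?_
    rw [norm_mul]
    gcongr
    exact norm_inner_le_norm _ _
  -- Young's inequality with weight ηS splits the coupling of u and l between s_λ and s₀. Powers of
  -- `pairConst` convert between the L² norm and the normalized one.
  have n8 : 2 * (‖l‖ * (‖u‖ * ‖ad‖)) ≤ (pairConst p)⁻¹ * etaS * ‖l‖ ^ 2 +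
      1 / etaS * (pairConst p * ‖ad‖ ^ 2) * ‖u‖ ^ 2 := by
    set κ := pairConst p
    have e : (κ)⁻¹ * etaS * ‖l‖ ^ 2 + 1 / etaS * (κ * ‖ad‖ ^ 2) * ‖u‖ ^ 2 -
        2 * (‖l‖ * (‖u‖ * ‖ad‖)) = (etaS * ‖l‖ - κ * ‖ad‖ * ‖u‖) ^ 2 / (κ * etaS) := by
      field_simp
      ring
    have : 0 ≤ (etaS * ‖l‖ - κ * ‖ad‖ * ‖u‖) ^ 2 / (κ * etaS) := by positivity
    linarith
  have e2 : (pairConst p)⁻¹ * sl p (green p χ) etaS * ‖l‖ ^ 2 =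
      ‖l‖ ^ 2 * ‖green p χ‖ ^ 2 - (pairConst p)⁻¹ * etaS * ‖l‖ ^ 2 := by
    rw [sl, normSq_eq]
    field_simp
  have hres : residual p (green p χ) lbar φ l = W - (lbar : ℂ) • u - l • green p χ := rfl
  rw [hres, n6, n3, e2, s2, s1, s0, hval, normSq_eq]
  simp only [RCLike.re_to_complex] at *
  rw [n4, norm_smul, norm_smul, Complex.norm_real, Real.norm_eq_abs, mul_pow, sq_abs, mul_pow]
  have e3 : lbar * (2 * (inner ℂ u v).re) = -(lbar * (inner ℂ u (mulL p (coefH p) u)).re) := by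
    rw [n4']; ring
  have e4 : (1 - etaL) * ((p.σ ^ 2 / 2) ^ 2 * ‖P‖ ^ 2) = (1 - etaL) * (p.σ ^ 4 / 4) * ‖P‖ ^ 2 := by
    ring
  rw [e4] at n1
  nlinarith

end LowerBound

/-! ### Compactness of the solution operator -/

section GreenCompact

variable {p : Params} [hp : p.Admissible]

/-- Since μ dominates both ν and |k|, only finitely many index pairs have μ below a given bound. -/
theorem tendsto_inv_mu : Tendsto (fun i => (-1 : ℂ) / mu p i) cofinite (𝓝 0) := by
  have hfin : ∀ C : ℝ, {i : ℕ × ℤ | mu p i ≤ C}.Finite := fun C => by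
    obtain ⟨n, hn⟩ := exists_nat_gt (C / (Real.pi / ell p))
    have hell : 0 < Real.pi / ell p := by
      have := nu_pos (p := p) 0
      unfold nu at this
      simpa using this
    rw [div_lt_iff₀ hell] at hn
    refine ((Set.finite_Iic n).prod (Set.finite_Icc (-⌈C⌉) ⌈C⌉)).subset ?_
    rintro ⟨j, k⟩ hi
    have hi : mu p (j, k) ≤ C := hi
    obtain ⟨h1, h2, -⟩ := abs_le_mu (p := p) (j, k)
    refine ⟨?_, ?_⟩
    · rw [mem_Iic]
      by_contra! hlt
      have h3 : (n : ℝ) ≤ j := by exact_mod_cast hlt.le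
      have h4 : nu p j = (j + 1) * (Real.pi / ell p) := by unfold nu; ring
      have h5 : nu p j ≤ C := h2.trans hi
      nlinarith
    · have h3 : |(k : ℝ)| ≤ ⌈C⌉ := (h1.trans hi).trans (Int.le_ceil C)
      have h4 : |k| ≤ ⌈C⌉ := by exact_mod_cast h3
      exact abs_le.1 h4
  have hmu : Tendsto (fun i => mu p i) cofinite atTop := by
    refine tendsto_atTop.2 fun C => ?_
    rw [eventually_cofinite]
    exact (hfin C).subset fun i hi => (not_le.1 hi).le
  rw [tendsto_zero_iff_norm_tendsto_zero]
  have h1 := tendsto_inv_atTop_zero.comp hmu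
  refine h1.congr fun i => ?_
  rw [Function.comp_apply, norm_div, norm_neg, norm_one, Complex.norm_real, Real.norm_eq_abs,
    abs_of_pos (mu_pos i), one_div]

theorem isCompactOperator_green : IsCompactOperator (green p) := by
  have h1 := isCompactOperator_diagOp (basis p) (orthonormal_basisFun (p := p))
    (tendsto_inv_mu (p := p)) (exists_bound_div_mu fun i => by
      have := mu_ge (p := p) i
      rw [norm_neg, norm_one]; linarith)
  exact h1.clm_comp (mulL p (rad p))

theorem not_finiteDimensional : ¬ FiniteDimensional ℂ (Y p) := fun h => by
  have := (basis p).orthonormal.linearIndependent.finite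
  exact not_finite (ℕ × ℤ)

theorem norm_le_radInv (u : Y p) : ‖u‖ ≤ p.rmax * ‖mulL p (radInv p) u‖ := by
  conv_lhs => rw [← mulL_rad_radInv u]
  refine norm_mulL_le continuous_rad (fun x hx => ?_) _
  rw [rad_eq hx, Real.norm_eq_abs, abs_of_pos (hp.rmin_pos.trans hx.1.1)]
  exact hx.1.2.le

end GreenCompact

/-! ### The Hilbert space Y × ℂ -/

section ProductSpace

variable (p : Params)

/-- The Hilbert space `Y × ℂ`. -/
abbrev PairSpace : Type := WithLp 2 (Y p × ℂ)

/-- An operator in `Y × ℂ` as an operator in the Hilbert space `PairSpace`. -/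
def toPair (A : Y p × ℂ →L[ℂ] Y p × ℂ) : PairSpace p →L[ℂ] PairSpace p :=
  (WithLp.prodContinuousLinearEquiv 2 ℂ (Y p) ℂ).symm.toContinuousLinearMap ∘L A ∘L
    (WithLp.prodContinuousLinearEquiv 2 ℂ (Y p) ℂ).toContinuousLinearMap

variable {p}

theorem toPair_apply (A : Y p × ℂ →L[ℂ] Y p × ℂ) (x : Y p × ℂ) :
    toPair p A (WithLp.toLp 2 x) = WithLp.toLp 2 (A x) := rfl

theorem inner_toLp (x y : Y p × ℂ) :
    inner ℂ (WithLp.toLp 2 x : PairSpace p) (WithLp.toLp 2 y) =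
      inner ℂ x.1 y.1 + inner ℂ x.2 y.2 := rfl

theorem norm_toLp_sq (x : Y p × ℂ) :
    ‖(WithLp.toLp 2 x : PairSpace p)‖ ^ 2 = ‖x.1‖ ^ 2 + ‖x.2‖ ^ 2 :=
  WithLp.prod_norm_sq_eq_of_L2 _

theorem isCompactOperator_toPair_prodMap {G : Y p →L[ℂ] Y p} (hG : IsCompactOperator G) :
    IsCompactOperator (toPair p (G.prodMap (.id ℂ ℂ))) := by
  have h1 : IsCompactOperator (ContinuousLinearMap.id ℂ ℂ) :=
    isCompactOperator_of_locallyCompactSpace_dom _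
  have h2 : IsCompactOperator (G.prodMap (ContinuousLinearMap.id ℂ ℂ)) := by
    have h3 := ((hG.comp_clm (ContinuousLinearMap.fst ℂ (Y p) ℂ)).clm_comp
      (ContinuousLinearMap.inl ℂ (Y p) ℂ)).add
      ((h1.comp_clm (ContinuousLinearMap.snd ℂ (Y p) ℂ)).clm_comp
      (ContinuousLinearMap.inr ℂ (Y p) ℂ))
    refine (congrArg IsCompactOperator (funext fun x => ?_)).mp h3
    exact Prod.ext (add_zero _) (zero_add _)
  exact (h2.comp_clm (WithLp.prodContinuousLinearEquiv 2 ℂ (Y p) ℂ).toContinuousLinearMap).clm_comp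
    (WithLp.prodContinuousLinearEquiv 2 ℂ (Y p) ℂ).symm.toContinuousLinearMap

end ProductSpace

/-! ### The eigenvalues of the family -/

section SolutionFamily

variable {p : Params} [hp : p.Admissible]

variable (p) in
/-- The scale factor between the norm of `ℂ` and the norm that `pair` prescribes. -/
def pairScale : ℝ := Real.sqrt (pairConst p)⁻¹

theorem pairScale_pos : 0 < pairScale p := Real.sqrt_pos.2 (inv_pos.2 pairConst_pos)

theorem pairScale_sq : pairScale p ^ 2 = (pairConst p)⁻¹ :=
  Real.sq_sqrt (inv_pos.2 pairConst_pos).le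

theorem pairConst_eq : (pairConst p : ℂ) = ((pairScale p : ℂ)⁻¹) ^ 2 := by
  rw [inv_pow, ← Complex.ofReal_pow, pairScale_sq, Complex.ofReal_inv, inv_inv]

variable (p) in
/-- `(φ, k) ↦ (Au - λū, ⟨u, ū⟩)` in the scaled norm, where `u = green φ` and `k` is the scaled `λ`. -/
def residualMap (ubar : Y p) (lbar : ℝ) : Y p × ℂ →L[ℂ] Y p × ℂ :=
  ((((p.σ ^ 2 / 2 : ℝ) : ℂ) • mulL p (radInv p) + greenV p - (lbar : ℂ) • green p).coprod
    ((ContinuousLinearMap.toSpanSingleton ℂ (-((pairScale p : ℂ)⁻¹ • ubar))))).prod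
    (((pairScale p : ℂ)⁻¹ • (innerSL ℂ ubar ∘L green p)) ∘L ContinuousLinearMap.fst ℂ (Y p) ℂ)

theorem residualMap_apply (ubar : Y p) (lbar : ℝ) (φ : Y p) (k : ℂ) :
    residualMap p ubar lbar (φ, k) = (residual p ubar lbar φ ((pairScale p : ℂ)⁻¹ * k),
      (pairScale p : ℂ)⁻¹ * inner ℂ ubar (green p φ)) := by
  refine Prod.ext ?_ ?_
  · simp [residualMap, residual, smul_smul, mul_comm, sub_eq_add_neg]
    rfl
  · simp [residualMap]

variable (p) in
/-- The form operator of the first component of the base operator. -/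
def baseOp (ubar : Y p) (lbar etaL etaS : ℝ) : Y p →L[ℂ] Y p :=
  (s2 p etaL : ℂ) • (mulL p (radInv p) ∘L mulL p (radInv p)) +
    -- The adjoint moves `green` to the test vector, so that this term represents ⟨v, Δ̃u⟩.
    (s1 p lbar etaL : ℂ) • (mulL p (radInv p) ∘L green p).adjoint +
    (s0 p ubar lbar etaS : ℂ) • ((green p).adjoint ∘L green p)

theorem inner_baseOp (ubar : Y p) (lbar etaL etaS : ℝ) (χ φ : Y p) :
    inner ℂ χ (baseOp p ubar lbar etaL etaS φ) =
      s2 p etaL * inner ℂ (mulL p (radInv p) χ) (mulL p (radInv p) φ) +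
      s1 p lbar etaL * inner ℂ (green p χ) (mulL p (radInv p) φ) +
      s0 p ubar lbar etaS * inner ℂ (green p χ) (green p φ) := by
  simp only [baseOp, _root_.add_apply, _root_.smul_apply,
    ContinuousLinearMap.comp_apply, inner_add_right, inner_smul_right,
    ContinuousLinearMap.adjoint_inner_right, inner_mulL]

theorem baseOp_symm (ubar : Y p) (lbar etaL etaS : ℝ) (χ φ : Y p) :
    inner ℂ (baseOp p ubar lbar etaL etaS χ) φ = inner ℂ χ (baseOp p ubar lbar etaL etaS φ) := by
  rw [← inner_conj_symm, inner_baseOp, inner_baseOp]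
  simp only [map_add, map_mul, Complex.conj_ofReal, inner_conj_symm, inner_radInv_green]

theorem s2_pos {etaL : ℝ} (h : etaL < 1) : 0 < s2 p etaL := by
  have := hp.σ_pos
  have := sub_pos.2 h
  unfold s2
  positivity

/-- Half of s₂‖Δ̃u‖² absorbs the indefinite term s₁⟨u, Δ̃u⟩ by Young's inequality. The other half
controls φ = rΔ̃u, since r < rmax. -/
theorem baseOp_coercive (ubar : Y p) (lbar : ℝ) {etaL : ℝ} (hL : etaL < 1) (etaS : ℝ) (φ : Y p) :
    s2 p etaL / (2 * p.rmax ^ 2) * ‖φ‖ ^ 2 ≤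
      (inner ℂ φ (baseOp p ubar lbar etaL etaS φ)).re +
        (s1 p lbar etaL ^ 2 / (2 * s2 p etaL) + |s0 p ubar lbar etaS|) * ‖green p φ‖ ^ 2 := by
  have hs := s2_pos (p := p) hL
  have hr : 0 < p.rmax := hp.rmin_pos.trans hp.rmin_lt
  have hφ := norm_le_radInv φ
  have hre : ∀ (c : ℝ) (w : ℂ), ((c : ℂ) * w).re = c * w.re := fun c w => Complex.re_ofReal_mul c w
  have hn : ∀ u : Y p, (inner ℂ u u).re = ‖u‖ ^ 2 := fun u => by
    rw [inner_self_eq_norm_sq_to_K]; norm_cast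
  have hc : |(inner ℂ (green p φ) (mulL p (radInv p) φ)).re| ≤
      ‖green p φ‖ * ‖mulL p (radInv p) φ‖ :=
    (Complex.abs_re_le_norm _).trans (norm_inner_le_norm _ _)
  rw [inner_baseOp, Complex.add_re, Complex.add_re, hre, hre, hre, hn, hn]
  set P := ‖mulL p (radInv p) φ‖
  set G := ‖green p φ‖
  set q := (inner ℂ (green p φ) (mulL p (radInv p) φ)).re
  set a := s1 p lbar etaL
  set b := s0 p ubar lbar etaS
  set c := s2 p etaL
  have h1 : ‖φ‖ ^ 2 ≤ (p.rmax * P) ^ 2 := pow_le_pow_left₀ (norm_nonneg _) hφ 2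
  have h2 : c / (2 * p.rmax ^ 2) * ‖φ‖ ^ 2 ≤ c / 2 * P ^ 2 := by
    refine (mul_le_mul_of_nonneg_left h1 (by positivity)).trans_eq ?_
    field_simp
  have h3 : |a * q| ≤ c / 2 * P ^ 2 + a ^ 2 / (2 * c) * G ^ 2 := by
    rw [abs_mul]
    refine (mul_le_mul_of_nonneg_left hc (abs_nonneg a)).trans ?_
    rw [← sq_abs a]
    have h4 : c / 2 * P ^ 2 + |a| ^ 2 / (2 * c) * G ^ 2 - |a| * (G * P) =
        (c * P - |a| * G) ^ 2 / (2 * c) := by field_simp; ring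
    have : 0 ≤ (c * P - |a| * G) ^ 2 / (2 * c) := by positivity
    linarith
  have h5 := (abs_le.1 h3).1
  have h6 : 0 ≤ (b + |b|) * G ^ 2 :=
    mul_nonneg (by linarith [neg_abs_le b]) (sq_nonneg _)
  linarith

/-- The eigenvalue equation in weak form, on the Hilbert space `Y × ℂ`. -/
theorem mem_eigenspace_family_iff_form {ubar : Y p} (hu : ubar ∈ X p) {lbar etaL etaS s : ℝ}
    (hs0 : 0 ≤ s) (hs1 : s ≤ 1) (hη : etaL < 1) {z : ℂ} (φ : Y p) (l : ℂ) :
    (green p φ, l) ∈ eigenspace (family p ubar lbar etaL etaS s) z ↔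
      ∀ (χ : Y p) (k : ℂ), (s : ℂ) *
        (inner ℂ (residualMap p ubar lbar (χ, k)).1
            (residualMap p ubar lbar (φ, pairScale p * l)).1 +
          inner ℂ (residualMap p ubar lbar (χ, k)).2
            (residualMap p ubar lbar (φ, pairScale p * l)).2) +
        (1 - (s : ℂ)) * (inner ℂ χ (baseOp p ubar lbar etaL etaS φ) +
          inner ℂ k (sl p ubar etaS * (pairScale p * l))) =
      z * (inner ℂ (green p χ) (green p φ) + inner ℂ k (pairScale p * l)) := by
  rw [mem_eigenspace_family_iff hu hs0 hs1 hη]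
  have hτ : (pairScale p : ℂ) ≠ 0 := by exact_mod_cast (pairScale_pos (p := p)).ne'
  -- The defect of the form equation splits into the defect of the first component, tested with χ,
  -- plus a multiple of conj(k) times that of the second. So k = 0, and then (χ, k) = (0, 1),
  -- recover the two equations.
  have key : ∀ (χ : Y p) (k : ℂ), (s : ℂ) *
        (inner ℂ (residualMap p ubar lbar (χ, k)).1
            (residualMap p ubar lbar (φ, pairScale p * l)).1 +
          inner ℂ (residualMap p ubar lbar (χ, k)).2
            (residualMap p ubar lbar (φ, pairScale p * l)).2) +
        (1 - (s : ℂ)) * (inner ℂ χ (baseOp p ubar lbar etaL etaS φ) +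
          inner ℂ k (sl p ubar etaS * (pairScale p * l))) -
      z * (inner ℂ (green p χ) (green p φ) + inner ℂ k (pairScale p * l)) =
      (inner ℂ (mulL p (radInv p) χ) (flux p ubar lbar etaL s φ l) +
        s * inner ℂ (greenV p χ) (residual p ubar lbar φ l) +
        inner ℂ (green p χ) (lowerOrder ubar lbar etaL etaS s φ l z)) +
      (starRingEnd ℂ k * pairScale p) * (-(s : ℂ) * ((pairConst p : ℂ) *
        inner ℂ ubar (residual p ubar lbar φ l)) + (1 - (s : ℂ)) * ((sl p ubar etaS : ℂ) * l) -
        z * l) := by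
    intro χ k
    have hres : residual p ubar lbar χ ((pairScale p : ℂ)⁻¹ * k) =
        ((p.σ ^ 2 / 2 : ℝ) : ℂ) • mulL p (radInv p) χ + greenV p χ - (lbar : ℂ) • green p χ -
          ((pairScale p : ℂ)⁻¹ * k) • ubar := rfl
    rw [residualMap_apply, residualMap_apply, inv_mul_cancel_left₀ hτ, inner_baseOp, hres,
      pairConst_eq]
    set w := residual p ubar lbar φ l
    simp only [flux, lowerOrder, inner_add_left, inner_sub_left, inner_add_right, inner_sub_right,
      inner_smul_left, inner_smul_right, RCLike.inner_apply, map_mul, map_inv₀,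
      Complex.conj_ofReal, inner_conj_symm, pairConst_eq, Complex.ofReal_mul, Complex.ofReal_sub,
      Complex.ofReal_one]
    field_simp
    ring
  constructor
  · rintro ⟨h1, h2⟩ χ k
    rw [← sub_eq_zero, key, h1, h2, sub_self, mul_zero, add_zero]
  · intro h
    have h0 : ∀ χ k, _ := fun χ k => (key χ k).symm.trans (sub_eq_zero.2 (h χ k))
    have h1 : ∀ χ, _ := fun χ => h0 χ 0
    simp only [map_zero, zero_mul, add_zero] at h1
    refine ⟨h1, sub_eq_zero.1 ?_⟩
    have h2 := h0 0 1
    rw [h1 0, zero_add, map_one, one_mul] at h2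
    exact (mul_eq_zero.1 h2).resolve_left hτ

variable (p) in
/-- `(u, l) ↦ (u, τ l)`, with `τ` the scale factor. -/
def scaleEquiv : (Y p × ℂ) ≃ₗ[ℂ] PairSpace p :=
  (LinearEquiv.prodCongr (LinearEquiv.refl ℂ (Y p)) (LinearEquiv.smulOfNeZero ℂ ℂ (pairScale p : ℂ)
    (by exact_mod_cast (pairScale_pos (p := p)).ne'))).trans (WithLp.linearEquiv 2 ℂ (Y p × ℂ)).symm

theorem scaleEquiv_apply (u : Y p) (l : ℂ) :
    scaleEquiv p (u, l) = WithLp.toLp 2 (u, (pairScale p : ℂ) * l) := rfl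

/-- The eigenvalues of the family, ordered and compared. -/
theorem exists_eigenvalues_family {ubar : Y p} (hu : ubar ∈ X p) (lbar : ℝ) {etaL etaS : ℝ}
    (hL : 0 < etaL) (hL1 : etaL < 1) (hS : 0 < etaS) (hS1 : etaS < normSq p ubar) :
    ∃ eig : Icc (0 : ℝ) 1 → ℕ → ℝ,
      (∀ s : Icc (0 : ℝ) 1, IsOrderedEigenvalues (family p ubar lbar etaL etaS s) (eig s)) ∧
      ∀ t s, t ≤ s → ∀ n, eig t n ≤ eig s n := by
  have hsl : 0 < sl p ubar etaS := sub_pos.2 hS1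
  have hs2 := s2_pos (p := p) hL1
  have hr : 0 < p.rmax := hp.rmin_pos.trans hp.rmin_lt
  have hτ : (pairScale p : ℂ) ≠ 0 := by exact_mod_cast (pairScale_pos (p := p)).ne'
  have hnorm : ∀ k : ℂ, ‖(pairScale p : ℂ)⁻¹ * k‖ ^ 2 = pairConst p * ‖k‖ ^ 2 := fun k => by
    rw [norm_mul, norm_inv, Complex.norm_real, mul_pow, inv_pow, Real.norm_eq_abs, sq_abs,
      pairScale_sq, inv_inv]
  have hin : ∀ k : ℂ, (inner ℂ k ((sl p ubar etaS : ℂ) * k)).re = sl p ubar etaS * ‖k‖ ^ 2 :=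
    fun k => by
      rw [← smul_eq_mul, inner_smul_right, inner_self_eq_norm_sq_to_K, Complex.re_ofReal_mul]
      norm_cast
  set m := s1 p lbar etaL ^ 2 / (2 * s2 p etaL) + |s0 p ubar lbar etaS|
  have hm : 0 ≤ m := by positivity
  set Φ := toPair p ((green p).prodMap (.id ℂ ℂ)) with hΦ
  set S := toPair p (residualMap p ubar lbar) with hSdef
  set N := toPair p ((baseOp p ubar lbar etaL etaS).prodMap
    ((sl p ubar etaS : ℂ) • .id ℂ ℂ)) with hN
  have hΦa : ∀ φ k, Φ (WithLp.toLp 2 (φ, k)) = WithLp.toLp 2 (green p φ, k) := fun _ _ => rfl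
  have hNa : ∀ φ k, N (WithLp.toLp 2 (φ, k)) =
    WithLp.toLp 2 (baseOp p ubar lbar etaL etaS φ, (sl p ubar etaS : ℂ) * k) := fun _ _ => rfl
  have hNsymm : ∀ x y, inner ℂ (N x) y = inner ℂ x (N y) := by
    rintro ⟨φ, k⟩ ⟨χ, l⟩
    rw [hNa, hNa, inner_toLp, inner_toLp, baseOp_symm]
    simp only [RCLike.inner_apply, map_mul, Complex.conj_ofReal]
    ring
  have hNre : ∀ φ k, (inner ℂ (N (WithLp.toLp 2 (φ, k))) (WithLp.toLp 2 (φ, k))).re =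
      (inner ℂ φ (baseOp p ubar lbar etaL etaS φ)).re + sl p ubar etaS * ‖k‖ ^ 2 := fun φ k => by
    rw [hNsymm, hNa, inner_toLp, Complex.add_re, hin]
  obtain ⟨T, hTc, hTs, hTp, hTm, hT⟩ := exists_solution_operators (Φ := Φ) (S := S) (N := N)
    (isCompactOperator_toPair_prodMap isCompactOperator_green)
    (by
      rintro ⟨x, k⟩ h
      have h1 : x = 0 := eq_zero_of_inner_green fun φ => by
        have := h (WithLp.toLp 2 (φ, 0))
        rwa [hΦa, inner_toLp, inner_zero_left, add_zero] at this
      have h2 : k = 0 := by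
        have := h (WithLp.toLp 2 (0, 1))
        rw [hΦa, inner_toLp, map_zero, inner_zero_left, zero_add] at this
        simpa using this
      rw [h1, h2]; rfl)
    hNsymm (c := min (s2 p etaL / (2 * p.rmax ^ 2)) (sl p ubar etaS)) (m := m)
    (lt_min (by positivity) hsl)
    (by
      rintro ⟨φ, k⟩
      rw [hNre, hΦa, norm_toLp_sq, norm_toLp_sq]
      have h1 := baseOp_coercive ubar lbar hL1 etaS φ
      have h2 := mul_le_mul_of_nonneg_right
        (min_le_left (s2 p etaL / (2 * p.rmax ^ 2)) (sl p ubar etaS)) (sq_nonneg ‖φ‖)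
      have h3 := mul_le_mul_of_nonneg_right
        (min_le_right (s2 p etaL / (2 * p.rmax ^ 2)) (sl p ubar etaS)) (sq_nonneg ‖k‖)
      have h4 := mul_nonneg hm (sq_nonneg ‖k‖)
      simp only
      linarith)
    (by
      rintro ⟨φ, k⟩
      rw [hNre, hSdef, toPair_apply, norm_toLp_sq, residualMap_apply, inner_baseOp]
      have h1 := base_le_residual hu lbar hL hL1 hS φ ((pairScale p : ℂ)⁻¹ * k)
      have h2 : (pairConst p)⁻¹ * sl p ubar etaS * (pairConst p * ‖k‖ ^ 2) =
          sl p ubar etaS * ‖k‖ ^ 2 := by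
        have := (pairConst_pos (p := p)).ne'
        field_simp
      have hn : ∀ u : Y p, (inner ℂ u u).re = ‖u‖ ^ 2 := fun u => by
        rw [inner_self_eq_norm_sq_to_K]; norm_cast
      rw [hnorm, h2] at h1
      simp only [Complex.add_re, Complex.re_ofReal_mul, hn]
      -- The second component of S contributes only this nonnegative term, which the lower bound
      -- discards.
      have := sq_nonneg ‖(pairScale p : ℂ)⁻¹ * inner ℂ ubar (green p φ)‖
      linarith)
  obtain ⟨eig, h1, h2⟩ := exists_isOrderedEigenvalues
    (fun hf => not_finiteDimensional (p := p) (by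
      have : FiniteDimensional ℂ (PairSpace p) := hf
      exact FiniteDimensional.of_injective
        ((WithLp.linearEquiv 2 ℂ (Y p × ℂ)).symm.toLinearMap ∘ₗ LinearMap.inl ℂ (Y p) ℂ)
        ((WithLp.linearEquiv 2 ℂ (Y p × ℂ)).symm.injective.comp LinearMap.inl_injective)))
    (scaleEquiv p) m (fun s : Icc (0 : ℝ) 1 => family p ubar lbar etaL etaS s) T hTc hTs hTp
    (by
      rintro s z ⟨u, l⟩
      rw [hT]
      have hform : ∀ φ, (green p φ, l) ∈ eigenspace (family p ubar lbar etaL etaS s) z ↔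
          ∀ v, ((s : ℝ) : ℂ) * inner ℂ (S v) (S (WithLp.toLp 2 (φ, pairScale p * l))) +
            (1 - ((s : ℝ) : ℂ)) * inner ℂ v (N (WithLp.toLp 2 (φ, pairScale p * l))) =
            z * inner ℂ (Φ v) (Φ (WithLp.toLp 2 (φ, pairScale p * l))) := fun φ => by
        rw [mem_eigenspace_family_iff_form hu s.2.1 s.2.2 hL1]
        exact ⟨fun h v => h v.fst v.snd, fun h χ k => h (WithLp.toLp 2 (χ, k))⟩
      rw [scaleEquiv_apply]
      constructor
      · intro h
        have hX : u ∈ X p := ((maps_domRestrict_iff.1 (mem_eigenspace_iff.1 h)).1).1.2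
        obtain ⟨φ, rfl⟩ := exists_eq_green hX
        exact ⟨_, hΦa _ _, (hform φ).1 h⟩
      · rintro ⟨⟨φ, k⟩, hy, hv⟩
        rw [hΦa] at hy
        obtain ⟨h3, h4⟩ := Prod.ext_iff.1 (WithLp.toLp_injective 2 hy)
        have h3 : green p φ = u := h3
        have h4 : k = pairScale p * l := h4
        subst h3 h4
        exact (hform φ).2 hv)
  exact ⟨eig, h1, fun t s hts => h2 t s (hTm t s hts)⟩

end SolutionFamily

end ShearKolmogorov

end

theorem proposition3p7 (p : ShearKolmogorov.Params)
    (hrmin : 0 < p.rmin) (hrmax : p.rmin < p.rmax) (hσ : 0 < p.σ)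
    (ubar : ShearKolmogorov.Y p) (hubar : ubar ∈ ShearKolmogorov.X p) (lbar : ℝ)
    (etaL : ℝ) (hetaL : etaL ∈ Set.Ioo (0 : ℝ) 1)
    (etaS : ℝ) (hetaS : etaS ∈ Set.Ioo (0 : ℝ) (ShearKolmogorov.normSq p ubar)) :
    ∃ eig : ℝ → ℕ → ℝ,
      (∀ s ∈ Set.Icc (0 : ℝ) 1, ShearKolmogorov.IsOrderedEigenvalues
        (ShearKolmogorov.family p ubar lbar etaL etaS s) (eig s)) ∧
      ∀ t s : ℝ, 0 ≤ t → t ≤ s → s ≤ 1 → ∀ n : ℕ, eig t n ≤ eig s n := by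
  classical
  have : p.Admissible := ⟨hrmin, hrmax, hσ⟩
  obtain ⟨eig, h1, h2⟩ := ShearKolmogorov.exists_eigenvalues_family hubar lbar hetaL.1 hetaL.2
    hetaS.1 hetaS.2
  -- The zero sequence outside [0, 1] is an arbitrary default.
  refine ⟨fun s => if hs : s ∈ Set.Icc (0 : ℝ) 1 then eig ⟨s, hs⟩ else 0, fun s hs => ?_,
    fun t s ht hts hs n => ?_⟩
  · simp only [dif_pos hs]
    exact h1 ⟨s, hs⟩
  · have h := h2 ⟨t, ht, hts.trans hs⟩ ⟨s, ht.trans hts, hs⟩ hts n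
    simpa only [Set.mem_Icc, ht, hts.trans hs, ht.trans hts, hs, and_self, dite_true] using h
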